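/- **Bipartitioning circuits.** *Circuits.* An $n$-qubit circuit is a finite sequence of gates, each an arbitrary quantum channel (completely positive trace-preserving map) applied to some of the qubits; its size is the number of gates. Let $A,B\subseteq[n]$, let $C_A$ and $C_B$ be circuits acting on the qubits in $A$ and in $B$ respectively, and let $C$, of size $m\ge 1$, be the composition "first $C_A$, then $C_B$". Let $\mathcal N$ be the channel that $C$ implements, $\kappa:=|A\cap B|\le k$ and $d:=2^{\kappa}$. For $f:\{0,1\}^n\to[-1,1]$ put $O_f=\sum_x f(x)|x\rangle\langle x|$. *Procedure.* One run of the cutting procedure does the following. (1) Let $z=1$ with probability $d/(2d+1)$ and $z=0$ otherwise. (2) Prepare $A$ in $|0\rangle$ and apply $C_A$. (3) If $z=0$: choose a uniformly random $\kappa$-qubit Clifford operator $V$ (up to phase), apply $V^\dagger$ to the wires $A\cap B$, measure them with outcome $y$, and prepare them again in the state $V|y\rangle$. If $z=1$: discard the wires $A\cap B$ and prepare them again in $|y\rangle$ for a uniformly random $y\in\{0,1\}^{\kappa}$. (4) Measure the wires $A\setminus B$; with $B\setminus A$ prepared in $|0\rangle$, apply $C_B$ to $B$ and measure $B$. Let $x\in\{0,1\}^n$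 be the collected outcomes (with $0$ on wires outside $A\cup B$), and output $Y=(2d+1)(-1)^z f(x)$. *Device.* A device has $\max\{|A|,|B|\}$ qubits and a classical bit memory. Its elementary steps are: initializing or measuring a qubit; applying a gate of $C$; applying a Hadamard, phase or CNOT gate controlled by a classical bit; a Boolean operation on two bits; drawing a uniform random integer of $b$ binary digits (time $b+1$); one evaluation of $f$; one operation on the running average. A program is a fixed sequence of such steps, which may depend on $C$. *Claim.* For every $\delta\in(0,1)$ there is a constant $c$, depending only on $\delta$, such that for all $C,A,B,k$ as above there is a program for this device that does not depend on $f$, works from any initial content of memory and qubits, applies the gates of $C$ once each and in order, and outputs $(z,x)$ with exactly the law of the cutting procedure; moreover, for every $f$, $|Y|\le 2^{k+1}+1$ and $\mathbb E[Y]=\mathrm{Tr}(O_f\,\mathcal N(|0\rangle\langle 0|^{\otimes n}))$. For every $\varepsilon\in(0,1]$ there is a number $N\ge 1$, the same for all $f$, such that the average of $Y$ over $N$ independent runs of the program is within $\varepsilon$ of $\mathrm{Tr}(O_f\,\mathcal N(|0\rangle\langle 0|^{\otimes n}))$ with probability at least $1-\delta$, and the total time of the estimation is at most $$c\,\frac{4^k(m+k^2)}{\varepsilon^2},$$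 not counting initializations and measurements of single qubits. If these are counted as well and all gates of $C$ act on at most $r\ge 1$ qubits, then the total time is at most $c\,4^k(rm+k^2)/\varepsilon^2$; so it is $O(4^k(m+k^2)/\varepsilon^2)$ for gates of bounded arity. -/

import Mathlib

noncomputable section

namespace CircuitCutting

/-! ### States, channels, gates, circuits

The qubits of a register are indexed by a finite type `W`; computational basis states are bit
strings `W → Bool`, and operators are matrices indexed by bit strings. -/

/-- Operators on the register with qubits `W`. -/
abbrev Op (W : Type) : Type := Matrix (W → Bool) (W → Bool) ℂ

/-- The pure basis state `|s⟩⟨s|`. -/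
def basisState {W : Type} [DecidableEq W] [Fintype W] (s : W → Bool) : Op W :=
  Matrix.single s s 1

/-- The map `Φ ⊗ id` on operators over `ℂ^I ⊗ ℂ^r`. -/
def ampliation {I : Type} (Φ : Matrix I I ℂ →ₗ[ℂ] Matrix I I ℂ) (r : ℕ)
    (M : Matrix (I × Fin r) (I × Fin r) ℂ) : Matrix (I × Fin r) (I × Fin r) ℂ :=
  Matrix.of fun p q => Φ (Matrix.of fun a b => M (a, p.2) (b, q.2)) p.1 q.1

open scoped ComplexOrder in
/-- Quantum channels: completely positive and trace preserving linear maps. -/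
structure IsChannel {I : Type} [Fintype I] (Φ : Matrix I I ℂ →ₗ[ℂ] Matrix I I ℂ) : Prop where
  completely_positive : ∀ (r : ℕ) (M : Matrix (I × Fin r) (I × Fin r) ℂ),
    M.PosSemidef → (ampliation Φ r M).PosSemidef
  trace_preserving : ∀ M, (Φ M).trace = M.trace

open scoped ComplexOrder in
/-- Quantum states (density operators). -/
structure IsState {W : Type} [Fintype W] [DecidableEq W] (ρ : Op W) : Prop where
  posSemidef : ρ.PosSemidef
  trace_eq_one : ρ.trace = 1

/-- `Φ` applied to the qubits `e '' K` of the register `W`, tensored with the identity on all other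
qubits (`e` is injective in all uses). -/
def applyOn {K W : Type} (Φ : Op K →ₗ[ℂ] Op K) (e : K → W) (M : Op W) : Op W :=
  Matrix.of fun s t =>
    Φ (Matrix.of fun u v => M (Function.extend e u s) (Function.extend e v t)) (s ∘ e) (t ∘ e)

/-- A gate: a quantum channel on finitely many qubits. -/
structure Gate where
  arity : ℕ
  map : Op (Fin arity) →ₗ[ℂ] Op (Fin arity)
  isChannel : IsChannel map

/-- A gate together with the distinct wires it is applied to. -/
structure PlacedGate (W : Type) where
  gate : Gate
  wires : Fin gate.arity ↪ W

/-- A circuit on the qubits `W`, its gates listed in an order of application. Its size is the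
length of the list. -/
abbrev Circuit (W : Type) : Type := List (PlacedGate W)

/-- The channel implemented by a circuit. -/
def Circuit.run {W : Type} (C : Circuit W) (M : Op W) : Op W :=
  C.foldl (fun M g => applyOn g.gate.map g.wires M) M

/-- A circuit on a set `A` of the `n` qubits, seen as a circuit on all `n` qubits. -/
def Circuit.lift {n : ℕ} {A : Finset (Fin n)} (C : Circuit A) : Circuit (Fin n) :=
  List.map (fun g => ⟨g.gate, g.wires.trans (Function.Embedding.subtype _)⟩) C

/-- `Tr (O_f 𝒩(|0…0⟩⟨0…0|))` for the channel `𝒩` implemented by `C` and the diagonal observable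
`O_f = ∑ₓ f(x) |x⟩⟨x|`. -/
def expectationValue {n : ℕ} (C : Circuit (Fin n)) (f : (Fin n → Bool) → ℝ) : ℂ :=
  (Matrix.diagonal (fun x => (f x : ℂ)) * C.run (basisState fun _ => false)).trace

/-- The unitary channel `M ↦ V M V†`. -/
def conj {I : Type} [Fintype I] (V : Matrix I I ℂ) : Matrix I I ℂ →ₗ[ℂ] Matrix I I ℂ where
  toFun M := V * M * V.conjTranspose
  map_add' M N := by rw [Matrix.mul_add, Matrix.add_mul]
  map_smul' c M := by simp

/-! ### Random Clifford operators -/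

/-- The single-qubit Pauli matrices `I, X, Y, Z`. -/
def pauli : Fin 4 → Matrix Bool Bool ℂ :=
  ![1,
    Matrix.of fun s t => if s = t then 0 else 1,
    Matrix.of fun s t => if s = t then 0 else if s then Complex.I else -Complex.I,
    Matrix.of fun s t => if s = t then (if s then -1 else 1) else 0]

/-- The tensor product of single-qubit Pauli matrices. -/
def pauliString {K : Type} [Fintype K] (p : K → Fin 4) : Op K :=
  Matrix.of fun s t => ∏ w, pauli (p w) (s w) (t w)

/-- Clifford operators: unitaries that conjugate Pauli operators into the Pauli group
`{i^j P : P a Pauli string}`. -/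
def IsClifford {K : Type} [Fintype K] [DecidableEq K] (V : Op K) : Prop :=
  V ∈ Matrix.unitaryGroup (K → Bool) ℂ ∧
    ∀ p : K → Fin 4, ∃ (j : ℕ) (p' : K → Fin 4),
      V * pauliString p * V.conjTranspose = Complex.I ^ j • pauliString p'

/-- Clifford operators up to a global phase: operators that induce the same channel are identified.
This is a finite set. -/
def CliffordClass (K : Type) [Fintype K] [DecidableEq K] : Type :=
  Quotient (Setoid.ker fun V : {V : Op K // IsClifford V} => conj V.1)

/-- The expectation of `F V` over a uniformly random Clifford operator `V`, for a function `F` that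
does not depend on the global phase of `V`. -/
def cliffordMean {K : Type} [Fintype K] [DecidableEq K] (F : Op K → ℝ) : ℝ :=
  (∑ᶠ v : CliffordClass K, F (Quotient.out v).1) / (Nat.card (CliffordClass K) : ℝ)

/-! ### The cutting procedure -/

section Cutting

variable {n : ℕ} {A B : Finset (Fin n)}

/-- The cut wires `A ∩ B` inside `A`. -/
def cutInLeft (w : ↥(A ∩ B)) : A := ⟨w.1, (Finset.mem_inter.mp w.2).1⟩

/-- The cut wires `A ∩ B` inside `B`. -/
def cutInRight (w : ↥(A ∩ B)) : B := ⟨w.1, (Finset.mem_inter.mp w.2).2⟩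

/-- The probability that measuring all wires of `A` gives `a`, after `C_A` has been applied to
`|0⟩` and then `V†` to the cut wires. -/
def leftProb (CA : Circuit A) (V : Op ↥(A ∩ B)) (a : A → Bool) : ℝ :=
  (applyOn (conj V.conjTranspose) cutInLeft (CA.run (basisState fun _ => false)) a a).re

/-- The bit string with `y` on the cut wires and `0` on the other wires of `B`. -/
def preparedBits (y : ↥(A ∩ B) → Bool) (w : B) : Bool :=
  if h : w.1 ∈ A then y ⟨w.1, Finset.mem_inter.mpr ⟨h, w.2⟩⟩ else false

/-- The probability that measuring all wires of `B` gives `b`, after preparing `V|y⟩` on the cut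
wires and `|0⟩` on the other wires of `B` and applying `C_B`. -/
def rightProb (CB : Circuit B) (V : Op ↥(A ∩ B)) (y : ↥(A ∩ B) → Bool) (b : B → Bool) : ℝ :=
  (CB.run (applyOn (conj V) cutInRight (basisState (preparedBits y))) b b).re

/-- The output string: `b` on `B`, `a` on `A \ B`, and `0` on wires that no circuit uses. -/
def assemble (a : A → Bool) (b : B → Bool) (w : Fin n) : Bool :=
  if h : w ∈ B then b ⟨w, h⟩ else if h' : w ∈ A then a ⟨w, h'⟩ else false

/-- The joint probability of `(z, x)` in one run of the cutting procedure. With `d = 2^|A ∩ B|`: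
* `z = 1` (`true`) with probability `d / (2d + 1)`, otherwise `z = 0` (`false`);
* `C_A` is applied to `|0⟩` on `A`;
* if `z = 0`, then `V†` is applied to the cut wires for a random Clifford `V`, they are measured with
  outcome `y`, and they are prepared again in the state `V|y⟩`;
* if `z = 1`, then the cut wires are discarded and prepared again in `|y⟩` for a uniformly random `y`;
* the wires of `A \ B` are measured, `C_B` is applied to `B` (with `|0⟩` on `B \ A`), and the wires of
  `B` are measured; `x` collects these results. -/
def cuttingLaw (CA : Circuit A) (CB : Circuit B) : Bool × (Fin n → Bool) → ℝ
  | (false, x) =>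
    (2 ^ (A ∩ B).card + 1) / (2 * 2 ^ (A ∩ B).card + 1) *
      cliffordMean fun V : Op ↥(A ∩ B) =>
        ∑ a : A → Bool, ∑ b : B → Bool,
          if assemble a b = x then leftProb CA V a * rightProb CB V (a ∘ cutInLeft) b else 0
  | (true, x) =>
    2 ^ (A ∩ B).card / (2 * 2 ^ (A ∩ B).card + 1) *
      ((1 / 2 ^ (A ∩ B).card) * ∑ y : ↥(A ∩ B) → Bool,
        ∑ a : A → Bool, ∑ b : B → Bool,
          if assemble a b = x then leftProb CA (1 : Op ↥(A ∩ B)) a * rightProb CB 1 y b else 0)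

end Cutting

/-- The estimator `Y = (2^(κ+1) + 1) (-1)^z f(x)` returned by a run with `κ` cut wires. -/
def estimator {n : ℕ} (κ : ℕ) (f : (Fin n → Bool) → ℝ) (o : Bool × (Fin n → Bool)) : ℝ :=
  (2 ^ (κ + 1) + 1) * (if o.1 then -1 else 1) * f o.2

/-! ### A quantum device with classical memory, and its running time -/

/-- The Hadamard gate. -/
def hadamardMap : Op (Fin 1) →ₗ[ℂ] Op (Fin 1) :=
  conj (Matrix.of fun s t => (if s 0 && t 0 then -1 else 1) / (Real.sqrt 2 : ℂ))

/-- The phase gate `diag(1, i)`. -/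
def phaseMap : Op (Fin 1) →ₗ[ℂ] Op (Fin 1) :=
  conj (Matrix.of fun s t => if s = t then (if s 0 then Complex.I else 1) else 0)

/-- The controlled-not gate with control `0` and target `1`. -/
def cnotMap : Op (Fin 2) →ₗ[ℂ] Op (Fin 2) :=
  conj (Matrix.of fun s t => if s 0 = t 0 ∧ s 1 = xor (t 0) (t 1) then 1 else 0)

/-- Replacing the state of a qubit by `|0⟩`. -/
def resetMap : Op (Fin 1) →ₗ[ℂ] Op (Fin 1) where
  toFun M := M.trace • basisState fun _ => false
  map_add' M N := by rw [Matrix.trace_add, add_smul]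
  map_smul' c M := by simp [Matrix.trace_smul, smul_smul]

/-- The compression `M ↦ Π M Π` to the outcome `b` of a measurement of qubit `w`. -/
def project {W : Type} (w : W) (b : Bool) (M : Op W) : Op W :=
  Matrix.of fun s t => if s w = b ∧ t w = b then M s t else 0

/-- Elementary operations of a device with `q` qubits and `s` classical bits. -/
inductive Instr (q s : ℕ) where
  /-- set qubit `w` to `|0⟩` -/
  | reset (w : Fin q)
  /-- measure qubit `w` in the computational basis and store the outcome in bit `i` -/
  | measure (w : Fin q) (i : Fin s)
  /-- apply the gate `g` of the simulated circuit to the device qubits `e` -/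
  | gate (g : Gate) (e : Fin g.arity ↪ Fin q)
  /-- apply a Hadamard gate to `w` if bit `i` is set -/
  | hadamard (i : Fin s) (w : Fin q)
  /-- apply a phase gate to `w` if bit `i` is set -/
  | phase (i : Fin s) (w : Fin q)
  /-- apply a controlled-not gate to the two qubits `e` if bit `i` is set -/
  | cnot (i : Fin s) (e : Fin 2 ↪ Fin q)
  /-- store `g (bit i) (bit j)` in bit `l` -/
  | logic (g : Bool → Bool → Bool) (i j l : Fin s)
  /-- draw an integer uniformly from `{0, …, N - 1}` and store its `b` binary digits in `dest` -/
  | uniform (N b : ℕ) (hN : 0 < N) (hb : N ≤ 2 ^ b) (dest : Fin b ↪ Fin s)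

/-- States of the device: to each content of the classical memory its subnormalized density operator
on the qubits. The trace is the probability of that content. -/
abbrev DeviceState (q s : ℕ) : Type := (Fin s → Bool) → Op (Fin q)

/-- The effect of a deterministic update of the classical memory. -/
def updateMemory {q s : ℕ} (u : (Fin s → Bool) → (Fin s → Bool)) (σ : DeviceState q s) :
    DeviceState q s :=
  fun μ => ∑ μ', if u μ' = μ then σ μ' else 0

/-- The effect of an elementary operation. -/
def Instr.step {q s : ℕ} (σ : DeviceState q s) : Instr q s → DeviceState q s
  | .reset w => fun μ => applyOn resetMap (fun _ => w) (σ μ)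
  | .measure w i => ∑ b : Bool,
      updateMemory (fun μ => Function.update μ i b) (fun μ => project w b (σ μ))
  | .gate g e => fun μ => applyOn g.map e (σ μ)
  | .hadamard i w => fun μ => if μ i then applyOn hadamardMap (fun _ => w) (σ μ) else σ μ
  | .phase i w => fun μ => if μ i then applyOn phaseMap (fun _ => w) (σ μ) else σ μ
  | .cnot i e => fun μ => if μ i then applyOn cnotMap e (σ μ) else σ μ
  | .logic g i j l => updateMemory (fun μ => Function.update μ l (g (μ i) (μ j))) σ
  | .uniform N _ _ _ dest => (1 / (N : ℂ)) • ∑ v : Fin N,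
      updateMemory (fun μ => Function.extend dest (fun t => v.1.testBit t) μ) σ

/-- The time of an operation: one step, and one step per digit (plus one) for a random integer. -/
def Instr.time {q s : ℕ} : Instr q s → ℕ
  | .uniform _ b _ _ _ => b + 1
  | _ => 1

/-- The same, but without initializations and measurements of single qubits. -/
def Instr.gateTime {q s : ℕ} : Instr q s → ℕ
  | .reset _ => 0
  | .measure _ _ => 0
  | .uniform _ b _ _ _ => b + 1
  | _ => 1

/-- The gate of the simulated circuit that the operation applies, if any. -/
def Instr.appliedGate {q s : ℕ} : Instr q s → Option Gate
  | .gate g _ => some g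
  | _ => none

/-- A program for a device with `q` qubits that outputs a bit `z` and an `n`-bit string `x`: a sequence
of elementary operations, all of them executed in order, and the addresses of the output bits. -/
structure Program (q n : ℕ) where
  bits : ℕ
  code : List (Instr q bits)
  outZ : Fin bits
  outX : Fin n → Fin bits

/-- The probability of output `o` if the device starts with memory `μ₀` and qubits in state `ρ`. -/
def Program.outputProb {q n : ℕ} (P : Program q n) (μ₀ : Fin P.bits → Bool) (ρ : Op (Fin q))
    (o : Bool × (Fin n → Bool)) : ℂ :=
  ∑ μ, if (μ P.outZ, μ ∘ P.outX) = o then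
    (P.code.foldl Instr.step (fun μ => if μ = μ₀ then ρ else 0) μ).trace else 0

/-- The output of `P` has law `p`, from whatever content of memory and qubits it is started (so that
all initialization is done by `P`, and `P` can be repeated on the same device). -/
def Program.Samples {q n : ℕ} (P : Program q n) (p : PMF (Bool × (Fin n → Bool))) : Prop :=
  ∀ (μ₀ : Fin P.bits → Bool) (ρ : Op (Fin q)), IsState ρ →
    ∀ o, P.outputProb μ₀ ρ o = ((p o).toReal : ℂ)

/-- The gates of the simulated circuit that `P` applies, in order. -/
def Program.appliedGates {q n : ℕ} (P : Program q n) : List Gate :=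
  P.code.filterMap Instr.appliedGate

/-- The running time of one execution of `P`. -/
def Program.time {q n : ℕ} (P : Program q n) : ℕ := (P.code.map Instr.time).sum

/-- The running time of one execution of `P`, initializations and measurements not counted. -/
def Program.gateTime {q n : ℕ} (P : Program q n) : ℕ := (P.code.map Instr.gateTime).sum

/-- The time for averaging an estimator over `N` samples, if a sample takes time `t`: for each of them
one evaluation of `f` and one addition, and one final normalization. -/
def averagingTime (N t : ℕ) : ℕ := N * (t + 2) + 1

end CircuitCutting

end

open CircuitCutting

/-! Let M be an operator on the κ cut wires and d = 2^κ. Measuring M in the basis V|y⟩ and preparing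
the observed basis state again gives, on average over a random Clifford V, the operator (Tr(M) I +
M)/(d+1). Hence M equals (d+1) times this average minus d times the operator Tr(M) I/d. The identity
on the cut wires is thus a signed combination of two channels that transmit only classical
information, and its coefficients have absolute sum 2d+1. Choosing a channel with probability
proportional to its coefficient, and multiplying f(x) by the sign and by 2d+1, gives an unbiased
estimator (`cuttingLaw_unbiased`, `sum_cuttingLaw_mul_estimator`). This uses that the weight of x
after the uncut circuit is a linear function of the cut state (`run_lift_append_apply`).

The average is obtained from an explicit family. The computational basis with weight 1, and the
graph-state bases D H^{⊗κ} with total weight d, where D is a product of randomly selected phase and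
controlled-Z gates, already sum to Tr(M) I + M (`measurePrepare_design`): sums of products of four
matrix entries factor over wires and pairs of wires, and some factor vanishes unless the four index
strings match in pairs (`sum_graphUnitary_prod_eq`). These basis changes are Clifford and the
uniform mean is invariant under right multiplication, so the identity passes to the Clifford mean
(`cliffordMean_measurePrepare`).

The same family makes a run cheap. Only the law of (z, x) matters, so for z = 0 the random Clifford
may be replaced by the computational basis with probability 1/(d+1) and a uniform graph-state basis
otherwise (`cliffordMean_cutProb_eq_graph`). This needs one integer below 2d+1, κ² random bits and
O(κ²) controlled gates. The two circuits use the same device qubits in succession, restricted to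
wires that are cut or touched by a gate (`Circuit.exists_restriction`), so that initializations and
measurements are bounded by the arities. The output law is computed in the Heisenberg picture, by
pulling the output functional back through the code (`pullCode`, `cuttingProgram_outputProb`,
`cuttingProgram_samples`).

Finally |Y| ≤ 2^(k+1)+1 ≤ 3·2^k, so by Chebyshev's inequality O(4^k/(δε²)) runs suffice
(`one_sub_le_pi_abs_mean_sub_le`). -/

noncomputable section

namespace CircuitCutting

open Function

set_option linter.unusedSectionVars false

/-! ### Operations on a part of a register -/

section Extend

variable {K L W : Type} {e : K → W}

lemma extend_comp_eq (he : Injective e) (u : K → Bool) (s : W → Bool) : extend e u s ∘ e = u :=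
  funext fun k => he.extend_apply u s k

lemma extend_comp_self (s : W → Bool) (he : Injective e) : extend e (s ∘ e) s = s := by
  funext w
  by_cases h : ∃ k, e k = w
  · obtain ⟨k, rfl⟩ := h
    rw [he.extend_apply]; rfl
  · rw [extend_apply' _ _ _ h]

lemma extend_extend_left (he : Injective e) (u v : K → Bool) (s : W → Bool) :
    extend e u (extend e v s) = extend e u s := by
  funext w
  by_cases h : ∃ k, e k = w
  · obtain ⟨k, rfl⟩ := h
    rw [he.extend_apply, he.extend_apply]
  · rw [extend_apply' _ _ _ h, extend_apply' _ _ _ h, extend_apply' _ _ _ h]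

lemma extend_comp_extend (he : Injective e) {g : L → K} (hg : Injective g) (u : L → Bool)
    (s : W → Bool) : extend (e ∘ g) u s = extend e (extend g u (s ∘ e)) s := by
  funext w
  by_cases h : ∃ k, e k = w
  · obtain ⟨k, rfl⟩ := h
    rw [he.extend_apply]
    by_cases h' : ∃ l, g l = k
    · obtain ⟨l, rfl⟩ := h'
      rw [hg.extend_apply]
      exact (he.comp hg).extend_apply u s l
    · rw [extend_apply' _ _ _ h', extend_apply']
      · rfl
      · rintro ⟨l, hl⟩
        exact h' ⟨l, he hl⟩
  · rw [extend_apply' _ _ _ h, extend_apply']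
    rintro ⟨l, hl⟩
    exact h ⟨g l, hl⟩

/-- A bit string, split into its restriction along `e` and the rest. -/
def splitEquiv (he : Injective e) :
    (W → Bool) ≃ (K → Bool) × {s : W → Bool // s ∘ e = fun _ => false} where
  toFun s := (s ∘ e, ⟨extend e (fun _ => false) s, extend_comp_eq he _ _⟩)
  invFun p := extend e p.1 p.2.1
  left_inv s := by
    simp only [extend_extend_left he, extend_comp_self s he]
  right_inv := by
    rintro ⟨u, s, hs⟩
    simp only [extend_comp_eq he, extend_extend_left he, Prod.mk.injEq, true_and, Subtype.mk.injEq]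
    rw [← hs, extend_comp_self s he]

end Extend

/-! ### Blocks of an operator and partial traces -/

section Block

variable {K L W : Type} {e : K → W}

/-- The block of `M` that an operation on the qubits `e` acts on, at the entry `(s, t)`. -/
def block (e : K → W) (M : Op W) (s t : W → Bool) : Op K :=
  Matrix.of fun u v => M (extend e u s) (extend e v t)

lemma applyOn_apply (Φ : Op K →ₗ[ℂ] Op K) (e : K → W) (M : Op W) (s t : W → Bool) :
    applyOn Φ e M s t = Φ (block e M s t) (s ∘ e) (t ∘ e) := rfl

lemma block_add (M N : Op W) (s t : W → Bool) :
    block e (M + N) s t = block e M s t + block e N s t := rfl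

lemma block_smul (c : ℂ) (M : Op W) (s t : W → Bool) :
    block e (c • M) s t = c • block e M s t := rfl

/-- `applyOn` as a linear map. -/
def applyOnLin (Φ : Op K →ₗ[ℂ] Op K) (e : K → W) : Op W →ₗ[ℂ] Op W where
  toFun := applyOn Φ e
  map_add' M N := by
    ext s t
    simp [applyOn_apply, block_add]
  map_smul' c M := by
    ext s t
    simp [applyOn_apply, block_smul]

lemma applyOnLin_apply (Φ : Op K →ₗ[ℂ] Op K) (e : K → W) (M : Op W) :
    applyOnLin Φ e M = applyOn Φ e M := rfl

/-- A block depends on `s` and `t` only outside `e`, so the operation acts on each block separately.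
The composition rules below follow from this. -/
lemma block_applyOn (he : Injective e) (Φ : Op K →ₗ[ℂ] Op K) (M : Op W) (s t : W → Bool) :
    block e (applyOn Φ e M) s t = Φ (block e M s t) := by
  ext u v
  simp only [block, Matrix.of_apply, applyOn_apply, extend_comp_eq he, extend_extend_left he]

lemma applyOn_applyOn (he : Injective e) (Φ Ψ : Op K →ₗ[ℂ] Op K) (M : Op W) :
    applyOn Φ e (applyOn Ψ e M) = applyOn (Φ ∘ₗ Ψ) e M := by
  ext s t
  rw [applyOn_apply, block_applyOn he]; rfl

lemma applyOn_id (he : Injective e) (M : Op W) : applyOn LinearMap.id e M = M := by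
  ext s t
  simp [applyOn_apply, block, extend_comp_self _ he]

lemma applyOn_comp (he : Injective e) {g : L → K} (hg : Injective g) (Φ : Op L →ₗ[ℂ] Op L)
    (M : Op W) : applyOn Φ (e ∘ g) M = applyOn (applyOnLin Φ g) e M := by
  ext s t
  have h : block (e ∘ g) M s t = block g (block e M s t) (s ∘ e) (t ∘ e) := by
    ext u v
    simp [block, extend_comp_extend he hg]
  rw [applyOn_apply, applyOn_apply, applyOnLin_apply, applyOn_apply, h]
  rfl

lemma block_applyOn_comp (he : Injective e) {g : L → K} (hg : Injective g)
    (Φ : Op L →ₗ[ℂ] Op L) (M : Op W) (s t : W → Bool) :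
    block e (applyOn Φ (e ∘ g) M) s t = applyOn Φ g (block e M s t) := by
  rw [applyOn_comp he hg, block_applyOn he, applyOnLin_apply]

lemma apply_eq_block (he : Injective e) (M : Op W) (s t : W → Bool) :
    M s t = block e M s t (s ∘ e) (t ∘ e) := by
  simp [block, extend_comp_self _ he]

variable [Fintype W] [DecidableEq W] [Fintype K]

/-- The partial trace onto the qubits `e`. -/
def partialTrace (e : K → W) (M : Op W) : Op K :=
  -- Strings vanishing on `e` serve as indices for the other qubits, so each configuration of the
  -- traced-out part is counted once.
  ∑ s : W → Bool, if s ∘ e = (fun _ => false) then block e M s s else 0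

/-- Operations inside a register commute with discarding the rest. The device can therefore be
analysed on a register while its other qubits are in an unknown state. -/
lemma partialTrace_applyOn (he : Injective e) {g : L → K} (hg : Injective g)
    (Φ : Op L →ₗ[ℂ] Op L) (M : Op W) :
    partialTrace e (applyOn Φ (e ∘ g) M) = applyOn Φ g (partialTrace e M) := by
  rw [← applyOnLin_apply Φ g, partialTrace, partialTrace, map_sum]
  refine Finset.sum_congr rfl fun s _ => ?_
  split_ifs
  · rw [block_applyOn_comp he hg, applyOnLin_apply]
  · simp

lemma partialTrace_apply_self (he : Injective e) (M : Op W) (u : K → Bool) :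
    partialTrace e M u u = ∑ s : W → Bool, if s ∘ e = u then M s s else 0 := by
  rw [partialTrace, Matrix.sum_apply]
  simp only [apply_ite (fun N : Op K => N u u), Matrix.zero_apply, ← Finset.sum_filter]
  refine Finset.sum_nbij' (fun s => extend e u s) (fun s => extend e (fun _ => false) s) ?_ ?_ ?_ ?_ ?_
  · simp [extend_comp_eq he]
  · simp [extend_comp_eq he]
  · intro s hs
    rw [extend_extend_left he, ← (Finset.mem_filter.mp hs).2, extend_comp_self _ he]
  · intro s hs
    rw [extend_extend_left he, ← (Finset.mem_filter.mp hs).2, extend_comp_self _ he]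
  · intro s _
    rfl

variable [DecidableEq K]

lemma trace_partialTrace (he : Injective e) (M : Op W) :
    (partialTrace e M).trace = M.trace := by
  classical
  have h : (partialTrace e M).trace
      = ∑ u : K → Bool, ∑ s : W → Bool, if s ∘ e = u then M s s else 0 :=
    Finset.sum_congr rfl fun u _ => partialTrace_apply_self he M u
  rw [h, Finset.sum_comm]
  simp [Matrix.trace]

lemma trace_applyOn (he : Injective e) (Φ : Op K →ₗ[ℂ] Op K)
    (hΦ : ∀ N, (Φ N).trace = N.trace) (M : Op W) : (applyOn Φ e M).trace = M.trace := by
  have h := partialTrace_applyOn (e := e) he (g := id) injective_id Φ M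
  rw [Function.comp_id] at h
  rw [← trace_partialTrace he, h, ← trace_partialTrace he M, ← hΦ (partialTrace e M)]
  congr 1
  ext s t
  have h' : block id (partialTrace e M) s t = partialTrace e M := by
    ext u v
    simp [block]
  rw [applyOn_apply, h']
  rfl

open scoped ComplexOrder in
lemma posSemidef_applyOn (he : Injective e) {Φ : Op K →ₗ[ℂ] Op K}
    (hΦ : IsChannel Φ) {M : Op W} (hM : M.PosSemidef) : (applyOn Φ e M).PosSemidef := by
  classical
  let R := {s : W → Bool // s ∘ e = fun _ => false}
  -- Once the qubits outside `e` are numbered by a single index, `applyOn` is an ampliation of Φ,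
  -- and complete positivity applies.
  let φ : (K → Bool) × Fin (Fintype.card R) ≃ (W → Bool) :=
    ((Equiv.refl _).prodCongr (Fintype.equivFin R).symm).trans (splitEquiv he).symm
  have h1 := hΦ.completely_positive _ _ (hM.submatrix φ)
  have h2 : ampliation Φ (Fintype.card R) (M.submatrix φ φ) = (applyOn Φ e M).submatrix φ φ := by
    ext ⟨u, i⟩ ⟨v, j⟩
    simp only [ampliation, Matrix.of_apply, Matrix.submatrix_apply, applyOn_apply, block]
    simp only [φ, splitEquiv, Equiv.trans_apply, Equiv.prodCongr_apply, Prod.map_apply,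
      Equiv.refl_apply, Equiv.coe_fn_symm_mk, extend_comp_eq he, extend_extend_left he]
  rw [h2] at h1
  exact (Matrix.posSemidef_submatrix_equiv φ).mp h1

end Block

/-! ### Circuits -/

section Circuits

variable {W W' : Type}

/-- A circuit with its wires renamed. -/
def Circuit.mapWires (ι : W ↪ W') (C : Circuit W) : Circuit W' :=
  List.map (fun g => ⟨g.gate, g.wires.trans ι⟩) C

lemma Circuit.lift_eq_mapWires {n : ℕ} {A : Finset (Fin n)} (C : Circuit A) :
    C.lift = C.mapWires (Embedding.subtype _) := rfl

lemma Circuit.run_cons (g : PlacedGate W) (C : Circuit W) (M : Op W) :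
    Circuit.run (g :: C) M = Circuit.run C (applyOn g.gate.map g.wires M) := rfl

lemma Circuit.run_append (C D : Circuit W) (M : Op W) :
    Circuit.run (C ++ D) M = Circuit.run D (Circuit.run C M) := by
  simp [Circuit.run, List.foldl_append]

/-- `Circuit.run` as a linear map. -/
def Circuit.runLin (C : Circuit W) : Op W →ₗ[ℂ] Op W where
  toFun := C.run
  map_add' M N := by
    induction C generalizing M N with
    | nil => rfl
    | cons g C ih =>
      simp only [Circuit.run_cons]
      rw [← applyOnLin_apply, map_add, ih]; rfl
  map_smul' c M := by
    induction C generalizing M with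
    | nil => rfl
    | cons g C ih =>
      simp only [Circuit.run_cons]
      rw [← applyOnLin_apply, map_smul, ih]; rfl

lemma Circuit.runLin_apply (C : Circuit W) (M : Op W) : C.runLin M = C.run M := rfl

/-- A circuit confined to a register acts on each block by itself. This handles entries with fixed
bits outside the register, as `Circuit.partialTrace_run` handles discarded qubits. -/
lemma Circuit.block_run (ι : W ↪ W') (C : Circuit W) (M : Op W') (s t : W' → Bool) :
    block ι ((C.mapWires ι).run M) s t = C.run (block ι M s t) := by
  induction C generalizing M with
  | nil => rfl
  | cons g C ih =>
    have h := ih (applyOn g.gate.map (ι ∘ g.wires) M)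
    rw [block_applyOn_comp ι.injective g.wires.injective] at h
    exact h

lemma Circuit.partialTrace_run [Fintype W'] [DecidableEq W'] [Fintype W]
    (ι : W ↪ W') (C : Circuit W)
    (M : Op W') : partialTrace ι ((C.mapWires ι).run M) = C.run (partialTrace ι M) := by
  induction C generalizing M with
  | nil => rfl
  | cons g C ih =>
    have h := ih (applyOn g.gate.map (ι ∘ g.wires) M)
    rw [partialTrace_applyOn ι.injective g.wires.injective] at h
    exact h

variable [Fintype W] [DecidableEq W]

open scoped ComplexOrder in
lemma Circuit.posSemidef_run (C : Circuit W) {M : Op W} (hM : M.PosSemidef) :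
    (C.run M).PosSemidef := by
  induction C generalizing M with
  | nil => exact hM
  | cons g C ih => exact ih (posSemidef_applyOn g.wires.injective g.gate.isChannel hM)

lemma Circuit.trace_run (C : Circuit W) (M : Op W) : (C.run M).trace = M.trace := by
  induction C generalizing M with
  | nil => rfl
  | cons g C ih =>
    rw [Circuit.run_cons, ih,
      trace_applyOn g.wires.injective _ g.gate.isChannel.trace_preserving]

open scoped ComplexOrder in
lemma posSemidef_basisState (s : W → Bool) : (basisState s).PosSemidef := by
  have : basisState s = Matrix.diagonal (Pi.single s (1 : ℂ)) := by
    rw [basisState, Matrix.diagonal_single]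
  rw [this, Matrix.posSemidef_diagonal_iff]
  intro t
  by_cases h : t = s
  · subst h; simp
  · simp [h]

lemma trace_basisState (s : W → Bool) : (basisState s).trace = 1 := by
  simp [basisState]

lemma basisState_apply (s t u : W → Bool) :
    basisState s t u = if s = t ∧ s = u then 1 else 0 := by
  simp [basisState, Matrix.single_apply]

open scoped ComplexOrder in
lemma isChannel_conj {I : Type} [Fintype I] [DecidableEq I] {V : Matrix I I ℂ}
    (hV : V ∈ Matrix.unitaryGroup I ℂ) : IsChannel (conj V) where
  completely_positive r M hM := by
    classical
    -- The ampliation is conjugation by V ⊗ 1, which preserves positivity.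
    have h : ampliation (conj V) r M = (Matrix.kroneckerMap (· * ·) V (1 : Matrix (Fin r) (Fin r) ℂ))
        * M * (Matrix.kroneckerMap (· * ·) V (1 : Matrix (Fin r) (Fin r) ℂ)).conjTranspose := by
      ext ⟨a, i⟩ ⟨b, j⟩
      simp [ampliation, conj, Matrix.mul_apply, Fintype.sum_prod_type, Matrix.one_apply,
        Finset.sum_mul, Matrix.kroneckerMap_apply, apply_ite]
    rw [h]
    exact hM.mul_mul_conjTranspose_same _
  trace_preserving M := by
    have h : V.conjTranspose * V = 1 := Matrix.mem_unitaryGroup_iff'.mp hV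
    change (V * M * V.conjTranspose).trace = M.trace
    rw [Matrix.trace_mul_comm, ← Matrix.mul_assoc, h, Matrix.one_mul]

open scoped ComplexOrder in
lemma diag_re_nonneg {I : Type} [Fintype I] {M : Matrix I I ℂ} (hM : M.PosSemidef) (s : I) :
    0 ≤ (M s s).re ∧ (((M s s).re : ℝ) : ℂ) = M s s := by
  have h := hM.diag_nonneg (i := s)
  rw [Complex.nonneg_iff] at h
  exact ⟨h.1, Complex.ext rfl h.2⟩

end Circuits

/-! ### Tensor products of single-qubit operators -/

section Tensor

variable {K : Type} [Fintype K]

/-- The tensor product of single-qubit operators. -/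
def tensor (U : K → Matrix Bool Bool ℂ) : Op K :=
  Matrix.of fun s t => ∏ w, U w (s w) (t w)

lemma tensor_apply (U : K → Matrix Bool Bool ℂ) (s t : K → Bool) :
    tensor U s t = ∏ w, U w (s w) (t w) := rfl

lemma pauliString_eq_tensor (p : K → Fin 4) : pauliString p = tensor fun w => pauli (p w) := rfl

lemma tensor_smul (c : K → ℂ) (U : K → Matrix Bool Bool ℂ) :
    tensor (fun w => c w • U w) = (∏ w, c w) • tensor U := by
  ext s t
  simp [tensor_apply, Finset.prod_mul_distrib]

lemma tensor_conjTranspose (U : K → Matrix Bool Bool ℂ) :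
    (tensor U).conjTranspose = tensor fun w => (U w).conjTranspose := by
  ext s t
  simp [tensor_apply, Matrix.conjTranspose_apply]

variable [DecidableEq K]

lemma tensor_mul (U V : K → Matrix Bool Bool ℂ) :
    tensor U * tensor V = tensor fun w => U w * V w := by
  ext s t
  simp only [Matrix.mul_apply, tensor_apply, ← Finset.prod_mul_distrib]
  rw [Finset.prod_univ_sum, Fintype.piFinset_univ]

lemma tensor_one : tensor (fun _ : K => (1 : Matrix Bool Bool ℂ)) = 1 := by
  ext s t
  rw [tensor_apply, Matrix.one_apply]
  simp only [Matrix.one_apply]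
  split_ifs with h
  · simp [h]
  · obtain ⟨w, hw⟩ := Function.ne_iff.mp h
    exact Finset.prod_eq_zero (Finset.mem_univ w) (if_neg hw)

/-- Expansion of a tensor product of linear combinations of Pauli matrices. -/
lemma tensor_sum_pauli (c : K → Fin 4 → ℂ) :
    tensor (fun w => ∑ j, c w j • pauli j) = ∑ p : K → Fin 4, (∏ w, c w (p w)) • pauliString p := by
  ext s t
  simp only [tensor_apply, Matrix.sum_apply, Matrix.smul_apply, smul_eq_mul, pauliString,
    Matrix.of_apply, ← Finset.prod_mul_distrib]
  rw [Finset.prod_univ_sum]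
  simp

end Tensor

/-! ### Pauli strings span all operators -/

section Pauli

lemma exists_pauli_expansion (M : Matrix Bool Bool ℂ) : ∃ c : Fin 4 → ℂ, M = ∑ j, c j • pauli j := by
  refine ⟨![(M false false + M true true) / 2, (M false true + M true false) / 2,
    Complex.I * (M false true - M true false) / 2, (M false false - M true true) / 2], ?_⟩
  ext s t
  cases s <;> cases t <;>
    simp [Fin.sum_univ_four, pauli, Matrix.sum_apply] <;> ring_nf <;>
    simp [Complex.I_sq] <;> ring

variable {K : Type} [Fintype K] [DecidableEq K]

lemma basis_eq_tensor (s t : K → Bool) :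
    (Matrix.single s t 1 : Op K) = tensor fun w => Matrix.single (s w) (t w) 1 := by
  ext u v
  rw [tensor_apply, Matrix.single_apply]
  simp only [Matrix.single_apply]
  split_ifs with h
  · simp [← h.1, ← h.2]
  · rw [not_and_or] at h
    rcases h with h | h <;> obtain ⟨w, hw⟩ := Function.ne_iff.mp h <;>
      exact (Finset.prod_eq_zero (Finset.mem_univ w) (if_neg fun h => hw (by first | exact h.1 | exact h.2))).symm

/-- Each matrix unit is a tensor product of single-qubit matrices, and these are combinations of
Pauli matrices. -/
lemma linearMap_ext_pauliString {Φ Ψ : Op K →ₗ[ℂ] Op K}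
    (h : ∀ p, Φ (pauliString p) = Ψ (pauliString p)) : Φ = Ψ := by
  refine Matrix.ext_linearMap (R := ℂ) fun s t => LinearMap.ext_ring ?_
  change Φ (Matrix.single s t 1) = Ψ (Matrix.single s t 1)
  choose c hc using fun w => exists_pauli_expansion (Matrix.single (s w) (t w) 1)
  rw [basis_eq_tensor, funext hc, tensor_sum_pauli]
  simp only [map_sum, map_smul, h]

end Pauli

/-! ### Clifford operators -/

section Clifford

variable {K : Type} [Fintype K] [DecidableEq K]

lemma conj_apply {I : Type} [Fintype I] (V M : Matrix I I ℂ) :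
    conj V M = V * M * V.conjTranspose := rfl

lemma conj_mul {I : Type} [Fintype I] (V U : Matrix I I ℂ) : conj (V * U) = conj V ∘ₗ conj U := by
  refine LinearMap.ext fun M => ?_
  simp [conj_apply, Matrix.mul_assoc, Matrix.conjTranspose_mul]

lemma conj_one {I : Type} [Fintype I] [DecidableEq I] :
    conj (1 : Matrix I I ℂ) = LinearMap.id := by
  refine LinearMap.ext fun M => ?_
  simp [conj_apply]

lemma conj_comp_conj_conjTranspose {I : Type} [Fintype I] [DecidableEq I] {V : Matrix I I ℂ}
    (hV : V ∈ Matrix.unitaryGroup I ℂ) : conj V ∘ₗ conj V.conjTranspose = LinearMap.id := by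
  rw [← conj_mul, ← conj_one]
  exact congrArg conj (Matrix.mem_unitaryGroup_iff.mp hV)

lemma IsClifford.mul {V U : Op K} (hV : IsClifford V) (hU : IsClifford U) :
    IsClifford (V * U) := by
  refine ⟨mul_mem hV.1 hU.1, fun p => ?_⟩
  obtain ⟨j, p', h⟩ := hU.2 p
  obtain ⟨j', p'', h'⟩ := hV.2 p'
  refine ⟨j + j', p'', ?_⟩
  have := congrArg (fun Φ => Φ (pauliString p)) (conj_mul V U)
  simp only [conj_apply, LinearMap.comp_apply] at this
  rw [this, h, Matrix.mul_smul, Matrix.smul_mul, h', smul_smul, pow_add]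

lemma IsClifford.one : IsClifford (1 : Op K) :=
  ⟨one_mem _, fun p => ⟨0, p, by simp⟩⟩

/-- The single-qubit Pauli group, without restriction on the determinant. -/
def IsPauli (M : Matrix Bool Bool ℂ) : Prop := ∃ (j : ℕ) (p : Fin 4), M = Complex.I ^ j • pauli p

lemma exists_pauliString_of_isPauli {U : K → Matrix Bool Bool ℂ} (hU : ∀ w, IsPauli (U w)) :
    ∃ (j : ℕ) (p : K → Fin 4), tensor U = Complex.I ^ j • pauliString p := by
  choose j p h using hU
  refine ⟨∑ w, j w, p, ?_⟩
  rw [funext h, tensor_smul, Finset.prod_pow_eq_pow_sum]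
  rfl

/-- A Clifford channel is determined by the images of the Pauli strings, which lie in the finite set
of operators i^j P with j < 4. Finiteness makes the `finsum` and the `Nat.card` in `cliffordMean`
genuine rather than default values. -/
instance : Finite (CliffordClass K) := by
  let T := {Q : Op K // ∃ (j : Fin 4) (p : K → Fin 4), Q = Complex.I ^ (j : ℕ) • pauliString p}
  have : Finite T := by
    refine Finite.of_surjective (α := Fin 4 × (K → Fin 4))
      (fun x => ⟨Complex.I ^ (x.1 : ℕ) • pauliString x.2, x.1, x.2, rfl⟩) ?_
    rintro ⟨_, j, p, rfl⟩
    exact ⟨(j, p), rfl⟩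
  let φ : CliffordClass K → (K → Fin 4) → T := fun v p =>
    ⟨conj (Quotient.out v).1 (pauliString p), by
      obtain ⟨j, p', h⟩ := (Quotient.out v).2.2 p
      refine ⟨⟨j % 4, Nat.mod_lt _ (by norm_num)⟩, p', ?_⟩
      rw [conj_apply, h]
      congr 1
      exact Complex.I_pow_eq_pow_mod j⟩
  refine Finite.of_injective φ fun v w h => ?_
  rw [← Quotient.out_eq v, ← Quotient.out_eq w]
  refine Quotient.sound ?_
  refine linearMap_ext_pauliString fun p => ?_
  exact congrArg Subtype.val (congrFun h p)

instance : Nonempty (CliffordClass K) := ⟨Quotient.mk _ ⟨1, IsClifford.one⟩⟩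

lemma cliffordClass_out {V : Op K} (hV : IsClifford V) :
    conj (Quotient.out (Quotient.mk (Setoid.ker fun V : {V : Op K // IsClifford V} => conj V.1)
      ⟨V, hV⟩)).1 = conj V :=
  Quotient.mk_out (s := Setoid.ker fun V : {V : Op K // IsClifford V} => conj V.1) ⟨V, hV⟩

/-- The Clifford mean of a function of the channel `conj V`. -/
lemma cliffordMean_eq_mul_right [Fintype (CliffordClass K)] (F : (Op K →ₗ[ℂ] Op K) → ℝ) {U : Op K}
    (hU : IsClifford U) : ∑ v : CliffordClass K, F (conj (Quotient.out v).1)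
      = ∑ v : CliffordClass K, F (conj (Quotient.out v).1 ∘ₗ conj U) := by
  -- Right translation by `U`. It is injective because `conj U` can be cancelled, hence a
  -- permutation of the finite set of classes.
  let τ : CliffordClass K → CliffordClass K := fun v =>
    Quotient.mk _ ⟨(Quotient.out v).1 * U, (Quotient.out v).2.mul hU⟩
  have hτ : ∀ v, conj (Quotient.out (τ v)).1 = conj (Quotient.out v).1 ∘ₗ conj U := fun v => by
    rw [← conj_mul]
    exact cliffordClass_out _
  have hinj : Function.Injective τ := by
    intro v w h
    have h1 : conj (Quotient.out v).1 ∘ₗ conj U = conj (Quotient.out w).1 ∘ₗ conj U := by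
      rw [← hτ, ← hτ, h]
    have h2 := congrArg (fun Φ => Φ ∘ₗ conj U.conjTranspose) h1
    simp only [LinearMap.comp_assoc, conj_comp_conj_conjTranspose hU.1, LinearMap.comp_id] at h2
    rw [← Quotient.out_eq v, ← Quotient.out_eq w]
    exact Quotient.sound h2
  have hbij : Function.Bijective τ := Finite.injective_iff_bijective.mp hinj
  rw [← Function.Bijective.sum_comp hbij fun v => F (conj (Quotient.out v).1)]
  exact Finset.sum_congr rfl fun v _ => by rw [hτ]

end Clifford

/-! ### Measuring and preparing in a random graph-state basis -/

section Graph

variable {K : Type}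

/-- The phase of the elementary diagonal Clifford gate attached to a pair of qubits: the phase gate
for equal qubits and the controlled-`Z` gate for distinct ones. -/
def pairPhase [DecidableEq K] (i j : K) (x : K → Bool) : ℂ :=
  if i = j then (if x i then Complex.I else 1) else (if x i && x j then -1 else 1)

/-- The diagonal of the product of the elementary gates selected by `g`. -/
def graphPhase [DecidableEq K] [Fintype K] (g : K × K → Bool) (x : K → Bool) : ℂ :=
  ∏ ij : K × K, if g ij then pairPhase ij.1 ij.2 x else 1

/-- The Hadamard matrix. -/
def hadamardMatrix : Matrix Bool Bool ℂ :=
  Matrix.of fun a b => (if a && b then -1 else 1) / (Real.sqrt 2 : ℂ)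

lemma sqrt_two_mul_self : (Real.sqrt 2 : ℂ) * (Real.sqrt 2 : ℂ) = 2 := by
  rw [← Complex.ofReal_mul, Real.mul_self_sqrt (by norm_num)]; norm_num

lemma sqrt_two_ne_zero : (Real.sqrt 2 : ℂ) ≠ 0 := by
  intro h
  have := sqrt_two_mul_self
  rw [h] at this
  norm_num at this

lemma hadamardMatrix_conjTranspose : hadamardMatrix.conjTranspose = hadamardMatrix := by
  ext a b
  cases a <;> cases b <;> simp [hadamardMatrix]

lemma hadamardMatrix_mul_self : hadamardMatrix * hadamardMatrix = 1 := by
  have h1 := sqrt_two_mul_self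
  have h2 := sqrt_two_ne_zero
  ext a b
  cases a <;> cases b <;>
    simp [hadamardMatrix, Matrix.mul_apply] <;> field_simp <;> norm_num [pow_two, h1]

variable [DecidableEq K] [Fintype K]

/-- A unitary whose columns are the graph-state basis of `g`. -/
def graphUnitary (g : K × K → Bool) : Op K :=
  Matrix.diagonal (graphPhase g) * tensor fun _ => hadamardMatrix

lemma pairPhase_mul_star (i j : K) (x : K → Bool) :
    pairPhase i j x * starRingEnd ℂ (pairPhase i j x) = 1 := by
  unfold pairPhase
  split_ifs <;> simp

lemma diagonal_mem_unitaryGroup {φ : (K → Bool) → ℂ} (h : ∀ x, φ x * starRingEnd ℂ (φ x) = 1) :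
    (Matrix.diagonal φ : Op K) ∈ Matrix.unitaryGroup (K → Bool) ℂ := by
  rw [Matrix.mem_unitaryGroup_iff, Matrix.star_eq_conjTranspose, Matrix.diagonal_conjTranspose,
    Matrix.diagonal_mul_diagonal, ← Matrix.diagonal_one]
  congr 1
  funext x
  exact h x

lemma tensor_mem_unitaryGroup {U : K → Matrix Bool Bool ℂ}
    (h : ∀ w, U w * (U w).conjTranspose = 1) : tensor U ∈ Matrix.unitaryGroup (K → Bool) ℂ := by
  rw [Matrix.mem_unitaryGroup_iff, Matrix.star_eq_conjTranspose, tensor_conjTranspose, tensor_mul]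
  simp only [h, tensor_one]

lemma isClifford_tensor {U : K → Matrix Bool Bool ℂ} (h : ∀ w, U w * (U w).conjTranspose = 1)
    (hU : ∀ w p, IsPauli (U w * pauli p * (U w).conjTranspose)) : IsClifford (tensor U) := by
  refine ⟨tensor_mem_unitaryGroup h, fun p => ?_⟩
  rw [pauliString_eq_tensor, tensor_conjTranspose, tensor_mul, tensor_mul]
  exact exists_pauliString_of_isPauli fun w => hU w (p w)

lemma isPauli_pauli (p : Fin 4) : IsPauli (pauli p) := ⟨0, p, by simp⟩

lemma isPauli_hadamard (p : Fin 4) :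
    IsPauli (hadamardMatrix * pauli p * hadamardMatrix.conjTranspose) := by
  rw [hadamardMatrix_conjTranspose]
  have h1 := sqrt_two_mul_self
  have h2 := sqrt_two_ne_zero
  fin_cases p
  · exact ⟨0, 0, by simp [pauli, hadamardMatrix_mul_self]⟩
  · refine ⟨0, 3, ?_⟩
    ext a b
    cases a <;> cases b <;> simp [hadamardMatrix, pauli, Matrix.mul_apply] <;> field_simp <;>
      simp [pow_two, h1] <;> norm_num
  · refine ⟨2, 2, ?_⟩
    ext a b
    cases a <;> cases b <;> simp [hadamardMatrix, pauli, Matrix.mul_apply] <;> field_simp <;>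
      simp [pow_two, h1] <;> ring
  · refine ⟨0, 1, ?_⟩
    ext a b
    cases a <;> cases b <;> simp [hadamardMatrix, pauli, Matrix.mul_apply] <;> field_simp <;>
      simp [pow_two, h1] <;> norm_num

lemma isClifford_hadamard : IsClifford (tensor fun _ : K => hadamardMatrix) :=
  isClifford_tensor (fun _ => by rw [hadamardMatrix_conjTranspose, hadamardMatrix_mul_self])
    fun _ => isPauli_hadamard

/-- Whether a Pauli matrix flips its qubit. -/
def pauliFlip : Fin 4 → Bool := ![false, true, true, false]

lemma pauli_eq_zero {p : Fin 4} {a b : Bool} (h : b ≠ xor a (pauliFlip p)) : pauli p a b = 0 := by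
  fin_cases p <;> cases a <;> cases b <;> simp [pauliFlip, pauli] at h ⊢

/-- A Pauli matrix, multiplied by `Z` if `c` is set. -/
lemma isPauli_signed (c : Bool) (p : Fin 4) :
    IsPauli (Matrix.of fun a b => (if c && a then -1 else 1) * pauli p a b) := by
  cases c
  · exact ⟨0, p, by ext a b; simp⟩
  · fin_cases p
    · refine ⟨0, 3, ?_⟩
      ext a b
      cases a <;> cases b <;> simp [pauli]
    · refine ⟨1, 2, ?_⟩
      ext a b
      cases a <;> cases b <;> simp [pauli]
    · refine ⟨3, 1, ?_⟩
      ext a b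
      cases a <;> cases b <;> simp [pauli, Complex.I_pow_three]
    · refine ⟨0, 0, ?_⟩
      ext a b
      cases a <;> cases b <;> simp [pauli]

lemma isPauli_phase (p : Fin 4) :
    IsPauli (Matrix.of fun a b => (if a then Complex.I else 1) * pauli p a b *
      (if b then -Complex.I else 1)) := by
  fin_cases p
  · refine ⟨0, 0, ?_⟩
    ext a b
    cases a <;> cases b <;> simp [pauli]
  · refine ⟨0, 2, ?_⟩
    ext a b
    cases a <;> cases b <;> simp [pauli]
  · refine ⟨2, 1, ?_⟩
    ext a b
    cases a <;> cases b <;> simp [pauli]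
  · refine ⟨0, 3, ?_⟩
    ext a b
    cases a <;> cases b <;> simp [pauli]

lemma conj_diagonal_apply (φ : (K → Bool) → ℂ) (M : Op K) (s t : K → Bool) :
    conj (Matrix.diagonal φ) M s t = φ s * M s t * starRingEnd ℂ (φ t) := by
  rw [conj_apply, Matrix.diagonal_conjTranspose, Matrix.mul_diagonal, Matrix.diagonal_mul]
  rfl

/-- Conjugating a Pauli string by a phase gate changes only the factor at that wire. Conjugating by
controlled-Z multiplies the factor at each of the two wires by Z exactly if the string flips the
other one, up to a global sign. -/
lemma isClifford_pairPhase (i j : K) : IsClifford (Matrix.diagonal (pairPhase i j) : Op K) := by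
  refine ⟨diagonal_mem_unitaryGroup (pairPhase_mul_star i j), fun p => ?_⟩
  by_cases hij : i = j
  · subst hij
    obtain ⟨k, p', h⟩ := exists_pauliString_of_isPauli
      (U := update (fun w => pauli (p w)) i (Matrix.of fun a b =>
        (if a then Complex.I else 1) * pauli (p i) a b * (if b then -Complex.I else 1))) (by
        intro w
        by_cases hw : w = i
        · subst hw; rw [update_self]; exact isPauli_phase _
        · rw [update_of_ne hw]; exact isPauli_pauli _)
    refine ⟨k, p', ?_⟩
    rw [← h]
    ext s t
    have h' := conj_diagonal_apply (pairPhase i i) (pauliString p) s t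
    rw [conj_apply] at h'
    rw [h', pauliString_eq_tensor, tensor_apply, tensor_apply,
      ← Finset.mul_prod_erase _ _ (Finset.mem_univ i), ← Finset.mul_prod_erase _ _ (Finset.mem_univ i),
      update_self]
    have h2 : ∏ x ∈ Finset.univ.erase i, pauli (p x) (s x) (t x) = ∏ x ∈ Finset.univ.erase i,
        (update (fun w => pauli (p w)) i (Matrix.of fun a b =>
          (if a then Complex.I else 1) * pauli (p i) a b * (if b then -Complex.I else 1)))
          x (s x) (t x) :=
      Finset.prod_congr rfl fun x hx => by rw [update_of_ne (Finset.ne_of_mem_erase hx)]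
    rw [h2]
    have h3 : starRingEnd ℂ (pairPhase i i t) = if t i then -Complex.I else 1 := by
      simp only [pairPhase, if_true]
      split_ifs <;> simp
    rw [h3]
    simp only [pairPhase, if_true, Matrix.of_apply]
    ring
  · let c : K → Bool := fun w =>
      if w = i then pauliFlip (p j) else if w = j then pauliFlip (p i) else false
    obtain ⟨k, p', h⟩ := exists_pauliString_of_isPauli
      (U := fun w => Matrix.of fun a b => (if c w && a then -1 else 1) * pauli (p w) a b)
      fun w => isPauli_signed _ _
    -- With flips f, a nonzero entry has t = s + f, and s_i s_j + t_i t_j = f_j s_i + f_i s_j + f_i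
    -- f_j mod 2. The last term is the global sign, written as an even power of i.
    refine ⟨2 * (if pauliFlip (p i) && pauliFlip (p j) then 1 else 0) + k, p', ?_⟩
    rw [pow_add, mul_smul, ← h]
    ext s t
    have h' := conj_diagonal_apply (pairPhase i j) (pauliString p) s t
    rw [conj_apply] at h'
    rw [h', pauliString_eq_tensor, Matrix.smul_apply, tensor_apply, tensor_apply]
    simp only [Matrix.of_apply, Finset.prod_mul_distrib, smul_eq_mul]
    by_cases hst : ∀ w, t w = xor (s w) (pauliFlip (p w))
    · have hc : (∏ w, (if c w && s w then (-1 : ℂ) else 1)) =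
          (if pauliFlip (p j) && s i then -1 else 1) * (if pauliFlip (p i) && s j then -1 else 1) := by
        rw [← Finset.mul_prod_erase _ _ (Finset.mem_univ i),
          ← Finset.mul_prod_erase _ _ (Finset.mem_erase.mpr ⟨Ne.symm hij, Finset.mem_univ j⟩),
          Finset.prod_eq_one, mul_one]
        · simp [c, Ne.symm hij]
        · intro x hx
          have hx1 := Finset.ne_of_mem_erase hx
          have hx2 := Finset.ne_of_mem_erase (Finset.mem_of_mem_erase hx)
          simp [c, hx1, hx2]
      rw [hc]
      simp only [pairPhase, if_neg hij, hst i, hst j]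
      cases s i <;> cases s j <;> cases pauliFlip (p i) <;> cases pauliFlip (p j) <;> simp
    · push Not at hst
      obtain ⟨w, hw⟩ := hst
      rw [Finset.prod_eq_zero (f := fun x => pauli (p x) (s x) (t x)) (Finset.mem_univ w)
        (pauli_eq_zero hw)]
      simp

lemma isClifford_graphPhase (g : K × K → Bool) :
    IsClifford (Matrix.diagonal (graphPhase g) : Op K) := by
  have h : ∀ S : Finset (K × K), IsClifford (Matrix.diagonal (fun x =>
      ∏ ij ∈ S, if g ij then pairPhase ij.1 ij.2 x else 1) : Op K) := by
    intro S
    induction S using Finset.induction_on with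
    | empty => simpa using IsClifford.one
    | insert ij S hS ih =>
      simp only [Finset.prod_insert hS]
      rw [← Matrix.diagonal_mul_diagonal]
      refine IsClifford.mul ?_ ih
      split_ifs
      · exact isClifford_pairPhase _ _
      · simpa using IsClifford.one
  exact h Finset.univ

lemma isClifford_graphUnitary (g : K × K → Bool) : IsClifford (graphUnitary g) :=
  (isClifford_graphPhase g).mul isClifford_hadamard

end Graph

/-! ### The 2-design identity and its transfer to the Clifford mean -/

section Design

variable {K : Type} [DecidableEq K] [Fintype K]

/-- Measuring in the basis `Φ |y⟩⟨y|` and preparing the observed basis state. -/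
def measurePrepare (Φ : Op K →ₗ[ℂ] Op K) (M : Op K) : Op K :=
  ∑ y : K → Bool, (Φ (basisState y) * M).trace • Φ (basisState y)

lemma conj_basisState_apply (V : Op K) (y p q : K → Bool) :
    conj V (basisState y) p q = V p y * starRingEnd ℂ (V q y) := by
  rw [conj_apply, basisState, Matrix.mul_apply]
  simp [Matrix.mul_apply, Matrix.single_apply, ite_and, Matrix.conjTranspose_apply]

lemma measurePrepare_conj_apply (V : Op K) (M : Op K) (p q : K → Bool) :
    measurePrepare (conj V) M p q = ∑ b, ∑ a, M a b * ∑ y, V b y * starRingEnd ℂ (V a y) *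
      (V p y * starRingEnd ℂ (V q y)) := by
  simp only [measurePrepare, Matrix.sum_apply, Matrix.smul_apply, smul_eq_mul, Matrix.trace,
    Matrix.diag_apply, Matrix.mul_apply, conj_basisState_apply, Finset.sum_mul, Finset.mul_sum]
  rw [Finset.sum_comm]
  refine Finset.sum_congr rfl fun b _ => ?_
  rw [Finset.sum_comm]
  refine Finset.sum_congr rfl fun a _ => Finset.sum_congr rfl fun y _ => ?_
  ring

/-- At every single wire the first hypothesis says that {a, q} and {b, p} agree as multisets. If b
and a differ at a wire i, the matching there is b = q, p = a with a ≠ q, and the parity condition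
for (i, j) then forces the same matching at each other j. -/
lemma pairing_of_sums_eq {a b p q : K → Bool}
    (h1 : ∀ i, (a i).toNat + (q i).toNat = (b i).toNat + (p i).toNat)
    (h2 : ∀ i j, i ≠ j → xor (xor (b i && b j) (a i && a j)) (xor (p i && p j) (q i && q j)) = false) :
    (b = a ∧ p = q) ∨ (b = q ∧ p = a) := by
  by_cases hb : b = a
  · left
    refine ⟨hb, funext fun i => ?_⟩
    have := h1 i
    rw [hb] at this
    revert this
    cases a i <;> cases p i <;> cases q i <;> simp
  · right
    obtain ⟨i, hi⟩ := Function.ne_iff.mp hb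
    have key : ∀ j, b j = q j ∧ p j = a j := by
      intro j
      by_cases hij : i = j
      · subst hij
        have := h1 i
        revert this hi
        cases a i <;> cases p i <;> cases q i <;> cases b i <;> simp
      · have e1 := h1 i
        have e2 := h1 j
        have e3 := h2 i j hij
        revert e1 e2 e3 hi
        cases a i <;> cases p i <;> cases q i <;> cases b i <;>
          cases a j <;> cases p j <;> cases q j <;> cases b j <;> simp
    exact ⟨funext fun j => (key j).1, funext fun j => (key j).2⟩

lemma graphUnitary_apply (g : K × K → Bool) (x y : K → Bool) :
    graphUnitary g x y = graphPhase g x * ∏ w, hadamardMatrix (x w) (y w) := by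
  rw [graphUnitary, Matrix.diagonal_mul, tensor_apply]

lemma star_hadamardMatrix (a b : Bool) :
    starRingEnd ℂ (hadamardMatrix a b) = hadamardMatrix a b := by
  cases a <;> cases b <;> simp [hadamardMatrix]

lemma graphUnitary_prod (g : K × K → Bool) (a b p q y : K → Bool) :
    graphUnitary g b y * starRingEnd ℂ (graphUnitary g a y) *
      (graphUnitary g p y * starRingEnd ℂ (graphUnitary g q y)) =
    (∏ ij : K × K, if g ij then pairPhase ij.1 ij.2 b * starRingEnd ℂ (pairPhase ij.1 ij.2 a) *
      (pairPhase ij.1 ij.2 p * starRingEnd ℂ (pairPhase ij.1 ij.2 q)) else 1) *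
    ∏ w, (hadamardMatrix (b w) (y w) * hadamardMatrix (a w) (y w) *
      (hadamardMatrix (p w) (y w) * hadamardMatrix (q w) (y w))) := by
  simp only [graphUnitary_apply, map_mul, map_prod, star_hadamardMatrix, Finset.prod_mul_distrib]
  have h : ∀ x : K → Bool, starRingEnd ℂ (graphPhase g x) =
      ∏ ij : K × K, if g ij then starRingEnd ℂ (pairPhase ij.1 ij.2 x) else 1 := by
    intro x
    rw [graphPhase, map_prod]
    exact Finset.prod_congr rfl fun ij _ => by split_ifs <;> simp
  have h' : (∏ ij : K × K, if g ij then pairPhase ij.1 ij.2 b * starRingEnd ℂ (pairPhase ij.1 ij.2 a) *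
      (pairPhase ij.1 ij.2 p * starRingEnd ℂ (pairPhase ij.1 ij.2 q)) else 1) =
      graphPhase g b * starRingEnd ℂ (graphPhase g a) *
        (graphPhase g p * starRingEnd ℂ (graphPhase g q)) := by
    rw [h, h, graphPhase, graphPhase, ← Finset.prod_mul_distrib, ← Finset.prod_mul_distrib,
      ← Finset.prod_mul_distrib]
    exact Finset.prod_congr rfl fun ij _ => by split_ifs <;> simp
  rw [h']
  ring

/-- The edges of `g` and the bits of `y` vary independently, so the double sum factors: an absent
edge contributes 1, a present edge a product of four phases, and each wire a sum of four Hadamard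
entries. -/
lemma sum_graphUnitary_prod (a b p q : K → Bool) :
    ∑ g : K × K → Bool, ∑ y, graphUnitary g b y * starRingEnd ℂ (graphUnitary g a y) *
      (graphUnitary g p y * starRingEnd ℂ (graphUnitary g q y)) =
    (∏ ij : K × K, (pairPhase ij.1 ij.2 b * starRingEnd ℂ (pairPhase ij.1 ij.2 a) *
      (pairPhase ij.1 ij.2 p * starRingEnd ℂ (pairPhase ij.1 ij.2 q)) + 1)) *
    ∏ w, ∑ β, (hadamardMatrix (b w) β * hadamardMatrix (a w) β *
      (hadamardMatrix (p w) β * hadamardMatrix (q w) β)) := by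
  simp only [graphUnitary_prod, ← Finset.mul_sum, ← Finset.sum_mul]
  congr 1
  · have := Finset.prod_univ_sum (fun _ : K × K => (Finset.univ : Finset Bool)) (fun ij β => if β then
      pairPhase ij.1 ij.2 b * starRingEnd ℂ (pairPhase ij.1 ij.2 a) *
      (pairPhase ij.1 ij.2 p * starRingEnd ℂ (pairPhase ij.1 ij.2 q)) else 1)
    rw [Fintype.piFinset_univ] at this
    rw [← this]
    simp
  · rw [Finset.prod_univ_sum, Fintype.piFinset_univ]

/-- If the strings match in pairs, all phases cancel: every edge factor is 2 and every wire factor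
1/2. Otherwise `pairing_of_sums_eq` fails in one of three ways. A bad pair of wires gives
controlled-Z signs with product −1, so its edge factor is −1 + 1. An odd sum at a wire kills the sum
of Hadamard entries. An even but unbalanced wire has b + p − a − q = ±2, so the phase of its loop is
i^{±2} = −1. -/
lemma sum_graphUnitary_prod_eq (a b p q : K → Bool) :
    ∑ g : K × K → Bool, ∑ y, graphUnitary g b y * starRingEnd ℂ (graphUnitary g a y) *
      (graphUnitary g p y * starRingEnd ℂ (graphUnitary g q y)) =
    if (b = a ∧ p = q) ∨ (b = q ∧ p = a) then
      2 ^ Fintype.card (K × K) / 2 ^ Fintype.card K else 0 := by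
  rw [sum_graphUnitary_prod]
  have hs := sqrt_two_mul_self
  have hs0 := sqrt_two_ne_zero
  have hquad : ∀ c e β : Bool, hadamardMatrix c β * hadamardMatrix c β *
      (hadamardMatrix e β * hadamardMatrix e β) = 1 / 4 := by
    have h2 : ∀ c β : Bool, hadamardMatrix c β * hadamardMatrix c β = 1 / 2 := by
      intro c β
      cases c <;> cases β <;> simp [hadamardMatrix] <;> field_simp <;> simp [pow_two, hs]
    intro c e β
    rw [h2, h2]; norm_num
  split_ifs with hm
  · have h1 : ∀ ij : K × K, pairPhase ij.1 ij.2 b * starRingEnd ℂ (pairPhase ij.1 ij.2 a) *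
        (pairPhase ij.1 ij.2 p * starRingEnd ℂ (pairPhase ij.1 ij.2 q)) + 1 = 2 := by
      intro ij
      rcases hm with ⟨rfl, rfl⟩ | ⟨rfl, rfl⟩
      · rw [pairPhase_mul_star, pairPhase_mul_star]; norm_num
      · have := congrArg₂ (· * ·) (pairPhase_mul_star ij.1 ij.2 b) (pairPhase_mul_star ij.1 ij.2 p)
        linear_combination this
    have h2 : ∀ w, ∑ β, (hadamardMatrix (b w) β * hadamardMatrix (a w) β *
        (hadamardMatrix (p w) β * hadamardMatrix (q w) β)) = 1 / 2 := by
      intro w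
      have : ∀ β, (hadamardMatrix (b w) β * hadamardMatrix (a w) β *
        (hadamardMatrix (p w) β * hadamardMatrix (q w) β)) = 1 / 4 := by
        intro β
        rcases hm with ⟨rfl, rfl⟩ | ⟨rfl, rfl⟩
        · exact hquad _ _ _
        · rw [← hquad (b w) (p w) β]; ring
      simp only [this]
      norm_num
    simp only [h1, h2, Finset.prod_const, Finset.card_univ]
    rw [one_div, inv_pow]
    rfl
  · have key : (∃ i j, i ≠ j ∧ xor (xor (b i && b j) (a i && a j)) (xor (p i && p j) (q i && q j)) = true) ∨
        ∃ i, (a i).toNat + (q i).toNat ≠ (b i).toNat + (p i).toNat := by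
      by_contra hcon
      push Not at hcon
      exact hm (pairing_of_sums_eq hcon.2 fun i j hij => by simpa using hcon.1 i j hij)
    rcases key with ⟨i, j, hij, h⟩ | ⟨i, h⟩
    · rw [Finset.prod_eq_zero (Finset.mem_univ (i, j)), zero_mul]
      simp only [pairPhase, if_neg hij]
      revert h
      cases a i <;> cases p i <;> cases q i <;> cases b i <;>
          cases a j <;> cases p j <;> cases q j <;> cases b j <;> simp
    · by_cases hodd : ((a i).toNat + (q i).toNat + (b i).toNat + (p i).toNat) % 2 = 1
      · rw [Finset.prod_eq_zero (s := Finset.univ) (ι := K) (Finset.mem_univ i), mul_zero]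
        rw [Fintype.sum_bool]
        revert hodd
        cases a i <;> cases p i <;> cases q i <;> cases b i <;>
          simp [hadamardMatrix] <;> field_simp <;> norm_num
      · rw [Finset.prod_eq_zero (Finset.mem_univ (i, i)), zero_mul]
        simp only [pairPhase, if_true]
        revert h hodd
        cases a i <;> cases p i <;> cases q i <;> cases b i <;> simp

/-- The graph-state bases, together with the computational basis, form a 2-design. -/
lemma measurePrepare_design (M : Op K) :
    measurePrepare LinearMap.id M + (2 ^ Fintype.card K / 2 ^ Fintype.card (K × K) : ℂ) •
      ∑ g : K × K → Bool, measurePrepare (conj (graphUnitary g)) M = M.trace • 1 + M := by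
  ext p q
  have h1 : (∑ g : K × K → Bool, measurePrepare (conj (graphUnitary g)) M) p q =
      ∑ b, ∑ a, M a b * if (b = a ∧ p = q) ∨ (b = q ∧ p = a) then
      2 ^ Fintype.card (K × K) / 2 ^ Fintype.card K else 0 := by
    simp only [Matrix.sum_apply, measurePrepare_conj_apply]
    rw [Finset.sum_comm]
    refine Finset.sum_congr rfl fun b _ => ?_
    rw [Finset.sum_comm]
    refine Finset.sum_congr rfl fun a _ => ?_
    rw [← Finset.mul_sum, sum_graphUnitary_prod_eq]
  have h0 : measurePrepare LinearMap.id M p q = if p = q then M p q else 0 := by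
    rw [← conj_one, measurePrepare_conj_apply]
    simp only [Matrix.one_apply]
    by_cases hpq : p = q
    · subst hpq
      simp [apply_ite]
    · simp [apply_ite, hpq]
  rw [Matrix.add_apply, Matrix.smul_apply, h1, h0, Matrix.add_apply, Matrix.smul_apply,
    Matrix.one_apply]
  have h2 : (2 : ℂ) ^ Fintype.card K ≠ 0 := pow_ne_zero _ two_ne_zero
  have h3 : (2 : ℂ) ^ Fintype.card (K × K) ≠ 0 := pow_ne_zero _ two_ne_zero
  have h4 : ∀ (b a : K → Bool), (2 ^ Fintype.card K / 2 ^ Fintype.card (K × K) : ℂ) *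
      (M a b * if (b = a ∧ p = q) ∨ (b = q ∧ p = a) then
        2 ^ Fintype.card (K × K) / 2 ^ Fintype.card K else 0) =
      if (b = a ∧ p = q) ∨ (b = q ∧ p = a) then M a b else 0 := by
    intro b a
    split_ifs
    · field_simp
    · simp
  simp only [smul_eq_mul, Finset.mul_sum, h4]
  -- On the diagonal every pair a = b contributes, giving Tr M; off the diagonal only the entry of M
  -- itself survives. The graph-state bases thus miss exactly the diagonal part of M, which the
  -- computational basis supplies.
  by_cases hpq : p = q
  · subst hpq
    have : ∀ b a, (b = a ∨ (b = p ∧ p = a)) ↔ a = b := by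
      intro b a
      constructor
      · rintro (h | ⟨h, h'⟩)
        · exact h.symm
        · rw [← h', h]
      · rintro rfl
        exact Or.inl rfl
    simp only [and_true, this]
    simp [Matrix.trace, add_comm]
  · simp only [hpq, and_false, false_or, if_false]
    rw [Finset.sum_eq_single q, Finset.sum_eq_single p] <;> simp +contextual [eq_comm]

lemma trace_conj_mul {I : Type} [Fintype I] (V N M : Matrix I I ℂ) :
    (conj V N * M).trace = (N * conj V.conjTranspose M).trace := by
  simp only [conj_apply, Matrix.conjTranspose_conjTranspose]
  rw [Matrix.mul_assoc, Matrix.mul_assoc, Matrix.trace_mul_comm]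
  simp only [Matrix.mul_assoc]

lemma measurePrepare_conj_comp (V : Op K) (Φ : Op K →ₗ[ℂ] Op K) (M : Op K) :
    measurePrepare (conj V ∘ₗ Φ) M = conj V (measurePrepare Φ (conj V.conjTranspose M)) := by
  simp only [measurePrepare, map_sum, map_smul, LinearMap.comp_apply, trace_conj_mul]

/-- The mean over the Clifford operators of the channel that measures and prepares in a random basis. -/
lemma cliffordMean_measurePrepare (L : Op K →ₗ[ℂ] ℂ) (M : Op K) :
    cliffordMean (fun V => (L (measurePrepare (conj V) M)).re) =
      (L (M.trace • 1 + M)).re / (2 ^ Fintype.card K + 1) := by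
  classical
  let _ : Fintype (CliffordClass K) := Fintype.ofFinite _
  rw [cliffordMean, finsum_eq_sum_of_fintype, Nat.card_eq_fintype_card]
  set S := ∑ v : CliffordClass K, (L (measurePrepare (conj (Quotient.out v).1) M)).re with hS
  -- By right invariance V may be replaced by VU, and measuring in the basis VU is measuring in the
  -- basis U conjugated by V.
  have hU : ∀ U : Op K, IsClifford U → S = ∑ v : CliffordClass K,
      (L (conj (Quotient.out v).1 (measurePrepare (conj U)
        (conj (Quotient.out v).1.conjTranspose M)))).re := by
    intro U hU
    rw [hS, cliffordMean_eq_mul_right (fun Φ => (L (measurePrepare Φ M)).re) hU]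
    simp only [measurePrepare_conj_comp]
  have hd : (2 : ℝ) ^ Fintype.card (K × K) ≠ 0 := pow_ne_zero _ two_ne_zero
  have hsum : (2 ^ Fintype.card K + 1 : ℝ) * S =
      ∑ v : CliffordClass K, (L (M.trace • 1 + M)).re := by
    -- The weight d + 1 is split as in the design: one copy of `S` will be rewritten with U = 1, the
    -- others with the graph unitaries.
    have hcard : (2 ^ Fintype.card K + 1 : ℝ) * S = S + (2 ^ Fintype.card K / 2 ^ Fintype.card (K × K))
        * ∑ _g : K × K → Bool, S := by
      rw [Finset.sum_const, Finset.card_univ, nsmul_eq_mul, Fintype.card_fun, Fintype.card_bool]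
      push_cast
      field_simp
      ring
    have hg : ∑ _g : K × K → Bool, S = ∑ g : K × K → Bool, ∑ v : CliffordClass K,
      (L (conj (Quotient.out v).1 (measurePrepare (conj (graphUnitary g))
        (conj (Quotient.out v).1.conjTranspose M)))).re :=
      Finset.sum_congr rfl fun g _ => hU _ (isClifford_graphUnitary g)
    rw [hcard, hg]
    nth_rewrite 1 [hU 1 IsClifford.one]
    rw [Finset.sum_comm, Finset.mul_sum, ← Finset.sum_add_distrib]
    refine Finset.sum_congr rfl fun v _ => ?_
    have hv := (Quotient.out v).2.1
    set V := (Quotient.out v).1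
    -- For each fixed V the design identity holds for V†MV, and conjugating back by V turns its
    -- right-hand side into Tr(M) I + M.
    have hdes := congrArg (fun N => (L (conj V N)).re) (measurePrepare_design (conj V.conjTranspose M))
    simp only [map_add, map_sum, map_smul, Complex.add_re] at hdes
    have hid : conj V (conj V.conjTranspose M) = M :=
      congrArg (fun Φ => Φ M) (conj_comp_conj_conjTranspose hv)
    have hone : conj V 1 = 1 := by
      rw [conj_apply, Matrix.mul_one]
      exact Matrix.mem_unitaryGroup_iff.mp hv
    have htr : (conj V.conjTranspose M).trace = M.trace := by
      have h1 := trace_conj_mul V 1 M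
      rw [hone, Matrix.one_mul, Matrix.one_mul] at h1
      exact h1.symm
    rw [hid, hone, htr] at hdes
    rw [map_add, map_smul, Complex.add_re, ← hdes, conj_one]
    congr 1
    have hreal : (2 ^ Fintype.card K / 2 ^ Fintype.card (K × K) : ℂ) =
        ((2 ^ Fintype.card K / 2 ^ Fintype.card (K × K) : ℝ) : ℂ) := by push_cast; rfl
    rw [hreal, smul_eq_mul, Complex.re_ofReal_mul, Complex.re_sum]
  have hc : (Fintype.card (CliffordClass K) : ℝ) ≠ 0 := Nat.cast_ne_zero.mpr Fintype.card_ne_zero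
  have hd1 : (2 ^ Fintype.card K + 1 : ℝ) ≠ 0 := by positivity
  rw [Finset.sum_const, Finset.card_univ, nsmul_eq_mul] at hsum
  field_simp
  linear_combination hsum

lemma cliffordMean_congr {F G : Op K → ℝ} (h : ∀ V, IsClifford V → F V = G V) :
    cliffordMean F = cliffordMean G := by
  unfold cliffordMean
  congr 1
  exact finsum_congr fun v => h _ (Quotient.out v).2

lemma cliffordMean_nonneg {F : Op K → ℝ} (h : ∀ V, IsClifford V → 0 ≤ F V) : 0 ≤ cliffordMean F :=
  div_nonneg (finsum_nonneg fun v => h _ (Quotient.out v).2) (Nat.cast_nonneg _)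

lemma sum_cliffordMean {α : Type} [Fintype α] (F : α → Op K → ℝ) :
    ∑ x, cliffordMean (F x) = cliffordMean fun V => ∑ x, F x V := by
  let _ : Fintype (CliffordClass K) := Fintype.ofFinite _
  simp only [cliffordMean, finsum_eq_sum_of_fintype, ← Finset.sum_div]
  rw [Finset.sum_comm]

lemma cliffordMean_one : cliffordMean (fun _ : Op K => 1) = 1 := by
  let _ : Fintype (CliffordClass K) := Fintype.ofFinite _
  simp [cliffordMean, finsum_eq_sum_of_fintype, Nat.card_eq_fintype_card, Fintype.card_ne_zero]

end Design

/-! ### Basis states and operators extended by zeros -/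

section Embed

variable {K W : Type} [DecidableEq W] [Fintype W] {e : K → W}

/-- The condition selects the strings that agree with `s₀` outside `e`; these are parametrized by
their bits on `e`. -/
lemma sum_ite_extend_eq [Fintype K] [DecidableEq K] {R : Type} [AddCommMonoid R] (he : Injective e)
    (s₀ : W → Bool) (G : (W → Bool) → R) :
    ∑ s : W → Bool, (if extend e (s ∘ e) s₀ = s then G s else 0) =
      ∑ u : K → Bool, G (extend e u s₀) := by
  rw [← Finset.sum_filter]
  refine Finset.sum_nbij' (fun s => s ∘ e) (fun u => extend e u s₀) ?_ ?_ ?_ ?_ ?_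
  · simp
  · simp [extend_comp_eq he]
  · intro s hs
    exact (Finset.mem_filter.mp hs).2
  · intro u _
    exact extend_comp_eq he _ _
  · intro s hs
    exact congrArg G (Finset.mem_filter.mp hs).2.symm

lemma block_extend (he : Injective e) (M : Op W) (y y' : K → Bool) (s t : W → Bool) :
    block e M (extend e y s) (extend e y' t) = block e M s t := by
  ext u v
  simp [block, extend_extend_left he]

/-- The operator `N` on the qubits `e`, tensored with `|0⟩⟨0|` on all other qubits. -/
def embed (e : K → W) : Op K →ₗ[ℂ] Op W where
  toFun N := Matrix.of fun s t =>
    if extend e (s ∘ e) (fun _ => false) = s ∧ extend e (t ∘ e) (fun _ => false) = t then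
      N (s ∘ e) (t ∘ e) else 0
  map_add' M N := by
    ext s t
    simp only [Matrix.of_apply, Matrix.add_apply]
    split_ifs <;> simp
  map_smul' c M := by
    ext s t
    simp only [Matrix.of_apply, Matrix.smul_apply, RingHom.id_apply]
    split_ifs <;> simp

lemma embed_apply (N : Op K) (s t : W → Bool) : embed e N s t =
    if extend e (s ∘ e) (fun _ => false) = s ∧ extend e (t ∘ e) (fun _ => false) = t then
      N (s ∘ e) (t ∘ e) else 0 := rfl

lemma extend_eq_extend_iff (he : Injective e) (y u : K → Bool) (s : W → Bool) :
    extend e y (fun _ => false) = extend e u s ↔ y = u ∧ extend e (s ∘ e) (fun _ => false) = s := by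
  constructor
  · intro h
    refine ⟨?_, ?_⟩
    · rw [← extend_comp_eq he y (fun _ => false), h, extend_comp_eq he]
    · rw [← extend_extend_left he (s ∘ e) y, h, extend_extend_left he, extend_comp_self s he]
  · rintro ⟨rfl, h⟩
    rw [← h, extend_extend_left he]

variable [Fintype K] [DecidableEq K]

lemma block_basisState (he : Injective e) (y : K → Bool) (s t : W → Bool) :
    block e (basisState (extend e y fun _ => false)) s t =
      if extend e (s ∘ e) (fun _ => false) = s ∧ extend e (t ∘ e) (fun _ => false) = t then
        basisState y else 0 := by
  ext u v
  rw [block, Matrix.of_apply, basisState_apply]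
  simp only [extend_eq_extend_iff he]
  split_ifs with h1 h2 h2
  · rw [basisState_apply, if_pos ⟨h1.1.1, h1.2.1⟩]
  · exact absurd ⟨h1.1.2, h1.2.2⟩ h2
  · rw [basisState_apply, if_neg]
    exact fun h => h1 ⟨⟨h.1, h2.1⟩, ⟨h.2, h2.2⟩⟩
  · rfl

lemma applyOn_basisState (he : Injective e) (Φ : Op K →ₗ[ℂ] Op K) (y : K → Bool) :
    applyOn Φ e (basisState (extend e y fun _ => false)) = embed e (Φ (basisState y)) := by
  ext s t
  rw [applyOn_apply, block_basisState he, embed_apply]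
  split_ifs <;> simp

lemma extend_const_false : extend e (fun _ => false) (fun _ => false) = fun _ => false := by
  funext w
  by_cases h : ∃ k, e k = w
  · simp only [extend_def, h, dite_true]
  · rw [extend_apply' _ _ _ h]

lemma block_basisState_zero (he : Injective e) (s t : W → Bool) :
    block e (basisState fun _ => false) s t =
      if extend e (s ∘ e) (fun _ => false) = s ∧ extend e (t ∘ e) (fun _ => false) = t then
        basisState (fun _ => false) else 0 := by
  rw [← block_basisState he, extend_const_false]

lemma extend_comp_eq_self_iff (he : Injective e) (s s₀ : W → Bool) :
    extend e (s ∘ e) s₀ = s ↔ ∀ w, (∀ k, e k ≠ w) → s w = s₀ w := by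
  constructor
  · intro h w hw
    rw [← h, extend_apply' _ _ _ (by push Not; exact hw)]
  · intro h
    funext w
    by_cases hw : ∃ k, e k = w
    · obtain ⟨k, rfl⟩ := hw
      rw [he.extend_apply]; rfl
    · rw [extend_apply' _ _ _ hw]
      push Not at hw
      exact (h w hw).symm

end Embed

/-! ### The law of the cutting procedure and its unbiasedness -/

section Law

variable {n : ℕ} {A B : Finset (Fin n)}

lemma cutInLeft_injective : Injective (cutInLeft : ↥(A ∩ B) → A) := fun v w h => by
  have := congrArg Subtype.val h
  exact Subtype.ext this

lemma cutInRight_injective : Injective (cutInRight : ↥(A ∩ B) → B) := fun v w h => by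
  have := congrArg Subtype.val h
  exact Subtype.ext this

lemma preparedBits_eq_extend (y : ↥(A ∩ B) → Bool) :
    preparedBits y = extend cutInRight y fun _ => false := by
  funext w
  unfold preparedBits
  split_ifs with h
  · have : w = cutInRight (⟨w.1, Finset.mem_inter.mpr ⟨h, w.2⟩⟩ : ↥(A ∩ B)) := rfl
    conv_rhs => rw [this]
    rw [cutInRight_injective.extend_apply]
  · rw [extend_apply']
    rintro ⟨k, rfl⟩
    exact h (Finset.mem_inter.mp k.2).1

lemma leftProb_nonneg_and_eq (CA : Circuit A) {V : Op ↥(A ∩ B)}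
    (hV : V ∈ Matrix.unitaryGroup (↥(A ∩ B) → Bool) ℂ) (a : A → Bool) :
    0 ≤ leftProb CA V a ∧ ((leftProb CA V a : ℝ) : ℂ) =
      applyOn (conj V.conjTranspose) cutInLeft (CA.run (basisState fun _ => false)) a a :=
  diag_re_nonneg (posSemidef_applyOn cutInLeft_injective
    (isChannel_conj (Unitary.star_mem hV)) (CA.posSemidef_run (posSemidef_basisState _))) a

lemma rightProb_nonneg_and_eq (CB : Circuit B) {V : Op ↥(A ∩ B)}
    (hV : V ∈ Matrix.unitaryGroup (↥(A ∩ B) → Bool) ℂ) (y : ↥(A ∩ B) → Bool) (b : B → Bool) :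
    0 ≤ rightProb CB V y b ∧ ((rightProb CB V y b : ℝ) : ℂ) =
      CB.run (embed cutInRight (conj V (basisState y))) b b := by
  have h := diag_re_nonneg (CB.posSemidef_run (posSemidef_applyOn cutInRight_injective
    (isChannel_conj hV) (posSemidef_basisState (preparedBits y)))) b
  refine ⟨h.1, ?_⟩
  rw [rightProb, h.2, preparedBits_eq_extend, applyOn_basisState cutInRight_injective]

lemma sum_leftProb (CA : Circuit A) {V : Op ↥(A ∩ B)}
    (hV : V ∈ Matrix.unitaryGroup (↥(A ∩ B) → Bool) ℂ) : ∑ a, leftProb CA V a = 1 := by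
  have h : ((∑ a, leftProb CA V a : ℝ) : ℂ) = 1 := by
    push_cast
    simp only [fun a => (leftProb_nonneg_and_eq CA hV a).2]
    exact (trace_applyOn cutInLeft_injective _
      (isChannel_conj (Unitary.star_mem hV)).trace_preserving _).trans
        ((CA.trace_run _).trans (trace_basisState _))
  exact_mod_cast h

lemma sum_rightProb (CB : Circuit B) {V : Op ↥(A ∩ B)}
    (hV : V ∈ Matrix.unitaryGroup (↥(A ∩ B) → Bool) ℂ) (y : ↥(A ∩ B) → Bool) :
    ∑ b, rightProb CB V y b = 1 := by
  have h : ((∑ b, rightProb CB V y b : ℝ) : ℂ) = 1 := by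
    push_cast
    simp only [fun b => (rightProb_nonneg_and_eq CB hV y b).2]
    rw [← applyOn_basisState cutInRight_injective]
    exact (CB.trace_run _).trans ((trace_applyOn cutInRight_injective _
      (isChannel_conj hV).trace_preserving _).trans (trace_basisState _))
  exact_mod_cast h

/-- The outcome `x` of a run vanishes on the wires that no circuit uses. -/
def Supported (A B : Finset (Fin n)) (x : Fin n → Bool) : Prop :=
  ∀ w, w ∉ A → w ∉ B → x w = false

/-- The restriction of a bit string to a set of wires. -/
def restrict (A : Finset (Fin n)) (x : Fin n → Bool) : A → Bool := fun w => x w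

/-- On the cut wires the output is taken from `b`, so `x` leaves the bits of `a` there free; `a` is
otherwise fixed by `x`, and `b` entirely. -/
lemma assemble_eq_iff (a : A → Bool) (b : B → Bool) (x : Fin n → Bool) :
    assemble a b = x ↔ Supported A B x ∧
      extend (cutInLeft : ↥(A ∩ B) → A) (a ∘ cutInLeft) (restrict A x) = a ∧ b = restrict B x := by
  rw [extend_comp_eq_self_iff cutInLeft_injective]
  constructor
  · rintro rfl
    refine ⟨fun w h1 h2 => by simp [assemble, h1, h2], fun w hw => ?_, ?_⟩
    · have hB : w.1 ∉ B := fun h => hw ⟨w.1, Finset.mem_inter.mpr ⟨w.2, h⟩⟩ rfl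
      simp [restrict, assemble, hB]
    · funext w
      simp [restrict, assemble]
  · rintro ⟨h1, h2, rfl⟩
    funext w
    by_cases hB : w ∈ B
    · simp [assemble, restrict, hB]
    · by_cases hA : w ∈ A
      · simp only [assemble, hB, hA, dite_true, dite_false]
        refine h2 ⟨w, hA⟩ fun k hk => hB ?_
        have := congrArg Subtype.val hk
        change k.1 = w at this
        rw [← this]
        exact (Finset.mem_inter.mp k.2).2
      · simp [assemble, hB, hA, h1 w hA hB]

open Classical in
lemma sum_assemble_eq (x : Fin n → Bool) (G : (A → Bool) → (B → Bool) → ℝ) :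
    ∑ a, ∑ b, (if assemble a b = x then G a b else 0) =
      if Supported A B x then ∑ y : ↥(A ∩ B) → Bool,
        G (extend cutInLeft y (restrict A x)) (restrict B x) else 0 := by
  split_ifs with hx
  · rw [← sum_ite_extend_eq cutInLeft_injective (restrict A x) fun a => G a (restrict B x)]
    refine Finset.sum_congr rfl fun a _ => ?_
    split_ifs with ha
    · rw [Finset.sum_eq_single (restrict B x)]
      · rw [if_pos ((assemble_eq_iff _ _ _).mpr ⟨hx, ha, rfl⟩)]
      · intro b _ hb
        rw [if_neg fun h => hb ((assemble_eq_iff _ _ _).mp h).2.2]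
      · simp
    · refine Finset.sum_eq_zero fun b _ => if_neg fun h => ha ((assemble_eq_iff _ _ _).mp h).2.1
  · refine Finset.sum_eq_zero fun a _ => Finset.sum_eq_zero fun b _ => if_neg fun h => ?_
    exact hx ((assemble_eq_iff _ _ _).mp h).1

/-- The unnormalized state of the cut wires after `C_A`, given the outcomes `x` on `A \ B`. -/
def cutState (B : Finset (Fin n)) (CA : Circuit A) (x : Fin n → Bool) : Op ↥(A ∩ B) :=
  block cutInLeft (CA.run (basisState fun _ => false)) (restrict A x) (restrict A x)

/-- The weight of outcome `b` after `C_B`, as a function of the operator on the cut wires. -/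
def outcomeWeight (A : Finset (Fin n)) (CB : Circuit B) (b : B → Bool) : Op ↥(A ∩ B) →ₗ[ℂ] ℂ where
  toFun N := CB.run (embed cutInRight N) b b
  map_add' M N := by
    rw [← Circuit.runLin_apply, map_add, map_add]; rfl
  map_smul' c M := by
    rw [← Circuit.runLin_apply, map_smul, map_smul]; rfl

lemma outcomeWeight_apply (CB : Circuit B) (b : B → Bool) (N : Op ↥(A ∩ B)) :
    outcomeWeight A CB b N = CB.run (embed cutInRight N) b b := rfl

lemma trace_basisState_mul {K : Type} [Fintype K] [DecidableEq K] (y : K → Bool) (M : Op K) :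
    (basisState y * M).trace = M y y := by
  rw [basisState, Matrix.trace_single_mul]
  simp

/-- Born's rule for the cut state; the adjoint basis change is moved from the state to the measured
projector. -/
lemma leftProb_extend (CA : Circuit A) {V : Op ↥(A ∩ B)}
    (hV : V ∈ Matrix.unitaryGroup (↥(A ∩ B) → Bool) ℂ) (y : ↥(A ∩ B) → Bool) (x : Fin n → Bool) :
    ((leftProb CA V (extend cutInLeft y (restrict A x)) : ℝ) : ℂ) =
      (conj V (basisState y) * cutState B CA x).trace := by
  rw [(leftProb_nonneg_and_eq CA hV _).2, applyOn_apply, extend_comp_eq cutInLeft_injective,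
    trace_conj_mul, trace_basisState_mul, cutState]
  rw [block_extend cutInLeft_injective]

/-- The probability of `x` if the cut wires are measured and prepared in the basis `V|y⟩`. -/
def cutProb (CA : Circuit A) (CB : Circuit B) (V : Op ↥(A ∩ B)) (x : Fin n → Bool) : ℝ :=
  ∑ a : A → Bool, ∑ b : B → Bool,
    if assemble a b = x then leftProb CA V a * rightProb CB V (a ∘ cutInLeft) b else 0

-- For a fixed basis, the sum over the forgotten outcome `y` is the measure-and-prepare channel on
-- the cut state, followed by the linear weight functional of the second circuit. The Clifford mean
-- can then be evaluated by the design identity.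
open Classical in
lemma cutProb_eq (CA : Circuit A) (CB : Circuit B) {V : Op ↥(A ∩ B)}
    (hV : V ∈ Matrix.unitaryGroup (↥(A ∩ B) → Bool) ℂ) (x : Fin n → Bool) :
    cutProb CA CB V x = if Supported A B x then
      (outcomeWeight A CB (restrict B x) (measurePrepare (conj V) (cutState B CA x))).re else 0 := by
  rw [cutProb, sum_assemble_eq x fun a b => leftProb CA V a * rightProb CB V (a ∘ cutInLeft) b]
  refine if_congr Iff.rfl ?_ rfl
  rw [measurePrepare, map_sum, Complex.re_sum]
  refine Finset.sum_congr rfl fun y _ => ?_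
  rw [extend_comp_eq cutInLeft_injective, map_smul, ← leftProb_extend CA hV, outcomeWeight_apply,
    ← (rightProb_nonneg_and_eq CB hV _ _).2, smul_eq_mul, ← Complex.ofReal_mul, Complex.ofReal_re]

/-- The sum over `y` of the probabilities of `x`, if the cut wires are prepared in `|y⟩`. -/
def discardProb (CA : Circuit A) (CB : Circuit B) (x : Fin n → Bool) : ℝ :=
  ∑ y : ↥(A ∩ B) → Bool, ∑ a : A → Bool, ∑ b : B → Bool,
    if assemble a b = x then leftProb CA (1 : Op ↥(A ∩ B)) a * rightProb CB 1 y b else 0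

-- Ignoring the outcomes on the cut wires leaves the trace of the cut state, and the basis states
-- prepared there sum to the identity.
open Classical in
lemma discardProb_eq (CA : Circuit A) (CB : Circuit B) (x : Fin n → Bool) :
    discardProb CA CB x = if Supported A B x then
      (outcomeWeight A CB (restrict B x) ((cutState B CA x).trace • 1)).re else 0 := by
  have h1 : (1 : Op ↥(A ∩ B)) ∈ Matrix.unitaryGroup (↥(A ∩ B) → Bool) ℂ := one_mem _
  simp only [discardProb]
  rw [Finset.sum_congr rfl fun y _ => sum_assemble_eq x fun a b =>
    leftProb CA (1 : Op ↥(A ∩ B)) a * rightProb CB 1 y b]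
  split_ifs with hx
  · have hone : (1 : Op ↥(A ∩ B)) = ∑ y, basisState y := by
      ext s t
      simp only [Matrix.sum_apply, basisState_apply, Matrix.one_apply]
      split_ifs with h
      · subst h; simp
      · refine (Finset.sum_eq_zero fun y _ => if_neg ?_).symm
        rintro ⟨rfl, h'⟩
        exact h h'
    have htr : (cutState B CA x).trace = ((∑ y : ↥(A ∩ B) → Bool,
        leftProb CA (1 : Op ↥(A ∩ B)) (extend cutInLeft y (restrict A x)) : ℝ) : ℂ) := by
      push_cast
      simp only [leftProb_extend CA h1, conj_one, LinearMap.id_apply, trace_basisState_mul]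
      rfl
    have hsum : outcomeWeight A CB (restrict B x) ((cutState B CA x).trace • 1) =
        (cutState B CA x).trace * ∑ y, outcomeWeight A CB (restrict B x) (basisState y) := by
      rw [map_smul, ← map_sum, ← hone, smul_eq_mul]
    rw [hsum, htr, Complex.re_ofReal_mul, Complex.re_sum,
      Finset.sum_mul_sum, Finset.sum_comm]
    refine Finset.sum_congr rfl fun y _ => Finset.sum_congr rfl fun y' _ => ?_
    have := (rightProb_nonneg_and_eq CB h1 y' (restrict B x)).2
    rw [conj_one, LinearMap.id_apply] at this
    rw [outcomeWeight_apply, ← this, Complex.ofReal_re]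
  · simp

-- The second circuit does not touch `A \ B`, so fixing the bits of `x` there before or after it
-- makes no difference. The uncut circuit is thus the identity channel on the cut state between the
-- two halves.
open Classical in
lemma run_lift_append_apply (CA : Circuit A) (CB : Circuit B) (x : Fin n → Bool) :
    (CA.lift ++ CB.lift).run (basisState fun _ => false) x x = if Supported A B x then
      outcomeWeight A CB (restrict B x) (cutState B CA x) else 0 := by
  have hA : Injective (Embedding.subtype (· ∈ A)) := (Embedding.subtype _).injective
  have hB : Injective (Embedding.subtype (· ∈ B)) := (Embedding.subtype _).injective
  have key : ∀ s t : Fin n → Bool, CA.lift.run (basisState fun _ => false) s t =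
      if (∀ w, w ∉ A → s w = false) ∧ (∀ w, w ∉ A → t w = false) then
        CA.run (basisState fun _ => false) (restrict A s) (restrict A t) else 0 := by
    intro s t
    have hz : ∀ s : Fin n → Bool, extend (Embedding.subtype (· ∈ A))
        (s ∘ Embedding.subtype (· ∈ A)) (fun _ => false) = s ↔ ∀ w, w ∉ A → s w = false := by
      intro s
      rw [extend_comp_eq_self_iff hA]
      refine forall_congr' fun w => ⟨fun h hw => h fun k hk => hw (hk ▸ k.2), fun h hw => h fun hA =>
        hw ⟨w, hA⟩ rfl⟩
    rw [apply_eq_block hA (CA.lift.run _) s t, Circuit.lift_eq_mapWires, Circuit.block_run, block_basisState_zero hA]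
    simp only [hz]
    split_ifs
    · rfl
    · rw [← Circuit.runLin_apply, map_zero]; rfl
  rw [Circuit.run_append, apply_eq_block hB (CB.lift.run _) x x, Circuit.lift_eq_mapWires CB, Circuit.block_run]
  have hblock : block (Embedding.subtype (· ∈ B)) (CA.lift.run (basisState fun _ => false)) x x =
      if Supported A B x then embed cutInRight (cutState B CA x) else 0 := by
    ext u v
    rw [block, Matrix.of_apply, key]
    -- The first circuit leaves 0 on all wires outside `A`. This separates into a condition on `x`
    -- outside `A ∪ B` and one on `u` on `B \ A`, the latter being the zero pattern of `embed`.
    have hz : ∀ u : B → Bool, (∀ w, w ∉ A → extend (Embedding.subtype (· ∈ B)) u x w = false) ↔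
        Supported A B x ∧ extend (cutInRight : ↥(A ∩ B) → B) (u ∘ cutInRight) (fun _ => false) = u := by
      intro u
      rw [extend_comp_eq_self_iff cutInRight_injective]
      constructor
      · intro h
        refine ⟨fun w h1 h2 => ?_, fun w hw => ?_⟩
        · rw [← h w h1, extend_apply']
          rintro ⟨k, rfl⟩
          exact h2 k.2
        · have := h w.1 fun hA => hw ⟨w.1, Finset.mem_inter.mpr ⟨hA, w.2⟩⟩ rfl
          rw [← this]
          exact (hB.extend_apply u x w).symm
      · rintro ⟨h1, h2⟩ w hw
        by_cases hwB : w ∈ B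
        · refine (hB.extend_apply u x ⟨w, hwB⟩).trans (h2 ⟨w, hwB⟩ fun k hk => hw ?_)
          have := congrArg Subtype.val hk
          change k.1 = w at this
          rw [← this]
          exact (Finset.mem_inter.mp k.2).1
        · rw [extend_apply']
          · exact h1 w hw hwB
          · rintro ⟨k, rfl⟩
            exact hwB k.2
    have hr : ∀ u : B → Bool, restrict A (extend (Embedding.subtype (· ∈ B)) u x) =
        extend (cutInLeft : ↥(A ∩ B) → A) (u ∘ cutInRight) (restrict A x) := by
      intro u
      funext w
      by_cases hwB : w.1 ∈ B
      · have h1 : w = cutInLeft (⟨w.1, Finset.mem_inter.mpr ⟨w.2, hwB⟩⟩ : ↥(A ∩ B)) := rfl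
        conv_rhs => rw [h1, cutInLeft_injective.extend_apply]
        exact hB.extend_apply u x ⟨w.1, hwB⟩
      · rw [extend_apply' _ _ _ (by
          rintro ⟨k, rfl⟩
          exact hwB (Finset.mem_inter.mp k.2).2)]
        refine extend_apply' _ _ _ ?_
        rintro ⟨k, hk⟩
        exact hwB (hk ▸ k.2)
    simp only [hz, hr]
    by_cases hx : Supported A B x
    · simp only [hx, true_and, if_true, embed_apply]
      rfl
    · simp [hx]
  rw [hblock]
  split_ifs
  · rfl
  · rw [← Circuit.runLin_apply, map_zero]; rfl

lemma cuttingLaw_false (CA : Circuit A) (CB : Circuit B) (x : Fin n → Bool) :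
    cuttingLaw CA CB (false, x) = (2 ^ (A ∩ B).card + 1) / (2 * 2 ^ (A ∩ B).card + 1) *
      cliffordMean fun V : Op ↥(A ∩ B) => cutProb CA CB V x := rfl

lemma cuttingLaw_true (CA : Circuit A) (CB : Circuit B) (x : Fin n → Bool) :
    cuttingLaw CA CB (true, x) = 1 / (2 * 2 ^ (A ∩ B).card + 1) * discardProb CA CB x := by
  have h : (2 : ℝ) ^ (A ∩ B).card ≠ 0 := by positivity
  change 2 ^ (A ∩ B).card / (2 * 2 ^ (A ∩ B).card + 1) *
    ((1 / 2 ^ (A ∩ B).card) * discardProb CA CB x) = _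
  field_simp

open Classical in
lemma cliffordMean_cutProb (CA : Circuit A) (CB : Circuit B) (x : Fin n → Bool) :
    (cliffordMean fun V : Op ↥(A ∩ B) => cutProb CA CB V x) = (if Supported A B x then
      (outcomeWeight A CB (restrict B x) ((cutState B CA x).trace • 1 + cutState B CA x)).re else 0) /
        (2 ^ (A ∩ B).card + 1) := by
  rw [cliffordMean_congr fun V hV => cutProb_eq CA CB hV.1 x]
  split_ifs
  · rw [cliffordMean_measurePrepare, Fintype.card_coe]
  · simp [cliffordMean]

/-- The cutting procedure may use a random graph-state basis or the computational basis. -/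
lemma cliffordMean_cutProb_eq_graph (CA : Circuit A) (CB : Circuit B) (x : Fin n → Bool) :
    (2 ^ (A ∩ B).card + 1) * (cliffordMean fun V : Op ↥(A ∩ B) => cutProb CA CB V x) =
      cutProb CA CB 1 x + 2 ^ (A ∩ B).card / 2 ^ Fintype.card (↥(A ∩ B) × ↥(A ∩ B)) *
        ∑ g : ↥(A ∩ B) × ↥(A ∩ B) → Bool, cutProb CA CB (graphUnitary g) x := by
  classical
  have hd : (2 ^ (A ∩ B).card + 1 : ℝ) ≠ 0 := by positivity
  rw [cliffordMean_cutProb, mul_div_cancel₀ _ hd, cutProb_eq CA CB (one_mem _),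
    Finset.sum_congr rfl fun g _ => cutProb_eq CA CB (isClifford_graphUnitary g).1 x]
  split_ifs
  · rw [← measurePrepare_design, map_add, map_smul, map_sum, Complex.add_re, conj_one]
    congr 1
    have hreal : (2 ^ Fintype.card ↥(A ∩ B) / 2 ^ Fintype.card (↥(A ∩ B) × ↥(A ∩ B)) : ℂ) =
        ((2 ^ (A ∩ B).card / 2 ^ Fintype.card (↥(A ∩ B) × ↥(A ∩ B)) : ℝ) : ℂ) := by
      rw [Fintype.card_coe]; push_cast; rfl
    rw [hreal, smul_eq_mul, Complex.re_ofReal_mul, Complex.re_sum]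
  · simp

lemma cuttingLaw_nonneg (CA : Circuit A) (CB : Circuit B) (o : Bool × (Fin n → Bool)) :
    0 ≤ cuttingLaw CA CB o := by
  obtain ⟨z, x⟩ := o
  have h1 : (1 : Op ↥(A ∩ B)) ∈ Matrix.unitaryGroup (↥(A ∩ B) → Bool) ℂ := one_mem _
  cases z
  · rw [cuttingLaw_false]
    refine mul_nonneg (by positivity) (cliffordMean_nonneg fun V hV => ?_)
    refine Finset.sum_nonneg fun a _ => Finset.sum_nonneg fun b _ => ?_
    split_ifs
    · exact mul_nonneg (leftProb_nonneg_and_eq CA hV.1 a).1 (rightProb_nonneg_and_eq CB hV.1 _ b).1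
    · exact le_rfl
  · rw [cuttingLaw_true]
    refine mul_nonneg (by positivity) ?_
    refine Finset.sum_nonneg fun y _ => Finset.sum_nonneg fun a _ => Finset.sum_nonneg fun b _ => ?_
    split_ifs
    · exact mul_nonneg (leftProb_nonneg_and_eq CA h1 a).1 (rightProb_nonneg_and_eq CB h1 _ b).1
    · exact le_rfl

lemma sum_ite_assemble (G : (A → Bool) → (B → Bool) → ℝ) :
    ∑ x : Fin n → Bool, ∑ a, ∑ b, (if assemble a b = x then G a b else 0) = ∑ a, ∑ b, G a b := by
  rw [Finset.sum_comm]
  refine Finset.sum_congr rfl fun a _ => ?_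
  rw [Finset.sum_comm]
  simp

lemma sum_cutProb (CA : Circuit A) (CB : Circuit B) {V : Op ↥(A ∩ B)}
    (hV : V ∈ Matrix.unitaryGroup (↥(A ∩ B) → Bool) ℂ) : ∑ x, cutProb CA CB V x = 1 := by
  simp only [cutProb]
  rw [sum_ite_assemble fun a b => leftProb CA V a * rightProb CB V (a ∘ cutInLeft) b]
  simp only [← Finset.mul_sum, sum_rightProb CB hV, mul_one, sum_leftProb CA hV]

lemma sum_discardProb (CA : Circuit A) (CB : Circuit B) :
    ∑ x, discardProb CA CB x = 2 ^ (A ∩ B).card := by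
  have h1 : (1 : Op ↥(A ∩ B)) ∈ Matrix.unitaryGroup (↥(A ∩ B) → Bool) ℂ := one_mem _
  simp only [discardProb]
  rw [Finset.sum_comm]
  simp only [sum_ite_assemble fun a b => leftProb CA (1 : Op ↥(A ∩ B)) a * rightProb CB 1 _ b,
    ← Finset.mul_sum, sum_rightProb CB h1, mul_one, sum_leftProb CA h1]
  rw [Finset.sum_const, Finset.card_univ, Fintype.card_fun, Fintype.card_bool, Fintype.card_coe]
  simp

lemma sum_cuttingLaw (CA : Circuit A) (CB : Circuit B) : ∑ o, cuttingLaw CA CB o = 1 := by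
  rw [Fintype.sum_prod_type, Fintype.sum_bool]
  simp only [cuttingLaw_false, cuttingLaw_true, ← Finset.mul_sum]
  rw [sum_discardProb, sum_cliffordMean (fun (x : Fin n → Bool) (V : Op ↥(A ∩ B)) => cutProb CA CB V x),
    cliffordMean_congr (G := fun _ => 1) fun V hV => sum_cutProb CA CB hV.1, cliffordMean_one]
  have h : (2 * 2 ^ (A ∩ B).card + 1 : ℝ) ≠ 0 := by positivity
  field_simp
  ring

/-- The law of one run of the cutting procedure. -/
def cuttingPMF (CA : Circuit A) (CB : Circuit B) : PMF (Bool × (Fin n → Bool)) :=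
  PMF.ofFintype (fun o => ENNReal.ofReal (cuttingLaw CA CB o)) (by
    rw [← ENNReal.ofReal_sum_of_nonneg fun o _ => cuttingLaw_nonneg CA CB o, sum_cuttingLaw,
      ENNReal.ofReal_one])

lemma cuttingPMF_toReal (CA : Circuit A) (CB : Circuit B) (o : Bool × (Fin n → Bool)) :
    (cuttingPMF CA CB o).toReal = cuttingLaw CA CB o := by
  rw [cuttingPMF, PMF.ofFintype_apply, ENNReal.toReal_ofReal (cuttingLaw_nonneg CA CB o)]

-- With ρ the cut state, the branch z = 0 has weight (Tr(ρ) I + ρ)/(2d+1), because the factor d + 1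
-- of its probability cancels, and z = 1 has weight Tr(ρ) I/(2d+1). The difference is ρ/(2d+1).
open Classical in
lemma cuttingLaw_unbiased (CA : Circuit A) (CB : Circuit B) (x : Fin n → Bool) :
    (2 ^ ((A ∩ B).card + 1) + 1) * (cuttingLaw CA CB (false, x) - cuttingLaw CA CB (true, x)) =
      (if Supported A B x then outcomeWeight A CB (restrict B x) (cutState B CA x) else 0).re := by
  rw [cuttingLaw_false, cuttingLaw_true, cliffordMean_cutProb, discardProb_eq]
  have h1 : (2 * 2 ^ (A ∩ B).card + 1 : ℝ) ≠ 0 := by positivity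
  have h2 : (2 ^ (A ∩ B).card + 1 : ℝ) ≠ 0 := by positivity
  split_ifs
  · rw [map_add, Complex.add_re, pow_succ]
    field_simp
    ring
  · simp

open scoped ComplexOrder in
/-- The output of the cutting procedure is an unbiased estimator. -/
lemma sum_cuttingLaw_mul_estimator (CA : Circuit A) (CB : Circuit B) (f : (Fin n → Bool) → ℝ) :
    ((∑ o, cuttingLaw CA CB o * estimator (A ∩ B).card f o : ℝ) : ℂ) =
      expectationValue (CA.lift ++ CB.lift) f := by
  classical
  have h : ∑ o, cuttingLaw CA CB o * estimator (A ∩ B).card f o =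
      ∑ x, f x * ((CA.lift ++ CB.lift).run (basisState fun _ => false) x x).re := by
    rw [Fintype.sum_prod_type, Fintype.sum_bool, ← Finset.sum_add_distrib]
    refine Finset.sum_congr rfl fun x _ => ?_
    rw [run_lift_append_apply, ← cuttingLaw_unbiased]
    simp only [estimator, if_true, Bool.false_eq_true, if_false]
    ring
  rw [h, expectationValue, Matrix.trace]
  push_cast
  refine Finset.sum_congr rfl fun x _ => ?_
  rw [Matrix.diag_apply, Matrix.diagonal_mul,
    (diag_re_nonneg (Circuit.posSemidef_run _ (posSemidef_basisState _)) x).2]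

end Law

/-! ### Backward semantics of programs -/

section Semantics

variable {q s : ℕ}

/-- `project` as a linear map. -/
def projectLin {W : Type} (w : W) (b : Bool) : Op W →ₗ[ℂ] Op W where
  toFun := project w b
  map_add' M N := by
    ext u v
    simp only [project, Matrix.of_apply, Matrix.add_apply]
    split_ifs <;> simp
  map_smul' c M := by
    ext u v
    simp only [project, Matrix.of_apply, Matrix.smul_apply, RingHom.id_apply]
    split_ifs <;> simp

/-- Linear functionals on the states of a device. -/
abbrev Functional (q s : ℕ) : Type := (Fin s → Bool) → (Op (Fin q) →ₗ[ℂ] ℂ)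

/-- The value of a functional after an elementary operation, as a functional of the state before. -/
def Instr.pull : Instr q s → Functional q s → Functional q s
  | .reset w, F => fun μ => F μ ∘ₗ applyOnLin resetMap (fun _ => w)
  | .measure w i, F => fun μ => ∑ b : Bool, F (Function.update μ i b) ∘ₗ projectLin w b
  | .gate g e, F => fun μ => F μ ∘ₗ applyOnLin g.map e
  | .hadamard i w, F => fun μ =>
      if μ i then F μ ∘ₗ applyOnLin hadamardMap (fun _ => w) else F μ
  | .phase i w, F => fun μ => if μ i then F μ ∘ₗ applyOnLin phaseMap (fun _ => w) else F μ
  | .cnot i e, F => fun μ => if μ i then F μ ∘ₗ applyOnLin cnotMap e else F μ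
  | .logic g i j l, F => fun μ => F (Function.update μ l (g (μ i) (μ j)))
  | .uniform N _ _ _ dest, F => fun μ => (1 / (N : ℂ)) • ∑ v : Fin N,
      F (Function.extend dest (fun t => v.1.testBit t) μ)

lemma sum_updateMemory (u : (Fin s → Bool) → (Fin s → Bool)) (F : Functional q s)
    (σ : DeviceState q s) : ∑ μ, F μ (updateMemory u σ μ) = ∑ μ, F (u μ) (σ μ) := by
  simp only [updateMemory, map_sum]
  rw [Finset.sum_comm]
  refine Finset.sum_congr rfl fun μ' _ => ?_
  rw [Finset.sum_eq_single (u μ')]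
  · simp
  · intro μ _ h
    rw [if_neg (Ne.symm h), map_zero]
  · simp

/-- Duality of the Schrödinger and Heisenberg pictures for one operation. Pulling functionals back
follows a single memory content at a time instead of the whole family of subnormalized states. -/
lemma Instr.sum_step (I : Instr q s) (F : Functional q s) (σ : DeviceState q s) :
    ∑ μ, F μ (Instr.step σ I μ) = ∑ μ, I.pull F μ (σ μ) := by
  cases I with
  | reset w => rfl
  | gate g e => rfl
  | measure w i =>
    simp only [Instr.step, Instr.pull, Finset.sum_apply, map_sum, LinearMap.sum_apply,
      LinearMap.comp_apply]
    rw [Finset.sum_comm]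
    conv_rhs => rw [Finset.sum_comm]
    refine Finset.sum_congr rfl fun b _ => ?_
    rw [sum_updateMemory]
    rfl
  | hadamard i w =>
    refine Finset.sum_congr rfl fun μ _ => ?_
    simp only [Instr.step, Instr.pull]
    split_ifs <;> rfl
  | phase i w =>
    refine Finset.sum_congr rfl fun μ _ => ?_
    simp only [Instr.step, Instr.pull]
    split_ifs <;> rfl
  | cnot i e =>
    refine Finset.sum_congr rfl fun μ _ => ?_
    simp only [Instr.step, Instr.pull]
    split_ifs <;> rfl
  | logic g i j l => exact sum_updateMemory _ _ _
  | uniform N b hN hb dest =>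
    simp only [Instr.step, Instr.pull, Pi.smul_apply, Finset.sum_apply, map_smul, map_sum,
      LinearMap.smul_apply, LinearMap.sum_apply, ← Finset.smul_sum]
    congr 1
    rw [Finset.sum_comm]
    conv_rhs => rw [Finset.sum_comm]
    exact Finset.sum_congr rfl fun v _ => sum_updateMemory _ _ _

/-- The value of a functional after a sequence of operations. -/
def pullCode (L : List (Instr q s)) (F : Functional q s) : Functional q s :=
  L.foldr Instr.pull F

lemma pullCode_nil (F : Functional q s) : pullCode [] F = F := rfl

lemma pullCode_cons (I : Instr q s) (L : List (Instr q s)) (F : Functional q s) :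
    pullCode (I :: L) F = I.pull (pullCode L F) := rfl

lemma pullCode_append (L L' : List (Instr q s)) (F : Functional q s) :
    pullCode (L ++ L') F = pullCode L (pullCode L' F) := by
  simp [pullCode, List.foldr_append]

lemma sum_foldl_step (L : List (Instr q s)) (F : Functional q s) (σ : DeviceState q s) :
    ∑ μ, F μ (L.foldl Instr.step σ μ) = ∑ μ, pullCode L F μ (σ μ) := by
  induction L generalizing σ with
  | nil => rfl
  | cons I L ih => rw [List.foldl_cons, ih, Instr.sum_step, pullCode_cons]

/-- The probability of output `o`, as a functional of the final state. -/
def Program.outputFunctional {n : ℕ} (outZ : Fin s) (outX : Fin n → Fin s)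
    (o : Bool × (Fin n → Bool)) : Functional q s :=
  fun μ => if (μ outZ, μ ∘ outX) = o then Matrix.traceLinearMap _ ℂ ℂ else 0

lemma Program.outputProb_eq_pullCode {n : ℕ} (P : Program q n) (μ₀ : Fin P.bits → Bool)
    (ρ : Op (Fin q)) (o : Bool × (Fin n → Bool)) : P.outputProb μ₀ ρ o =
      pullCode P.code (Program.outputFunctional P.outZ P.outX o) μ₀ ρ := by
  have h : P.outputProb μ₀ ρ o = ∑ μ, Program.outputFunctional P.outZ P.outX o μ
      (P.code.foldl Instr.step (fun μ => if μ = μ₀ then ρ else 0) μ) := by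
    refine Finset.sum_congr rfl fun μ _ => ?_
    simp only [Program.outputFunctional]
    split_ifs <;> rfl
  rw [h, sum_foldl_step, Finset.sum_eq_single μ₀]
  · simp
  · intro μ _ hμ
    simp [hμ]
  · simp

/-- In memory content `μ`, the code applies `Φ` to the qubits and leaves the memory unchanged. -/
def Implements (μ : Fin s → Bool) (L : List (Instr q s)) (Φ : Op (Fin q) → Op (Fin q)) : Prop :=
  ∀ (F : Functional q s) (ρ : Op (Fin q)), pullCode L F μ ρ = F μ (Φ ρ)

variable {μ : Fin s → Bool}

lemma Implements.append {L L' : List (Instr q s)} {Φ Ψ : Op (Fin q) → Op (Fin q)}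
    (h : Implements μ L Φ) (h' : Implements μ L' Ψ) : Implements μ (L ++ L') (fun ρ => Ψ (Φ ρ)) := by
  intro F ρ
  rw [pullCode_append, h, h']

lemma Implements.nil : Implements (q := q) μ [] fun ρ => ρ := fun _ _ => rfl

lemma Implements.flatMap {α : Type} {c : α → List (Instr q s)} {Φ : α → Op (Fin q) → Op (Fin q)}
    (h : ∀ x, Implements μ (c x) (Φ x)) (l : List α) :
    Implements μ (l.flatMap c) (fun ρ => l.foldl (fun ρ x => Φ x ρ) ρ) := by
  induction l with
  | nil => exact Implements.nil
  | cons x l ih => exact (h x).append ih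

lemma Implements.congr {L : List (Instr q s)} {Φ Ψ : Op (Fin q) → Op (Fin q)}
    (h : Implements μ L Φ) (h' : ∀ ρ, Φ ρ = Ψ ρ) : Implements μ L Ψ := by
  intro F ρ
  rw [h, h']

lemma implements_reset (w : Fin q) :
    Implements μ [.reset w] (applyOn resetMap (fun _ : Fin 1 => w)) := fun _ _ => rfl

lemma implements_hadamard (i : Fin s) (w : Fin q) : Implements μ [.hadamard i w]
    (fun ρ => if μ i then applyOn hadamardMap (fun _ : Fin 1 => w) ρ else ρ) := fun F ρ => by
  simp only [pullCode_cons, pullCode_nil, Instr.pull]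
  split_ifs <;> rfl

lemma implements_phase (i : Fin s) (w : Fin q) : Implements μ [.phase i w]
    (fun ρ => if μ i then applyOn phaseMap (fun _ : Fin 1 => w) ρ else ρ) := fun F ρ => by
  simp only [pullCode_cons, pullCode_nil, Instr.pull]
  split_ifs <;> rfl

lemma implements_cnot (i : Fin s) (e : Fin 2 ↪ Fin q) : Implements μ [.cnot i e]
    (fun ρ => if μ i then applyOn cnotMap e ρ else ρ) := fun F ρ => by
  simp only [pullCode_cons, pullCode_nil, Instr.pull]
  split_ifs <;> rfl

/-- The code that applies a circuit. -/
def circuitCode (s : ℕ) (C : Circuit (Fin q)) : List (Instr q s) :=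
  List.map (fun g => .gate g.gate g.wires) C

lemma implements_circuitCode (C : Circuit (Fin q)) : Implements μ (circuitCode s C) C.run := by
  induction C with
  | nil => exact Implements.nil
  | cons g C ih =>
    intro F ρ
    exact ih F (applyOn g.gate.map g.wires ρ)

end Semantics

/-! ### Elementary gates -/

section Gates

variable {K W : Type} [Fintype K] [DecidableEq K]

lemma extend_const_one (w : W) [DecidableEq W] (u : Fin 1 → Bool) (s : W → Bool) :
    extend (fun _ : Fin 1 => w) u s = update s w (u 0) := by
  have hinj : Injective (fun _ : Fin 1 => w) := fun a b _ => Subsingleton.elim a b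
  funext x
  by_cases h : x = w
  · subst h
    rw [update_self]
    exact hinj.extend_apply u s 0
  · rw [update_of_ne h, extend_apply']
    rintro ⟨_, rfl⟩
    exact h rfl

lemma const_one_injective (w : W) : Injective (fun _ : Fin 1 => w) :=
  fun a b _ => Subsingleton.elim a b

lemma tensor_update_apply (w : K) (U : Matrix Bool Bool ℂ) (s t : K → Bool) :
    tensor (update (fun _ => 1) w U) s t =
      if extend (fun _ : Fin 1 => w) (t ∘ fun _ => w) s = t then U (s w) (t w) else 0 := by
  rw [extend_const_one, tensor_apply, ← Finset.mul_prod_erase _ _ (Finset.mem_univ w), update_self]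
  have h : ∏ x ∈ Finset.univ.erase w, (update (fun _ => (1 : Matrix Bool Bool ℂ)) w U) x (s x) (t x) =
      ∏ x ∈ Finset.univ.erase w, if s x = t x then 1 else 0 :=
    Finset.prod_congr rfl fun x hx => by
      rw [update_of_ne (Finset.ne_of_mem_erase hx), Matrix.one_apply]
  rw [h]
  split_ifs with hst
  · rw [Finset.prod_eq_one, mul_one]
    intro x hx
    rw [if_pos]
    rw [← hst, update_of_ne (Finset.ne_of_mem_erase hx)]
  · have : ∃ x, x ≠ w ∧ s x ≠ t x := by
      by_contra hcon
      push Not at hcon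
      refine hst (funext fun x => ?_)
      by_cases hx : x = w
      · subst hx; simp
      · rw [update_of_ne hx, hcon x hx]
    obtain ⟨x, hx, hxs⟩ := this
    rw [Finset.prod_eq_zero (Finset.mem_erase.mpr ⟨hx, Finset.mem_univ x⟩) (if_neg hxs), mul_zero]

lemma applyOn_single (w : K) (U : Matrix Bool Bool ℂ) (N : Op K) :
    applyOn (conj (Matrix.of fun s t : Fin 1 → Bool => U (s 0) (t 0))) (fun _ => w) N =
      conj (tensor (update (fun _ => 1) w U)) N := by
  ext s t
  rw [applyOn_apply, conj_apply, conj_apply, Matrix.mul_apply, Matrix.mul_apply]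
  simp only [Matrix.mul_apply, Matrix.conjTranspose_apply, tensor_update_apply]
  have h1 : ∀ t' : K → Bool, (∑ s' : K → Bool, (if extend (fun _ : Fin 1 => w) (s' ∘ fun _ => w) s = s'
      then U (s w) (s' w) else 0) * N s' t') =
      ∑ u : Fin 1 → Bool, U (s w) (u 0) * N (extend (fun _ => w) u s) t' := by
    intro t'
    simp only [ite_mul, zero_mul]
    rw [sum_ite_extend_eq (const_one_injective w) s fun s' => U (s w) (s' w) * N s' t']
    refine Finset.sum_congr rfl fun u _ => ?_
    rw [extend_const_one, update_self]
  simp only [h1, apply_ite (star : ℂ → ℂ), star_zero, mul_ite, mul_zero]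
  rw [sum_ite_extend_eq (const_one_injective w) t fun t' =>
    (∑ u : Fin 1 → Bool, U (s w) (u 0) * N (extend (fun _ => w) u s) t') * star (U (t w) (t' w))]
  refine Finset.sum_congr rfl fun v _ => ?_
  rw [extend_const_one, update_self]
  simp only [block, Matrix.of_apply, comp_apply]
  congr 1
  refine Finset.sum_congr rfl fun u _ => ?_
  rw [extend_const_one w v]

variable {c : K → W}

lemma applyOn_single_comp (hc : Injective c) (w : K) (U : Matrix Bool Bool ℂ) (M : Op W) :
    applyOn (conj (Matrix.of fun s t : Fin 1 → Bool => U (s 0) (t 0))) (fun _ => c w) M =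
      applyOn (conj (tensor (update (fun _ => 1) w U))) c M := by
  have h := applyOn_comp hc (const_one_injective w)
    (conj (Matrix.of fun s t : Fin 1 → Bool => U (s 0) (t 0))) M
  have h' : applyOnLin (conj (Matrix.of fun s t : Fin 1 → Bool => U (s 0) (t 0))) (fun _ => w) =
      conj (tensor (update (fun _ => 1) w U)) := LinearMap.ext fun N => applyOn_single w U N
  rw [h'] at h
  exact h

lemma applyOn_hadamardMap (hc : Injective c) (w : K) (M : Op W) :
    applyOn hadamardMap (fun _ => c w) M =
      applyOn (conj (tensor (update (fun _ => 1) w hadamardMatrix))) c M :=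
  applyOn_single_comp hc w hadamardMatrix M

/-- The matrix of the phase gate. -/
def phaseMatrix : Matrix Bool Bool ℂ := Matrix.diagonal fun b => if b then Complex.I else 1

lemma applyOn_phaseMap (hc : Injective c) (w : K) (M : Op W) :
    applyOn phaseMap (fun _ => c w) M =
      applyOn (conj (tensor (update (fun _ => 1) w phaseMatrix))) c M := by
  rw [← applyOn_single_comp hc]
  have : phaseMap = conj (Matrix.of fun s t : Fin 1 → Bool => phaseMatrix (s 0) (t 0)) := by
    unfold phaseMap
    congr 1
    ext s t
    have : s = t ↔ s 0 = t 0 := by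
      constructor
      · rintro rfl; rfl
      · intro h
        funext i
        rw [Subsingleton.elim i 0, h]
    simp [phaseMatrix, Matrix.diagonal_apply, this]
  rw [this]

lemma applyOn_conj_diagonal (hc : Injective c) (φ : (K → Bool) → ℂ) (M : Op W) (s t : W → Bool) :
    applyOn (conj (Matrix.diagonal φ)) c M s t = φ (s ∘ c) * M s t * starRingEnd ℂ (φ (t ∘ c)) := by
  rw [applyOn_apply, conj_diagonal_apply, ← apply_eq_block hc]

lemma applyOn_phaseMap_apply (w : W) (M : Op W) (s t : W → Bool) :
    applyOn phaseMap (fun _ => w) M s t =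
      (if s w then Complex.I else 1) * M s t * starRingEnd ℂ (if t w then Complex.I else 1) := by
  have h : phaseMap = conj (Matrix.diagonal fun s : Fin 1 → Bool => if s 0 then Complex.I else 1) := by
    unfold phaseMap
    congr 1
  rw [h, applyOn_conj_diagonal (const_one_injective w)]
  rfl

/-- The action of a controlled-not gate on bit strings. -/
def cnotBits [DecidableEq W] (v w : W) (s : W → Bool) : W → Bool := update s w (xor (s v) (s w))

lemma applyOn_cnotMap_apply [DecidableEq W] (e : Fin 2 ↪ W) (M : Op W) (s t : W → Bool) :
    applyOn cnotMap e M s t = M (cnotBits (e 0) (e 1) s) (cnotBits (e 0) (e 1) t) := by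
  have hperm : ∀ (N : Op (Fin 2)) (u v : Fin 2 → Bool),
      cnotMap N u v = N ![u 0, xor (u 0) (u 1)] ![v 0, xor (v 0) (v 1)] := by
    intro N u v
    have hiff : ∀ u u' : Fin 2 → Bool, (u 0 = u' 0 ∧ u 1 = xor (u' 0) (u' 1)) ↔
        ![u 0, xor (u 0) (u 1)] = u' := by
      intro u u'
      constructor
      · rintro ⟨h1, h2⟩
        funext i
        fin_cases i
        · exact h1
        · simp [h1, h2]
      · rintro rfl
        simp
    simp only [cnotMap, conj_apply, Matrix.mul_apply, Matrix.conjTranspose_apply, Matrix.of_apply, hiff]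
    simp
  rw [applyOn_apply, hperm, block, Matrix.of_apply]
  have hext : ∀ s : W → Bool, extend e ![(s ∘ e) 0, xor ((s ∘ e) 0) ((s ∘ e) 1)] s =
      cnotBits (e 0) (e 1) s := by
    intro s
    funext x
    by_cases hx : ∃ i, e i = x
    · obtain ⟨i, rfl⟩ := hx
      rw [e.injective.extend_apply]
      fin_cases i
      · have : e 0 ≠ e 1 := fun h => by simpa using e.injective h
        simp [cnotBits, this]
      · simp [cnotBits]
    · rw [extend_apply' _ _ _ hx, cnotBits, update_of_ne]
      rintro rfl
      exact hx ⟨1, rfl⟩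
  rw [hext, hext]

end Gates

/-! ### Blocks of code acting on the cut wires -/

section Blocks

variable {K : Type} [Fintype K] [DecidableEq K] {q s : ℕ} {μ : Fin s → Bool}

lemma foldl_applyOn_tensor {W : Type} {c : K → W} (hc : Injective c) (U : K → Matrix Bool Bool ℂ)
    (l : List K) (hl : l.Nodup) (M : Op W) :
    l.foldl (fun M w => applyOn (conj (tensor (update (fun _ => 1) w (U w)))) c M) M =
      applyOn (conj (tensor fun w => if w ∈ l then U w else 1)) c M := by
  induction l generalizing M with
  | nil => simp [tensor_one, conj_one, applyOn_id hc]
  | cons w l ih =>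
    rw [List.foldl_cons, ih hl.of_cons, applyOn_applyOn hc, ← conj_mul, tensor_mul]
    congr 4
    funext x
    by_cases hx : x = w
    · subst hx
      have := (List.nodup_cons.mp hl).1
      simp [this]
    · simp [hx]

/-- A layer of single-qubit gates on all wires. -/
lemma implements_layer {c : K → Fin q} (hc : Injective c) {code : K → List (Instr q s)}
    {U : K → Matrix Bool Bool ℂ}
    (h : ∀ w, Implements μ (code w) (applyOn (conj (tensor (update (fun _ => 1) w (U w)))) c)) :
    Implements μ ((Finset.univ : Finset K).toList.flatMap code) (applyOn (conj (tensor U)) c) :=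
  (Implements.flatMap h _).congr fun ρ => by
    rw [foldl_applyOn_tensor hc _ _ (Finset.nodup_toList _)]
    simp

/-- A layer of Hadamard gates, controlled by a bit. -/
def hadamardCode (i : Fin s) (c : K → Fin q) : List (Instr q s) :=
  (Finset.univ : Finset K).toList.flatMap fun w => [.hadamard i (c w)]

/-- The Hadamard matrix if `b` is set. -/
def hadamardIf (b : Bool) : Matrix Bool Bool ℂ := if b then hadamardMatrix else 1

lemma update_one (w : K) : update (fun _ => (1 : Matrix Bool Bool ℂ)) w 1 = fun _ => 1 := by
  funext x
  by_cases h : x = w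
  · subst h; simp
  · simp [h]

lemma implements_hadamard_single {c : K → Fin q} (hc : Injective c) (i : Fin s) (w : K) :
    Implements μ [.hadamard i (c w)]
      (applyOn (conj (tensor (update (fun _ => 1) w (hadamardIf (μ i))))) c) :=
  (implements_hadamard i (c w)).congr fun ρ => by
    unfold hadamardIf
    split_ifs
    · exact applyOn_hadamardMap hc w ρ
    · rw [update_one, tensor_one, conj_one, applyOn_id hc]

lemma implements_phase_single {c : K → Fin q} (hc : Injective c) (i : Fin s) (w : K) :
    Implements μ [.phase i (c w)]
      (applyOn (conj (tensor (update (fun _ => 1) w (if μ i then phaseMatrix else 1)))) c) :=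
  (implements_phase i (c w)).congr fun ρ => by
    split_ifs
    · exact applyOn_phaseMap hc w ρ
    · rw [update_one, tensor_one, conj_one, applyOn_id hc]

lemma implements_hadamardCode {c : K → Fin q} (hc : Injective c) (i : Fin s) :
    Implements μ (hadamardCode i c) (applyOn (conj (tensor fun _ => hadamardIf (μ i))) c) :=
  implements_layer hc fun w => implements_hadamard_single hc i w

/-- Flips of the wires whose bit is set. -/
def flipCode (y : K → Fin s) (c : K → Fin q) : List (Instr q s) :=
  (Finset.univ : Finset K).toList.flatMap fun w =>
    [.hadamard (y w) (c w)] ++ ([.phase (y w) (c w)] ++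
      ([.phase (y w) (c w)] ++ [.hadamard (y w) (c w)]))

/-- The matrix of a bit flip if `b` is set. -/
def flipMatrix (b : Bool) : Matrix Bool Bool ℂ := Matrix.of fun s t => if s = xor t b then 1 else 0

/-- S² = Z and HZH = X: this writes a controlled bit flip with the gates the device offers. -/
lemma hadamard_phase_phase_hadamard (b : Bool) :
    hadamardIf b * ((if b then phaseMatrix else 1) * ((if b then phaseMatrix else 1) * hadamardIf b)) =
      flipMatrix b := by
  cases b
  · ext s t
    simp [hadamardIf, flipMatrix, Matrix.one_apply]
  · have h1 := sqrt_two_mul_self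
    have h2 := sqrt_two_ne_zero
    have h3 : phaseMatrix * phaseMatrix = Matrix.diagonal fun b : Bool => if b then (-1 : ℂ) else 1 := by
      rw [phaseMatrix, Matrix.diagonal_mul_diagonal]
      congr 1
      funext b
      cases b <;> simp
    simp only [if_true, hadamardIf]
    rw [← Matrix.mul_assoc phaseMatrix, h3]
    ext s t
    cases s <;> cases t <;>
      simp [hadamardMatrix, flipMatrix, Matrix.mul_apply, Matrix.diagonal_apply] <;> field_simp <;>
      norm_num [pow_two, h1]

lemma applyOn_tensor_update_mul {W : Type} {c : K → W} (hc : Injective c) (w : K)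
    (U V : Matrix Bool Bool ℂ) (M : Op W) :
    applyOn (conj (tensor (update (fun _ => 1) w U))) c
      (applyOn (conj (tensor (update (fun _ => 1) w V))) c M) =
      applyOn (conj (tensor (update (fun _ => 1) w (U * V)))) c M := by
  rw [applyOn_applyOn hc, ← conj_mul, tensor_mul]
  congr 3
  funext x
  by_cases h : x = w
  · subst h; simp
  · simp [h]

lemma implements_flipCode {c : K → Fin q} (hc : Injective c) (y : K → Fin s) :
    Implements μ (flipCode y c) (applyOn (conj (tensor fun w => flipMatrix (μ (y w)))) c) :=
  implements_layer hc fun w =>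
    ((implements_hadamard_single hc (y w) w).append ((implements_phase_single hc (y w) w).append
      ((implements_phase_single hc (y w) w).append (implements_hadamard_single hc (y w) w)))).congr
      fun ρ => by
        rw [applyOn_tensor_update_mul hc, applyOn_tensor_update_mul hc, applyOn_tensor_update_mul hc,
          Matrix.mul_assoc, Matrix.mul_assoc, hadamard_phase_phase_hadamard]

lemma conj_flip_basisState (y : K → Bool) :
    conj (tensor fun w => flipMatrix (y w)) (basisState fun _ => false) = basisState y := by
  have h : ∀ p : K → Bool, tensor (fun w => flipMatrix (y w)) p (fun _ => false) =
      if y = p then 1 else 0 := by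
    intro p
    rw [tensor_apply]
    simp only [flipMatrix, Matrix.of_apply, Bool.false_bne]
    split_ifs with h
    · subst h; simp
    · obtain ⟨w, hw⟩ := Function.ne_iff.mp h
      exact Finset.prod_eq_zero (Finset.mem_univ w) (if_neg fun h => hw h.symm)
  ext p r
  rw [conj_basisState_apply, h, h, basisState_apply]
  by_cases h1 : y = p <;> by_cases h2 : y = r <;> simp only [h1, h2, if_true, if_false] <;> simp

/-- Two distinct wires. -/
def pairEmbedding {W : Type} {v w : W} (h : v ≠ w) : Fin 2 ↪ W where
  toFun := ![v, w]
  inj' a b := by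
    have := h.symm
    fin_cases a <;> fin_cases b <;> simp_all

lemma pairEmbedding_zero {W : Type} {v w : W} (h : v ≠ w) : pairEmbedding h 0 = v := rfl

lemma pairEmbedding_one {W : Type} {v w : W} (h : v ≠ w) : pairEmbedding h 1 = w := rfl

/-- The gate of a pair of wires: a phase gate or a controlled-`Z` gate, controlled by a bit. -/
def pairCode (i : Fin s) (c : K ↪ Fin q) (v w : K) : List (Instr q s) :=
  if h : v = w then [.phase i (c v)]
  else
    [.cnot i (pairEmbedding (c.injective.ne h))] ++
    ([.phase i (c w)] ++ ([.phase i (c w)] ++ ([.phase i (c w)] ++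
    ([.cnot i (pairEmbedding (c.injective.ne h))] ++
    ([.phase i (c v)] ++ [.phase i (c w)])))))

/-- The code for the inverse gate. -/
def pairCodeInv (i : Fin s) (c : K ↪ Fin q) (v w : K) : List (Instr q s) :=
  if v = w then [.phase i (c v)] ++ ([.phase i (c v)] ++ [.phase i (c v)]) else pairCode i c v w

/-- The phase of a pair if `b` is set. -/
def pairPhaseIf (b : Bool) (v w : K) (x : K → Bool) : ℂ := if b then pairPhase v w x else 1

lemma cnotBits_cnotBits {W : Type} [DecidableEq W] {v w : W} (h : v ≠ w) (x : W → Bool) :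
    cnotBits v w (cnotBits v w x) = x := by
  funext y
  unfold cnotBits
  by_cases hy : y = w
  · subst hy
    simp [h]
  · simp [hy]

/-- Since a + b − (a xor b) = 2ab, the controlled-Z sign is i^a · i^b · i^{−(a xor b)}. The
controlled-not writes a xor b on the second wire, three phase gates act as the inverse phase, and
the second controlled-not undoes the first. -/
lemma implements_pairCode (i : Fin s) (c : K ↪ Fin q) (v w : K) :
    Implements μ (pairCode i c v w)
      (applyOn (conj (Matrix.diagonal (pairPhaseIf (μ i) v w))) c) := by
  unfold pairCode
  split_ifs with hvw
  · subst hvw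
    refine (implements_phase i (c v)).congr fun ρ => ?_
    ext x y
    rw [applyOn_conj_diagonal c.injective]
    split_ifs with hi
    · rw [applyOn_phaseMap_apply]
      simp [pairPhaseIf, pairPhase, hi]
    · simp [pairPhaseIf, hi]
  · have hne : c v ≠ c w := fun h => hvw (c.injective h)
    refine ((implements_cnot i _).append ((implements_phase i (c w)).append
      ((implements_phase i (c w)).append ((implements_phase i (c w)).append
      ((implements_cnot i _).append ((implements_phase i (c v)).append
        (implements_phase i (c w)))))))).congr fun ρ => ?_
    ext x y
    rw [applyOn_conj_diagonal c.injective]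
    by_cases hi : μ i = true
    · simp only [hi, if_true, applyOn_phaseMap_apply, applyOn_cnotMap_apply]
      simp only [pairEmbedding_zero, pairEmbedding_one, cnotBits_cnotBits hne]
      have h1 : ∀ x : Fin q → Bool, cnotBits (c v) (c w) x (c w) = xor (x (c v)) (x (c w)) :=
        fun x => by simp [cnotBits]
      simp only [h1, pairPhaseIf, if_true, pairPhase, if_neg hvw, comp_apply]
      have hF : ∀ a b : Bool, (if a && b then (-1 : ℂ) else 1) = (if b then Complex.I else 1) *
          ((if a then Complex.I else 1) * ((if xor a b then Complex.I else 1) *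
            ((if xor a b then Complex.I else 1) * (if xor a b then Complex.I else 1)))) := by
        intro a b
        cases a <;> cases b <;> simp
      refine Eq.trans ?_ (congrArg₂ (fun a b => a * ρ x y * starRingEnd ℂ b)
        (hF (x (c v)) (x (c w))) (hF (y (c v)) (y (c w)))).symm
      simp only [map_mul]
      ring
    · simp [hi, pairPhaseIf]

lemma conj_diagonal_conjTranspose_apply {W : Type} {c : K → W} (hc : Injective c)
    (φ : (K → Bool) → ℂ) (M : Op W) (s t : W → Bool) :
    applyOn (conj (Matrix.diagonal φ).conjTranspose) c M s t =
      starRingEnd ℂ (φ (s ∘ c)) * M s t * φ (t ∘ c) := by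
  rw [Matrix.diagonal_conjTranspose, applyOn_conj_diagonal hc]
  simp

/-- The phase gate has order 4, so its inverse is its cube; controlled-Z is its own inverse. -/
lemma implements_pairCodeInv (i : Fin s) (c : K ↪ Fin q) (v w : K) :
    Implements μ (pairCodeInv i c v w)
      (applyOn (conj (Matrix.diagonal (pairPhaseIf (μ i) v w)).conjTranspose) c) := by
  unfold pairCodeInv
  split_ifs with hvw
  · subst hvw
    refine ((implements_phase i (c v)).append ((implements_phase i (c v)).append
      (implements_phase i (c v)))).congr fun ρ => ?_
    ext x y
    rw [conj_diagonal_conjTranspose_apply c.injective]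
    by_cases hi : μ i = true
    · simp only [hi, if_true, applyOn_phaseMap_apply, pairPhaseIf, pairPhase, comp_apply]
      have hF : ∀ a : Bool, starRingEnd ℂ (if a then Complex.I else 1) = (if a then Complex.I else 1) *
          ((if a then Complex.I else 1) * (if a then Complex.I else 1)) := by
        intro a
        cases a <;> simp
      have hF' : ∀ a : Bool, (if a then Complex.I else 1) = starRingEnd ℂ (if a then Complex.I else 1) *
          (starRingEnd ℂ (if a then Complex.I else 1) * starRingEnd ℂ (if a then Complex.I else 1)) := by
        intro a
        cases a <;> simp
      refine Eq.trans ?_ (congrArg₂ (fun a b => a * ρ x y * b)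
        (hF (x (c v))) (hF' (y (c v)))).symm
      ring
    · simp [hi, pairPhaseIf]
  · refine (implements_pairCode i c v w).congr fun ρ => ?_
    ext x y
    rw [conj_diagonal_conjTranspose_apply c.injective, applyOn_conj_diagonal c.injective]
    have h : ∀ x, starRingEnd ℂ (pairPhaseIf (μ i) v w x) = pairPhaseIf (μ i) v w x := by
      intro x
      simp only [pairPhaseIf, pairPhase, if_neg hvw]
      split_ifs <;> simp
    rw [h, h]

/-- The diagonal gate with edges given by bits. -/
def graphCode (g : K × K → Fin s) (c : K ↪ Fin q) : List (Instr q s) :=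
  (Finset.univ : Finset (K × K)).toList.flatMap fun ij => pairCode (g ij) c ij.1 ij.2

/-- The inverse of the diagonal gate with edges given by bits. -/
def graphCodeInv (g : K × K → Fin s) (c : K ↪ Fin q) : List (Instr q s) :=
  (Finset.univ : Finset (K × K)).toList.flatMap fun ij => pairCodeInv (g ij) c ij.1 ij.2

lemma foldl_applyOn_diagonal {W α : Type} {c : K → W} (hc : Injective c)
    (φ : α → (K → Bool) → ℂ) (l : List α) (M : Op W) :
    l.foldl (fun M a => applyOn (conj (Matrix.diagonal (φ a))) c M) M =
      applyOn (conj (Matrix.diagonal fun x => (l.map fun a => φ a x).prod)) c M := by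
  induction l generalizing M with
  | nil => simp [conj_one, applyOn_id hc]
  | cons a l ih =>
    rw [List.foldl_cons, ih, applyOn_applyOn hc, ← conj_mul, Matrix.diagonal_mul_diagonal]
    congr 3
    funext x
    simp [mul_comm]

lemma implements_graphCode (g : K × K → Fin s) (c : K ↪ Fin q) :
    Implements μ (graphCode g c)
      (applyOn (conj (Matrix.diagonal (graphPhase fun ij => μ (g ij)))) c) :=
  (Implements.flatMap (fun ij => implements_pairCode (g ij) c ij.1 ij.2) _).congr fun ρ => by
    rw [foldl_applyOn_diagonal c.injective
      (fun ij : K × K => pairPhaseIf (μ (g ij)) ij.1 ij.2)]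
    simp only [Finset.prod_map_toList]
    rfl

lemma implements_graphCodeInv (g : K × K → Fin s) (c : K ↪ Fin q) :
    Implements μ (graphCodeInv g c)
      (applyOn (conj (Matrix.diagonal (graphPhase fun ij => μ (g ij))).conjTranspose) c) :=
  (Implements.flatMap (fun ij => implements_pairCodeInv (g ij) c ij.1 ij.2) _).congr fun ρ => by
    simp only [Matrix.diagonal_conjTranspose]
    rw [foldl_applyOn_diagonal c.injective
      (fun ij : K × K => star (pairPhaseIf (μ (g ij)) ij.1 ij.2))]
    simp only [Finset.prod_map_toList]
    congr 3
    funext x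
    simp only [Pi.star_apply, graphPhase, star_prod]
    rfl

/-- A graph unitary with the layer of Hadamard gates controlled by `b`. -/
def basisUnitary (b : Bool) (g : K × K → Bool) : Op K :=
  Matrix.diagonal (graphPhase g) * tensor fun _ => hadamardIf b

lemma basisUnitary_true (g : K × K → Bool) : basisUnitary true g = graphUnitary g := rfl

lemma basisUnitary_false : basisUnitary false (fun _ : K × K => false) = 1 := by
  have : graphPhase (fun _ : K × K => false) = fun _ => 1 := by
    funext x
    simp [graphPhase]
  simp [basisUnitary, hadamardIf, tensor_one, this]

lemma basisUnitary_conjTranspose (b : Bool) (g : K × K → Bool) :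
    (basisUnitary b g).conjTranspose =
      (tensor fun _ => hadamardIf b) * (Matrix.diagonal (graphPhase g)).conjTranspose := by
  rw [basisUnitary, Matrix.conjTranspose_mul, tensor_conjTranspose]
  congr 3
  funext w
  cases b
  · simp [hadamardIf]
  · exact hadamardMatrix_conjTranspose

lemma implements_basis (b : Fin s) (g : K × K → Fin s) (c : K ↪ Fin q) :
    Implements μ (hadamardCode b c ++ graphCode g c)
      (applyOn (conj (basisUnitary (μ b) fun ij => μ (g ij))) c) :=
  ((implements_hadamardCode c.injective b).append (implements_graphCode g c)).congr fun ρ => by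
    rw [applyOn_applyOn c.injective, ← conj_mul]
    rfl

lemma implements_basisInv (b : Fin s) (g : K × K → Fin s) (c : K ↪ Fin q) :
    Implements μ (graphCodeInv g c ++ hadamardCode b c)
      (applyOn (conj (basisUnitary (μ b) fun ij => μ (g ij)).conjTranspose) c) :=
  ((implements_graphCodeInv g c).append (implements_hadamardCode c.injective b)).congr fun ρ => by
    rw [applyOn_applyOn c.injective, ← conj_mul, basisUnitary_conjTranspose]

end Blocks

section Registers

variable {q s t : ℕ} {μ : Fin s → Bool}

/-! ### Initialization -/

/-- Initialization of a register. -/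
def resetCode (s : ℕ) (e : Fin t → Fin q) : List (Instr q s) :=
  (List.finRange t).flatMap fun i => [.reset (e i)]

lemma trace_resetMap (N : Op (Fin 1)) : (resetMap N).trace = N.trace := by
  change (N.trace • basisState fun _ => false).trace = _
  rw [Matrix.trace_smul, trace_basisState, smul_eq_mul, mul_one]

/-- `S` collects the qubits known to be in state 0. An entry after the reset of `w` is a sum of old
entries with the same bits on all other qubits, so earlier zeros persist. -/
lemma applyOn_resetMap_eq_zero {W : Type} [DecidableEq W] {S : Set W} {M : Op W} (w : W)
    (hM : ∀ i ∈ S, ∀ s t : W → Bool, s i = true ∨ t i = true → M s t = 0) :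
    ∀ i ∈ insert w S, ∀ s t : W → Bool, s i = true ∨ t i = true →
      applyOn resetMap (fun _ : Fin 1 => w) M s t = 0 := by
  intro i hi s t hst
  rw [applyOn_apply]
  change (block (fun _ : Fin 1 => w) M s t).trace *
    basisState (fun _ => false) (s ∘ fun _ => w) (t ∘ fun _ => w) = 0
  by_cases hiw : i = w
  · subst hiw
    rw [basisState_apply, if_neg, mul_zero]
    rintro ⟨h1, h2⟩
    have h1 := congrFun h1 0
    have h2 := congrFun h2 0
    simp only [comp_apply] at h1 h2
    rw [← h1, ← h2] at hst
    simp at hst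
  · have : (block (fun _ : Fin 1 => w) M s t).trace = 0 := by
      refine Finset.sum_eq_zero fun u _ => ?_
      rw [Matrix.diag_apply, block, Matrix.of_apply, extend_const_one, extend_const_one]
      refine hM i (Set.mem_of_mem_insert_of_ne hi hiw) _ _ ?_
      rwa [update_of_ne hiw, update_of_ne hiw]
    rw [this, zero_mul]

lemma foldl_reset_eq_zero {W : Type} [DecidableEq W] (l : List W) {S : Set W} {M : Op W}
    (hM : ∀ i ∈ S, ∀ s t : W → Bool, s i = true ∨ t i = true → M s t = 0) :
    ∀ i, i ∈ S ∨ i ∈ l → ∀ s t : W → Bool, s i = true ∨ t i = true →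
      l.foldl (fun M w => applyOn resetMap (fun _ : Fin 1 => w) M) M s t = 0 := by
  induction l generalizing S M with
  | nil =>
    intro i hi
    exact hM i (by simpa using hi)
  | cons w l ih =>
    intro i hi
    refine ih (applyOn_resetMap_eq_zero w hM) i ?_
    rcases hi with hi | hi
    · exact Or.inl (Set.mem_insert_of_mem _ hi)
    · rcases List.mem_cons.mp hi with rfl | hi
      · exact Or.inl (Set.mem_insert _ _)
      · exact Or.inr hi

/-- After all resets only the entry at the zero string can be nonzero, and its value is fixed by
preservation of the trace. -/
lemma foldl_reset_finRange (M : Op (Fin t)) :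
    (List.finRange t).foldl (fun M w => applyOn resetMap (fun _ : Fin 1 => w) M) M =
      M.trace • basisState fun _ => false := by
  have htr : ∀ (l : List (Fin t)) (M : Op (Fin t)),
      (l.foldl (fun M w => applyOn resetMap (fun _ : Fin 1 => w) M) M).trace = M.trace := by
    intro l
    induction l with
    | nil => exact fun M => rfl
    | cons w l ih =>
      intro M
      rw [List.foldl_cons, ih, trace_applyOn (const_one_injective w) _ trace_resetMap]
  have h0 := foldl_reset_eq_zero (List.finRange t) (S := ∅) (M := M) (by simp)
  have h1 := htr (List.finRange t) M
  set R := (List.finRange t).foldl (fun M w => applyOn resetMap (fun _ : Fin 1 => w) M) M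
  have hz : ∀ u v : Fin t → Bool, ¬ ((fun _ => false) = u ∧ (fun _ => false) = v) → R u v = 0 := by
    intro u v huv
    rw [not_and_or] at huv
    rcases huv with h | h <;> obtain ⟨i, hi⟩ := Function.ne_iff.mp h
    · exact h0 i (Or.inr (List.mem_finRange i)) u v (Or.inl (by simpa using Ne.symm hi))
    · exact h0 i (Or.inr (List.mem_finRange i)) u v (Or.inr (by simpa using Ne.symm hi))
  have h00 : R (fun _ => false) (fun _ => false) = M.trace := by
    rw [← h1, Matrix.trace, Finset.sum_eq_single fun _ => false]
    · rfl
    · intro u _ hu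
      exact hz u u fun h => hu h.1.symm
    · simp
  ext u v
  rw [Matrix.smul_apply, basisState_apply]
  split_ifs with h
  · rw [← h.1, ← h.2, h00]; simp
  · rw [hz u v h]; simp

/-- Only the reduced state of the register is described; the other qubits stay arbitrary. This is
why the program works from any initial state, and why the second register may reuse qubits of the
first. -/
lemma implements_resetCode (e : Fin t ↪ Fin q) : ∃ Φ : Op (Fin q) → Op (Fin q),
    (∀ μ : Fin s → Bool, Implements μ (resetCode s e) Φ) ∧
      ∀ ρ, partialTrace e (Φ ρ) = ρ.trace • basisState fun _ => false := by
  refine ⟨_, fun μ => Implements.flatMap (fun i => implements_reset (e i)) (List.finRange t),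
    fun ρ => ?_⟩
  have h : ∀ (l : List (Fin t)) (ρ : Op (Fin q)),
      partialTrace e (l.foldl (fun ρ i => applyOn resetMap (fun _ : Fin 1 => e i) ρ) ρ) =
      l.foldl (fun M w => applyOn resetMap (fun _ : Fin 1 => w) M) (partialTrace e ρ) := by
    intro l
    induction l with
    | nil => exact fun ρ => rfl
    | cons i l ih =>
      intro ρ
      rw [List.foldl_cons, List.foldl_cons, ih]
      congr 1
      exact partialTrace_applyOn e.injective (const_one_injective i) resetMap ρ
  rw [h, foldl_reset_finRange, trace_partialTrace e.injective]

/-! ### Measurement -/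

/-- Measurement of a register. -/
def measureCode (e : Fin t → Fin q) (m : Fin t → Fin s) : List (Instr q s) :=
  List.ofFn fun i => .measure (e i) (m i)

/-- The compression to the outcome `α` of a measurement of a register. -/
def projectAll {W : Type} (e : Fin t → W) (α : Fin t → Bool) (M : Op W) : Op W :=
  Matrix.of fun u v => if u ∘ e = α ∧ v ∘ e = α then M u v else 0

lemma pullCode_measureCode (e : Fin t → Fin q) (m : Fin t → Fin s) (hm : Injective m)
    (F : Functional q s) (μ : Fin s → Bool) (ρ : Op (Fin q)) :
    pullCode (measureCode e m) F μ ρ =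
      ∑ α : Fin t → Bool, F (extend m α μ) (projectAll e α ρ) := by
  induction t generalizing μ ρ with
  | zero =>
    have h1 : ∀ α : Fin 0 → Bool, extend m α μ = μ := by
      intro α
      funext i
      exact extend_apply' _ _ _ fun ⟨j, _⟩ => j.elim0
    have h2 : ∀ α : Fin 0 → Bool, projectAll e α ρ = ρ := by
      intro α
      ext u v
      rw [projectAll, Matrix.of_apply, if_pos ⟨Subsingleton.elim _ _, Subsingleton.elim _ _⟩]
    rw [Fintype.sum_unique, h1, h2]
    simp [measureCode, pullCode_nil]
  | succ t ih =>
    have hcode : measureCode e m = .measure (e 0) (m 0) ::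
        measureCode (fun i => e i.succ) (fun i => m i.succ) := by
      simp [measureCode, List.ofFn_succ]
    rw [hcode, pullCode_cons]
    simp only [Instr.pull, LinearMap.sum_apply, LinearMap.comp_apply]
    rw [← (Fin.consEquiv fun _ : Fin (t + 1) => Bool).sum_comp, Fintype.sum_prod_type]
    refine Finset.sum_congr rfl fun b _ => ?_
    rw [ih _ _ fun i j h => Fin.succ_injective _ (hm h)]
    refine Finset.sum_congr rfl fun α _ => ?_
    have h1 : extend (fun i : Fin t => m i.succ) α (update μ (m 0) b) =
        extend m (Fin.cons b α) μ := by
      funext x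
      by_cases hx : ∃ i, m i = x
      · obtain ⟨i, rfl⟩ := hx
        rw [hm.extend_apply]
        refine Fin.cases ?_ (fun i => ?_) i
        · rw [extend_apply' _ _ _ (by
            rintro ⟨j, hj⟩
            exact Fin.succ_ne_zero j (hm hj)), update_self, Fin.cons_zero]
        · rw [Fin.cons_succ]
          exact Injective.extend_apply (f := fun i : Fin t => m i.succ)
            (fun i j h => Fin.succ_injective _ (hm h)) _ _ i
      · rw [extend_apply' _ _ _ hx, extend_apply' _ _ _ (by
          rintro ⟨j, hj⟩
          exact hx ⟨j.succ, hj⟩), update_of_ne]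
        rintro rfl
        exact hx ⟨0, rfl⟩
    have h2 : projectAll (fun i : Fin t => e i.succ) α (projectLin (e 0) b ρ) =
        projectAll e (Fin.cons b α) ρ := by
      have hiff : ∀ u : Fin q → Bool, u ∘ e = (Fin.cons b α : Fin (t + 1) → Bool) ↔
          u (e 0) = b ∧ (u ∘ fun i : Fin t => e i.succ) = α := by
        intro u
        rw [funext_iff, Fin.forall_fin_succ, funext_iff]
        simp
      ext u v
      simp only [projectAll, Matrix.of_apply, hiff]
      change (if _ then (if _ then _ else _) else _) = _
      by_cases h1 : u (e 0) = b <;> by_cases h2 : v (e 0) = b <;> simp [h1, h2]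
    rw [h1, h2]
    rfl

lemma trace_projectAll (e : Fin t ↪ Fin q) (α : Fin t → Bool) (M : Op (Fin q)) :
    (projectAll e α M).trace = partialTrace e M α α := by
  rw [partialTrace_apply_self e.injective]
  refine Finset.sum_congr rfl fun u _ => ?_
  simp [projectAll]

/-! ### Classical processing -/

/-- No source is a destination and destinations are distinct, so sequential execution has the effect
of a simultaneous update. -/
lemma pullCode_logic_list {α : Type} (g : Bool → Bool → Bool) {dst src : α → Fin s}
    (hdst : Injective dst) (hsrc : ∀ x y, src x ≠ dst y) (l : List α) (hl : l.Nodup)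
    (μ : Fin s → Bool) : ∃ μ' : Fin s → Bool,
      (∀ F : Functional q s,
        pullCode (l.map fun x => .logic g (dst x) (src x) (dst x)) F μ = F μ') ∧
      (∀ x ∈ l, μ' (dst x) = g (μ (dst x)) (μ (src x))) ∧
      ∀ a, (∀ x ∈ l, dst x ≠ a) → μ' a = μ a := by
  induction l generalizing μ with
  | nil => exact ⟨μ, fun F => rfl, by simp, by simp⟩
  | cons x l ih =>
    obtain ⟨μ', h1, h2, h3⟩ := ih hl.of_cons (update μ (dst x) (g (μ (dst x)) (μ (src x))))
    have hx : x ∉ l := (List.nodup_cons.mp hl).1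
    refine ⟨μ', fun F => ?_, fun y hy => ?_, fun a ha => ?_⟩
    · exact h1 F
    · rcases List.mem_cons.mp hy with rfl | hy
      · rw [h3 _ fun z hz h => hx (by rwa [← hdst h]), update_self]
      · have hyx : y ≠ x := fun h => hx (h ▸ hy)
        rw [h2 y hy, update_of_ne fun h => hyx (hdst h), update_of_ne (hsrc _ _)]
    · rw [h3 a fun y hy => ha y (List.mem_cons_of_mem _ hy),
        update_of_ne (Ne.symm (ha x List.mem_cons_self))]

lemma pullCode_logic {α : Type} [Fintype α] (g : Bool → Bool → Bool) {dst src : α → Fin s}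
    (hdst : Injective dst) (hsrc : ∀ x y, src x ≠ dst y) (F : Functional q s) (μ : Fin s → Bool) :
    pullCode ((Finset.univ : Finset α).toList.map fun x => .logic g (dst x) (src x) (dst x)) F μ =
      F (extend dst (fun x => g (μ (dst x)) (μ (src x))) μ) := by
  obtain ⟨μ', h1, h2, h3⟩ := pullCode_logic_list (q := q) g hdst hsrc
    (Finset.univ : Finset α).toList (Finset.nodup_toList _) μ
  rw [h1]
  congr 1
  funext a
  by_cases ha : ∃ x, dst x = a
  · obtain ⟨x, rfl⟩ := ha
    rw [hdst.extend_apply, h2 x (by simp)]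
  · rw [extend_apply' _ _ _ ha, h3 a fun x _ h => ha ⟨x, h⟩]

lemma testBit_bijective (b : ℕ) :
    Bijective fun (v : Fin (2 ^ b)) (t : Fin b) => v.1.testBit t := by
  refine (Fintype.bijective_iff_injective_and_card _).mpr ⟨fun v w h => Fin.ext ?_, by simp⟩
  refine Nat.eq_of_testBit_eq fun i => ?_
  by_cases hi : i < b
  · exact congrFun h ⟨i, hi⟩
  · have hle : 2 ^ b ≤ 2 ^ i := Nat.pow_le_pow_right (by norm_num) (by omega)
    rw [Nat.testBit_lt_two_pow (v.2.trans_le hle), Nat.testBit_lt_two_pow (w.2.trans_le hle)]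

lemma sum_testBit {R : Type} [AddCommMonoid R] (b : ℕ) (G : (Fin b → Bool) → R) :
    ∑ v : Fin (2 ^ b), G (fun t => v.1.testBit t) = ∑ f : Fin b → Bool, G f :=
  (testBit_bijective b).sum_comp G

end Registers

/-! ### The program -/

/-- Names of the bits of the classical memory. -/
inductive Addr (K : Type) [Fintype K] (tA tB : ℕ) : Type
  | zero
  | sign
  | digit (i : Fin (Fintype.card K + 2))
  | edge (ij : K × K)
  | left (i : Fin tA)
  | right (j : Fin tB)

section Program

variable {K : Type} [Fintype K] {q n tA tB : ℕ}

instance : Finite (Addr K tA tB) := by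
  refine Finite.of_surjective
    (α := (Bool ⊕ Fin (Fintype.card K + 2)) ⊕ ((K × K) ⊕ (Fin tA ⊕ Fin tB)))
    (Sum.elim (Sum.elim (fun b => if b then .sign else .zero) .digit)
      (Sum.elim .edge (Sum.elim .left .right))) ?_
  rintro (_ | _ | i | ij | i | j)
  · exact ⟨Sum.inl (Sum.inl false), rfl⟩
  · exact ⟨Sum.inl (Sum.inl true), rfl⟩
  · exact ⟨Sum.inl (Sum.inr i), rfl⟩
  · exact ⟨Sum.inr (Sum.inl ij), rfl⟩
  · exact ⟨Sum.inr (Sum.inr (Sum.inl i)), rfl⟩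
  · exact ⟨Sum.inr (Sum.inr (Sum.inr j)), rfl⟩

/-- The number of bits of the classical memory. -/
abbrev memorySize (K : Type) [Fintype K] (tA tB : ℕ) : ℕ := Nat.card (Addr K tA tB)

/-- The position of a bit in the memory. -/
def addr : Addr K tA tB ≃ Fin (memorySize K tA tB) := Finite.equivFin _

/-- The bit that decides whether a graph-state basis is used. -/
def graphBit : Addr K tA tB := .digit (Fin.natAdd (Fintype.card K) 0)

/-- The most significant digit of the random number. -/
def lastBit : Addr K tA tB := .digit (Fin.natAdd (Fintype.card K) 1)

/-- The digit of the random number that belongs to a cut wire. -/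
def wireBit (k : K) : Addr K tA tB := .digit (Fin.castAdd 2 (Fintype.equivFin K k))

lemma left_injective : Injective (Addr.left : Fin tA → Addr K tA tB) := fun i j h => by simpa using h

lemma edge_injective : Injective (Addr.edge : K × K → Addr K tA tB) := fun i j h => by simpa using h

lemma digit_injective : Injective (Addr.digit : _ → Addr K tA tB) := fun i j h => by simpa using h

instance : DecidableEq (Addr K tA tB) := Classical.decEq _

/-- The positions of the digits of the random number. -/
def digitEmbedding (K : Type) [Fintype K] (tA tB : ℕ) :
    Fin (Fintype.card K + 2) ↪ Fin (memorySize K tA tB) :=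
  ⟨fun i => addr (.digit i), addr.injective.comp digit_injective⟩

lemma coe_digitEmbedding : ⇑(digitEmbedding K tA tB) = fun i => addr (.digit i) := rfl

/-- The positions of the edges of the random graph. -/
def edgeEmbedding (K : Type) [Fintype K] (tA tB : ℕ) :
    Fin (Fintype.card (K × K)) ↪ Fin (memorySize K tA tB) :=
  ⟨fun i => addr (.edge ((Fintype.equivFin (K × K)).symm i)),
    addr.injective.comp (edge_injective.comp (Fintype.equivFin (K × K)).symm.injective)⟩

lemma coe_edgeEmbedding : ⇑(edgeEmbedding K tA tB) =
    fun i => addr (.edge ((Fintype.equivFin (K × K)).symm i)) := rfl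

lemma wireBit_injective : Injective (wireBit : K → Addr K tA tB) := by
  intro k k' h
  simp only [wireBit, Addr.digit.injEq] at h
  exact (Fintype.equivFin K).injective (Fin.castAdd_injective _ _ h)

lemma wireBit_ne_graphBit (k : K) : (wireBit k : Addr K tA tB) ≠ graphBit := by
  intro h
  simp only [wireBit, graphBit, Addr.digit.injEq] at h
  have := congrArg Fin.val h
  simp only [Fin.val_castAdd, Fin.val_natAdd] at this
  have := (Fintype.equivFin K k).2
  omega

variable [DecidableEq K]

/-- The part of the program that samples the sign and the basis. -/
def sampleCode : List (Instr q (memorySize K tA tB)) :=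
  [.logic (fun _ _ => false) (addr .zero) (addr .zero) (addr .zero)] ++
  -- One integer v in {0, …, 2d} selects the branch: v < d means z = 1, d ≤ v < 2d a graph-state
  -- basis, v = 2d the computational basis with z = 0. Digit κ marks the second range and digit κ +
  -- 1 the third.
  ([.uniform (2 * 2 ^ Fintype.card K + 1) (Fintype.card K + 2) (Nat.succ_pos _) (by
      have := Nat.one_le_two_pow (n := Fintype.card K)
      rw [pow_add]; omega) (digitEmbedding K tA tB)] ++
  ([.logic (fun a b => !(a || b)) (addr graphBit) (addr lastBit) (addr .sign)] ++
  -- For z = 1 the low digits are a uniform string; for z = 0 they are cleared.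
  (((Finset.univ : Finset K).toList.map fun k =>
    .logic and (addr (wireBit k)) (addr .sign) (addr (wireBit k))) ++
  ([.uniform (2 ^ Fintype.card (K × K)) (Fintype.card (K × K)) (by positivity) le_rfl
      (edgeEmbedding K tA tB)] ++
  -- Outside the graph branch all edges are erased, so the same gates then implement the identity
  -- basis change.
  ((Finset.univ : Finset (K × K)).toList.map fun ij =>
    .logic and (addr (.edge ij)) (addr graphBit) (addr (.edge ij)))))))

/-- The part of the program that runs the first circuit and measures its wires. -/
def leftCode (tB : ℕ) (CA : Circuit (Fin tA)) (lA : K ↪ Fin tA) (jA : Fin tA ↪ Fin q) :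
    List (Instr q (memorySize K tA tB)) :=
  (resetCode _ jA ++ (circuitCode _ (CA.mapWires jA) ++
    (graphCodeInv (fun ij => addr (.edge ij)) (lA.trans jA) ++
      hadamardCode (addr graphBit) (lA.trans jA)))) ++
  (measureCode jA (fun i => addr (.left i)) ++
  -- The outcome is added to the stored string. From a cleared string this gives the outcome itself;
  -- from a uniform one it gives a uniform string again, as required for z = 1.
  ((Finset.univ : Finset K).toList.map fun k =>
    .logic xor (addr (wireBit k)) (addr (.left (lA k))) (addr (wireBit k))))

/-- The part of the program that prepares the cut wires, runs the second circuit and measures. -/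
def rightCode (tA : ℕ) (CB : Circuit (Fin tB)) (lB : K ↪ Fin tB) (jB : Fin tB ↪ Fin q) :
    List (Instr q (memorySize K tA tB)) :=
  (resetCode _ jB ++ (flipCode (fun k => addr (wireBit k)) (lB.trans jB) ++
    ((hadamardCode (addr graphBit) (lB.trans jB) ++
      graphCode (fun ij => addr (.edge ij)) (lB.trans jB)) ++ circuitCode _ (CB.mapWires jB)))) ++
  measureCode jB fun j => addr (.right j)

/-- A program for the cutting procedure. -/
def cuttingProgram (CA : Circuit (Fin tA)) (CB : Circuit (Fin tB)) (lA : K ↪ Fin tA)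
    (lB : K ↪ Fin tB) (jA : Fin tA ↪ Fin q) (jB : Fin tB ↪ Fin q) (out : Fin n → Addr K tA tB) :
    Program q n where
  bits := memorySize K tA tB
  code := sampleCode ++ (leftCode tB CA lA jA ++ rightCode tA CB lB jB)
  outZ := addr .sign
  outX w := addr (out w)

/-- The weight of outcome `α` of the measurement of the first register. -/
def leftWeight (CA : Circuit (Fin tA)) (lA : K ↪ Fin tA) (V : Op K) (α : Fin tA → Bool) : ℂ :=
  applyOn (conj V.conjTranspose) lA (CA.run (basisState fun _ => false)) α α

/-- The weight of outcome `β` of the measurement of the second register. -/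
def rightWeight (CB : Circuit (Fin tB)) (lB : K ↪ Fin tB) (V : Op K) (y : K → Bool)
    (β : Fin tB → Bool) : ℂ :=
  CB.run (embed lB (conj V (basisState y))) β β

/-- The functional that multiplies the trace by a function of the memory. -/
def traceTimes {s : ℕ} (G : (Fin s → Bool) → ℂ) : Functional q s :=
  fun μ => G μ • Matrix.traceLinearMap _ ℂ ℂ

lemma traceTimes_apply {s : ℕ} (G : (Fin s → Bool) → ℂ) (μ : Fin s → Bool) (ρ : Op (Fin q)) :
    traceTimes G μ ρ = G μ * ρ.trace := rfl

/-- The basis described by the memory. -/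
def memoryBasis (m : Addr K tA tB → Bool) : Op K :=
  basisUnitary (m graphBit) fun ij => m (.edge ij)

/-- After the initial reset the qubits enter only through the total trace, so the pulled-back
functional is a function of the memory times the trace. Phases of the program can then be composed
classically. -/
lemma pullCode_rightCode (CB : Circuit (Fin tB)) (lB : K ↪ Fin tB) (jB : Fin tB ↪ Fin q)
    (out : Fin n → Addr K tA tB) (o : Bool × (Fin n → Bool)) :
    pullCode (rightCode tA CB lB jB)
        (Program.outputFunctional (addr .sign) (fun w => addr (out w)) o) =
      traceTimes fun μ => ∑ β : Fin tB → Bool,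
        if (μ (addr .sign), fun w => extend Addr.right β (μ ∘ addr) (out w)) = o then
          rightWeight CB lB (memoryBasis (μ ∘ addr)) (fun k => μ (addr (wireBit k))) β else 0 := by
  funext μ
  refine LinearMap.ext fun ρ => ?_
  obtain ⟨Φ, hΦ, hΦt⟩ := implements_resetCode (s := memorySize K tA tB) jB
  have himp := (hΦ μ).append ((implements_flipCode (lB.trans jB).injective
    (fun k => addr (wireBit k))).append ((implements_basis (addr graphBit) (fun ij => addr (.edge ij))
      (lB.trans jB)).append (implements_circuitCode (CB.mapWires jB))))
  have hinj : Injective fun j : Fin tB => (addr (.right j) : Fin (memorySize K tA tB)) :=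
    fun i j h => by simpa using h
  rw [rightCode, pullCode_append, himp, pullCode_measureCode _ _ hinj, traceTimes_apply,
    Finset.sum_mul]
  refine Finset.sum_congr rfl fun β _ => ?_
  have hread : ∀ a : Addr K tA tB, extend (fun j : Fin tB => addr (.right j)) β μ (addr a) =
      extend Addr.right β (μ ∘ addr) a := by
    intro a
    have hr : Injective (Addr.right : Fin tB → Addr K tA tB) := fun i j h => by simpa using h
    by_cases h : ∃ j, Addr.right j = a
    · obtain ⟨j, rfl⟩ := h
      rw [hr.extend_apply]
      exact hinj.extend_apply β μ j
    · rw [extend_apply' _ _ _ h, extend_apply']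
      · rfl
      · rintro ⟨j, hj⟩
        exact h ⟨j, addr.injective hj⟩
  have hsign : extend (Addr.right : Fin tB → Addr K tA tB) β (μ ∘ addr) .sign = μ (addr .sign) :=
    extend_apply' _ _ _ (by rintro ⟨j, hj⟩; cases hj)
  have htrace : (projectAll jB β ((CB.mapWires jB).run (applyOn (conj (basisUnitary (μ (addr graphBit))
      fun ij => μ (addr (.edge ij)))) (lB.trans jB)
      (applyOn (conj (tensor fun w => flipMatrix (μ (addr (wireBit w))))) (lB.trans jB) (Φ ρ))))).trace =
      rightWeight CB lB (memoryBasis (μ ∘ addr)) (fun k => μ (addr (wireBit k))) β * ρ.trace := by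
    rw [trace_projectAll, Circuit.partialTrace_run]
    have h1 : partialTrace jB (applyOn (conj (basisUnitary (μ (addr graphBit))
        fun ij => μ (addr (.edge ij)))) (lB.trans jB)
        (applyOn (conj (tensor fun w => flipMatrix (μ (addr (wireBit w))))) (lB.trans jB) (Φ ρ))) =
        ρ.trace • embed lB (conj (memoryBasis (μ ∘ addr)) (basisState fun k => μ (addr (wireBit k)))) := by
      rw [Embedding.coe_trans, partialTrace_applyOn jB.injective lB.injective,
        partialTrace_applyOn jB.injective lB.injective, hΦt, applyOn_applyOn lB.injective,
        ← applyOnLin_apply, map_smul, applyOnLin_apply]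
      have := applyOn_basisState lB.injective (conj (basisUnitary (μ (addr graphBit))
        fun ij => μ (addr (.edge ij))) ∘ₗ conj (tensor fun w => flipMatrix (μ (addr (wireBit w)))))
        fun _ => false
      rw [extend_const_false] at this
      rw [this, LinearMap.comp_apply, conj_flip_basisState]
      rfl
    rw [h1, ← Circuit.runLin_apply, map_smul, Matrix.smul_apply, smul_eq_mul, mul_comm]
    rfl
  have hcond : (extend (fun j : Fin tB => addr (.right j)) β μ (addr .sign),
      extend (fun j : Fin tB => addr (.right j)) β μ ∘ fun w => addr (out w)) =
      (μ (addr .sign), fun w => extend Addr.right β (μ ∘ addr) (out w)) :=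
    Prod.ext ((hread _).trans hsign) (funext fun w => hread (out w))
  rw [Program.outputFunctional, hcond]
  by_cases ho : (μ (addr .sign), fun w => extend Addr.right β (μ ∘ addr) (out w)) = o
  · rw [if_pos ho, if_pos ho]
    exact htrace
  · rw [if_neg ho, if_neg ho]
    simp

/-- The memory after the first circuit, with outcome `α`. -/
def leftMemory (lA : K ↪ Fin tA) (m : Addr K tA tB → Bool) (α : Fin tA → Bool) :
    Addr K tA tB → Bool :=
  extend wireBit (fun k => xor (m (wireBit k)) (α (lA k))) (extend Addr.left α m)

lemma extend_addr {α : Type} {j : α → Addr K tA tB} (hj : Injective j) (f : α → Bool)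
    (μ : Fin (memorySize K tA tB) → Bool) :
    extend (fun x => addr (j x)) f μ ∘ addr = extend j f (μ ∘ addr) := by
  funext a
  have hinj : Injective fun x => addr (j x) := addr.injective.comp hj
  by_cases h : ∃ x, j x = a
  · obtain ⟨x, rfl⟩ := h
    rw [hj.extend_apply]
    exact hinj.extend_apply f μ x
  · rw [extend_apply' _ _ _ h, comp_apply, extend_apply']
    · rfl
    · rintro ⟨x, hx⟩
      exact h ⟨x, addr.injective hx⟩

lemma pullCode_leftCode (CA : Circuit (Fin tA)) (lA : K ↪ Fin tA) (jA : Fin tA ↪ Fin q)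
    (G : (Addr K tA tB → Bool) → ℂ) :
    pullCode (leftCode tB CA lA jA) (traceTimes fun μ => G (μ ∘ addr)) =
      traceTimes fun μ => ∑ α : Fin tA → Bool,
        leftWeight CA lA (memoryBasis (μ ∘ addr)) α * G (leftMemory lA (μ ∘ addr) α) := by
  funext μ
  refine LinearMap.ext fun ρ => ?_
  obtain ⟨Φ, hΦ, hΦt⟩ := implements_resetCode (s := memorySize K tA tB) jA
  have himp := (hΦ μ).append ((implements_circuitCode (CA.mapWires jA)).append
    (implements_basisInv (addr graphBit) (fun ij => addr (.edge ij)) (lA.trans jA)))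
  have hinj : Injective fun i : Fin tA => (addr (.left i) : Fin (memorySize K tA tB)) :=
    addr.injective.comp left_injective
  rw [leftCode, pullCode_append, himp, pullCode_append, pullCode_measureCode _ _ hinj,
    traceTimes_apply, Finset.sum_mul]
  refine Finset.sum_congr rfl fun α _ => ?_
  rw [pullCode_logic xor (dst := fun k : K => addr (wireBit k)) (src := fun k => addr (.left (lA k)))
    (addr.injective.comp wireBit_injective) (by
      intro k k' h
      have := addr.injective h
      cases this), traceTimes_apply]
  have hmem : extend (fun k : K => addr (wireBit k)) (fun k =>
      xor (extend (fun i => addr (.left i)) α μ (addr (wireBit k)))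
        (extend (fun i => addr (.left i)) α μ (addr (.left (lA k)))))
      (extend (fun i => addr (.left i)) α μ) ∘ addr = leftMemory lA (μ ∘ addr) α := by
    rw [extend_addr wireBit_injective, extend_addr left_injective, leftMemory]
    congr 1
    funext k
    congr 1
    · refine extend_apply' _ _ _ ?_
      rintro ⟨i, hi⟩
      have := addr.injective hi
      cases this
    · exact hinj.extend_apply α μ (lA k)
  rw [hmem, trace_projectAll]
  have htrace : partialTrace jA (applyOn (conj (basisUnitary (μ (addr graphBit))
      fun ij => μ (addr (.edge ij))).conjTranspose) (lA.trans jA) ((CA.mapWires jA).run (Φ ρ))) =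
      ρ.trace • applyOn (conj (memoryBasis (μ ∘ addr)).conjTranspose) lA
        (CA.run (basisState fun _ => false)) := by
    rw [Embedding.coe_trans, partialTrace_applyOn jA.injective lA.injective,
      Circuit.partialTrace_run, hΦt, ← Circuit.runLin_apply, map_smul, ← applyOnLin_apply, map_smul]
    rfl
  rw [htrace, Matrix.smul_apply, smul_eq_mul, leftWeight]
  ring

/-- The memory after the sampling, with random number `v` and random graph `g`. -/
def sampleMemory (m : Addr K tA tB → Bool) (v : ℕ) (g : K × K → Bool) : Addr K tA tB → Bool :=
  let d : Addr K tA tB → Bool := extend Addr.digit (fun i => v.testBit i) (update m .zero false)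
  let z := !(d graphBit || d lastBit)
  extend Addr.edge (fun ij => g ij && d graphBit)
    (extend wireBit (fun k => d (wireBit k) && z) (update d .sign z))

lemma update_comp_addr (μ : Fin (memorySize K tA tB) → Bool) (a : Addr K tA tB) (b : Bool) :
    update μ (addr a) b ∘ addr = update (μ ∘ addr) a b := by
  funext x
  by_cases h : x = a
  · subst h; simp
  · simp [h]

lemma pullCode_sampleCode (G : (Addr K tA tB → Bool) → ℂ) :
    pullCode (q := q) sampleCode (traceTimes fun μ => G (μ ∘ addr)) =
      traceTimes fun μ => 1 / (2 * 2 ^ Fintype.card K + 1) *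
        ∑ v : Fin (2 * 2 ^ Fintype.card K + 1), 1 / 2 ^ Fintype.card (K × K) *
          ∑ g : K × K → Bool, G (sampleMemory (μ ∘ addr) v g) := by
  funext μ
  refine LinearMap.ext fun ρ => ?_
  have hedge : Injective fun i : Fin (Fintype.card (K × K)) =>
      (Addr.edge ((Fintype.equivFin (K × K)).symm i) : Addr K tA tB) :=
    edge_injective.comp (Fintype.equivFin (K × K)).symm.injective
  simp only [sampleCode, pullCode_append]
  simp only [pullCode_cons, pullCode_nil, Instr.pull]
  simp only [LinearMap.smul_apply, LinearMap.sum_apply]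
  rw [traceTimes_apply, smul_eq_mul, mul_assoc, Finset.sum_mul]
  congr 1
  · push_cast; rfl
  refine Finset.sum_congr rfl fun v _ => ?_
  rw [pullCode_logic and (dst := fun k : K => addr (wireBit k)) (src := fun k => addr .sign)
    (addr.injective.comp wireBit_injective) (by
      intro k k' h
      have := addr.injective h
      cases this)]
  rw [LinearMap.smul_apply, LinearMap.sum_apply, smul_eq_mul, mul_assoc, Finset.sum_mul]
  congr 1
  · push_cast; rfl
  -- A uniform integer below a power of two has independent uniform digits, so it is the same as a
  -- uniform graph.
  rw [← (Equiv.arrowCongr (Fintype.equivFin (K × K)).symm (Equiv.refl Bool)).sum_comp,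
    ← sum_testBit]
  refine Finset.sum_congr rfl fun w _ => ?_
  rw [pullCode_logic and (dst := fun ij : K × K => addr (.edge ij)) (src := fun ij => addr graphBit)
    (addr.injective.comp edge_injective) (by
      intro k k' h
      have := addr.injective h
      cases this), traceTimes_apply]
  congr 2
  rw [coe_edgeEmbedding, coe_digitEmbedding, extend_addr edge_injective]
  set μ₂ := extend (fun i : Fin (Fintype.card K + 2) => addr (.digit i)) (fun i => v.1.testBit i)
    (update μ (addr (.zero : Addr K tA tB)) false) with hμ₂
  have h₂ : ∀ a : Addr K tA tB, μ₂ (addr a) =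
      extend Addr.digit (fun i => v.1.testBit i) (update (μ ∘ addr) .zero false) a := by
    intro a
    rw [← update_comp_addr, ← extend_addr digit_injective]
    rfl
  set μ₄ := extend (fun k : K => addr (wireBit k)) (fun k => and (update μ₂ (addr (.sign : Addr K tA tB))
    (!(μ₂ (addr graphBit) || μ₂ (addr lastBit))) (addr (wireBit k))) (update μ₂ (addr .sign)
    (!(μ₂ (addr graphBit) || μ₂ (addr lastBit))) (addr .sign))) (update μ₂ (addr .sign)
    (!(μ₂ (addr graphBit) || μ₂ (addr lastBit)))) with hμ₄
  have h₄ : μ₄ ∘ addr = extend wireBit (fun k => μ₂ (addr (wireBit k)) &&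
      !(μ₂ (addr graphBit) || μ₂ (addr lastBit)))
      (update (μ₂ ∘ addr) .sign (!(μ₂ (addr graphBit) || μ₂ (addr lastBit)))) := by
    rw [hμ₄, extend_addr wireBit_injective, update_comp_addr]
    congr 1
    funext k
    rw [update_self, update_of_ne]
    intro h
    have := addr.injective h
    cases this
  rw [extend_addr hedge]
  funext a
  by_cases ha : ∃ ij, Addr.edge ij = a
  · obtain ⟨ij, rfl⟩ := ha
    rw [sampleMemory, edge_injective.extend_apply, edge_injective.extend_apply, ← h₂]
    congr 1
    · have := Injective.extend_apply (addr.injective.comp hedge)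
        (fun t : Fin (Fintype.card (K × K)) => w.1.testBit t) μ₄ (Fintype.equivFin (K × K) ij)
      simp only [comp_apply, Equiv.symm_apply_apply] at this
      refine Eq.trans this ?_
      simp [Equiv.arrowCongr]
    · have h1 := congrFun h₄ graphBit
      rw [comp_apply, extend_apply' _ _ _ (by
        rintro ⟨k, hk⟩
        exact wireBit_ne_graphBit k hk), update_of_ne (by intro h; cases h), comp_apply] at h1
      rw [← h1]
      refine extend_apply' _ _ _ ?_
      rintro ⟨i, hi⟩
      have := addr.injective hi
      cases this
  · rw [sampleMemory, extend_apply' _ _ _ ha, extend_apply' _ _ _ ha, extend_apply' _ _ _ (by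
      rintro ⟨i, rfl⟩
      exact ha ⟨_, rfl⟩), h₄]
    have hd : μ₂ ∘ addr = extend Addr.digit (fun i => v.1.testBit i) (update (μ ∘ addr) .zero false) :=
      funext h₂
    simp only [hd, h₂]

/-- The weight of output `o` with a given sign, basis and shift of the prepared state. -/
def branchWeight (CA : Circuit (Fin tA)) (CB : Circuit (Fin tB)) (lA : K ↪ Fin tA) (lB : K ↪ Fin tB)
    (out : Fin n → Addr K tA tB) (o : Bool × (Fin n → Bool)) (z : Bool) (V : Op K) (r : K → Bool) : ℂ :=
  ∑ α : Fin tA → Bool, leftWeight CA lA V α * ∑ β : Fin tB → Bool,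
    if (z, fun w => extend Addr.right β (extend Addr.left α fun _ => false) (out w)) = o then
      rightWeight CB lB V (fun k => xor (r k) (α (lA k))) β else 0

section Reads

variable (m : Addr K tA tB → Bool) (v : ℕ) (g : K × K → Bool)

lemma sampleMemory_digits (i : Fin (Fintype.card K + 2)) :
    extend Addr.digit (fun i : Fin (Fintype.card K + 2) => v.testBit i) (update m .zero false)
      (.digit i : Addr K tA tB) = v.testBit i := digit_injective.extend_apply _ _ _

lemma sampleMemory_sign : sampleMemory m v g .sign =
    !(v.testBit (Fintype.card K) || v.testBit (Fintype.card K + 1)) := by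
  rw [sampleMemory, extend_apply' _ _ _ (by rintro ⟨i, hi⟩; cases hi),
    extend_apply' _ _ _ (by rintro ⟨i, hi⟩; cases hi), update_self, graphBit, lastBit,
    sampleMemory_digits, sampleMemory_digits]
  rfl

lemma sampleMemory_graphBit : sampleMemory m v g graphBit = v.testBit (Fintype.card K) := by
  rw [sampleMemory, extend_apply' _ _ _ (by rintro ⟨i, hi⟩; cases hi),
    extend_apply' _ _ _ (by rintro ⟨i, hi⟩; exact wireBit_ne_graphBit i hi),
    update_of_ne (by intro h; cases h), graphBit, sampleMemory_digits]
  rfl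

lemma sampleMemory_wireBit (k : K) : sampleMemory m v g (wireBit k) =
    (v.testBit (Fintype.equivFin K k) &&
      !(v.testBit (Fintype.card K) || v.testBit (Fintype.card K + 1))) := by
  rw [sampleMemory, extend_apply' _ _ _ (by rintro ⟨i, hi⟩; cases hi),
    wireBit_injective.extend_apply]
  simp only [graphBit, lastBit, wireBit, sampleMemory_digits]
  rfl

lemma sampleMemory_edge (ij : K × K) : sampleMemory m v g (.edge ij) =
    (g ij && v.testBit (Fintype.card K)) := by
  rw [sampleMemory, edge_injective.extend_apply, graphBit, sampleMemory_digits]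
  rfl

lemma sampleMemory_zero : sampleMemory m v g .zero = false := by
  rw [sampleMemory, extend_apply' _ _ _ (by rintro ⟨i, hi⟩; cases hi),
    extend_apply' _ _ _ (by rintro ⟨i, hi⟩; cases hi), update_of_ne (by intro h; cases h),
    extend_apply' _ _ _ (by rintro ⟨i, hi⟩; cases hi), update_self]

lemma leftMemory_of_not_digit (lA : K ↪ Fin tA) (α : Fin tA → Bool) (a : Addr K tA tB)
    (h1 : ∀ k, wireBit k ≠ a) (h2 : ∀ i, .left i ≠ a) : leftMemory lA m α a = m a := by
  rw [leftMemory, extend_apply' _ _ _ (by rintro ⟨i, hi⟩; exact h1 i hi),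
    extend_apply' _ _ _ (by rintro ⟨i, hi⟩; exact h2 i hi)]

end Reads

/-- The three ranges of the branching integer. -/
lemma sum_range_split {R : Type} [AddCommMonoid R] (N : ℕ) (f : ℕ → R) :
    ∑ v : Fin (2 * 2 ^ N + 1), f v = (∑ v : Fin (2 ^ N), f v) + (∑ v : Fin (2 ^ N), f (2 ^ N + v)) +
      f (2 ^ (N + 1)) := by
  rw [Fin.sum_univ_eq_sum_range f, Finset.sum_range_succ, two_mul, Finset.sum_range_add,
    Fin.sum_univ_eq_sum_range f, Fin.sum_univ_eq_sum_range (fun v => f (2 ^ N + v)), pow_succ, mul_two]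

/-- The output probabilities of the program. -/
lemma cuttingProgram_outputProb (CA : Circuit (Fin tA)) (CB : Circuit (Fin tB)) (lA : K ↪ Fin tA)
    (lB : K ↪ Fin tB) (jA : Fin tA ↪ Fin q) (jB : Fin tB ↪ Fin q) (out : Fin n → Addr K tA tB)
    (hout : ∀ w, out w = .zero ∨ (∃ i, out w = .left i) ∨ ∃ j, out w = .right j)
    (μ₀ : Fin (memorySize K tA tB) → Bool) (ρ : Op (Fin q)) (o : Bool × (Fin n → Bool)) :
    (cuttingProgram CA CB lA lB jA jB out).outputProb μ₀ ρ o =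
      1 / (2 * 2 ^ Fintype.card K + 1) *
        ((∑ r : K → Bool, branchWeight CA CB lA lB out o true 1 r) +
          2 ^ Fintype.card K / 2 ^ Fintype.card (K × K) * (∑ g : K × K → Bool,
            branchWeight CA CB lA lB out o false (graphUnitary g) fun _ => false) +
          branchWeight CA CB lA lB out o false 1 fun _ => false) * ρ.trace := by
  have hcode : pullCode (sampleCode ++ (leftCode tB CA lA jA ++ rightCode tA CB lB jB))
      (Program.outputFunctional (addr .sign) (fun w => addr (out w)) o) μ₀ ρ =
      pullCode sampleCode (pullCode (leftCode tB CA lA jA) (pullCode (rightCode tA CB lB jB)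
        (Program.outputFunctional (addr .sign) (fun w => addr (out w)) o))) μ₀ ρ := by
    rw [pullCode_append, pullCode_append]
  refine ((cuttingProgram CA CB lA lB jA jB out).outputProb_eq_pullCode μ₀ ρ o).trans
    (hcode.trans ?_)
  rw [pullCode_rightCode]
  have h1 := pullCode_leftCode CA lA jA fun m : Addr K tA tB → Bool => ∑ β : Fin tB → Bool,
    if (m .sign, fun w => extend Addr.right β m (out w)) = o then
      rightWeight CB lB (memoryBasis m) (fun k => m (wireBit k)) β else 0
  simp only [comp_apply] at h1
  refine (congrArg (fun F => pullCode sampleCode F μ₀ ρ) h1).trans ?_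
  have h2 := pullCode_sampleCode (q := q) fun m : Addr K tA tB → Bool => ∑ α : Fin tA → Bool,
    leftWeight CA lA (memoryBasis m) α * ∑ β : Fin tB → Bool,
      if (leftMemory lA m α .sign, fun w => extend Addr.right β (leftMemory lA m α) (out w)) = o then
        rightWeight CB lB (memoryBasis (leftMemory lA m α))
          (fun k => leftMemory lA m α (wireBit k)) β else 0
  refine (congrArg (fun F : Functional q _ => F μ₀ ρ) h2).trans ?_
  rw [traceTimes_apply]
  congr 2
  -- The initial memory disappears: every bit that is read has been written by the program, the
  -- constant zero bit included.
  have key : ∀ (v : ℕ) (g : K × K → Bool), (∑ α : Fin tA → Bool,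
      leftWeight CA lA (memoryBasis (sampleMemory (μ₀ ∘ addr) v g)) α * ∑ β : Fin tB → Bool,
      if (leftMemory lA (sampleMemory (μ₀ ∘ addr) v g) α .sign,
          fun w => extend Addr.right β (leftMemory lA (sampleMemory (μ₀ ∘ addr) v g) α) (out w)) = o then
        rightWeight CB lB (memoryBasis (leftMemory lA (sampleMemory (μ₀ ∘ addr) v g) α))
          (fun k => leftMemory lA (sampleMemory (μ₀ ∘ addr) v g) α (wireBit k)) β else 0) =
      branchWeight CA CB lA lB out o
        (!(v.testBit (Fintype.card K) || v.testBit (Fintype.card K + 1)))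
        (basisUnitary (v.testBit (Fintype.card K)) fun ij => g ij && v.testBit (Fintype.card K))
        (fun k => v.testBit (Fintype.equivFin K k) &&
          !(v.testBit (Fintype.card K) || v.testBit (Fintype.card K + 1))) := by
    intro v g
    have hb : memoryBasis (sampleMemory (μ₀ ∘ addr) v g) = basisUnitary (v.testBit (Fintype.card K))
        fun ij => g ij && v.testBit (Fintype.card K) := by
      simp only [memoryBasis, sampleMemory_graphBit, sampleMemory_edge]
    refine Finset.sum_congr rfl fun α _ => ?_
    rw [hb]
    congr 1
    refine Finset.sum_congr rfl fun β _ => ?_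
    have hb' : memoryBasis (leftMemory lA (sampleMemory (μ₀ ∘ addr) v g) α) =
        memoryBasis (sampleMemory (μ₀ ∘ addr) v g) := by
      simp only [memoryBasis]
      rw [leftMemory_of_not_digit _ _ _ _ wireBit_ne_graphBit (by intro i h; cases h)]
      congr 1
      funext ij
      exact leftMemory_of_not_digit _ _ _ _ (by intro i h; cases h) (by intro i h; cases h)
    have hs : leftMemory lA (sampleMemory (μ₀ ∘ addr) v g) α .sign =
        !(v.testBit (Fintype.card K) || v.testBit (Fintype.card K + 1)) := by
      rw [leftMemory_of_not_digit _ _ _ _ (by intro i h; cases h) (by intro i h; cases h),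
        sampleMemory_sign]
    have hw : ∀ k, leftMemory lA (sampleMemory (μ₀ ∘ addr) v g) α (wireBit k) =
        xor (v.testBit (Fintype.equivFin K k) &&
          !(v.testBit (Fintype.card K) || v.testBit (Fintype.card K + 1))) (α (lA k)) := by
      intro k
      rw [leftMemory, wireBit_injective.extend_apply, sampleMemory_wireBit]
    have hr : Injective (Addr.right : Fin tB → Addr K tA tB) := fun i j h => by simpa using h
    have ho : ∀ w, extend Addr.right β (leftMemory lA (sampleMemory (μ₀ ∘ addr) v g) α) (out w) =
        extend Addr.right β (extend Addr.left α fun _ => false) (out w) := by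
      intro w
      rcases hout w with h | ⟨i, h⟩ | ⟨j, h⟩ <;> rw [h]
      · rw [extend_apply' _ _ _ (by rintro ⟨i, hi⟩; cases hi),
          extend_apply' _ _ _ (by rintro ⟨i, hi⟩; cases hi),
          extend_apply' _ _ _ (by rintro ⟨i, hi⟩; cases hi),
          leftMemory_of_not_digit _ _ _ _ (by intro i h; cases h) (by intro i h; cases h),
          sampleMemory_zero]
      · rw [extend_apply' _ _ _ (by rintro ⟨i, hi⟩; cases hi),
          extend_apply' _ _ _ (by rintro ⟨i, hi⟩; cases hi), left_injective.extend_apply, leftMemory,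
          extend_apply' _ _ _ (by rintro ⟨i, hi⟩; cases hi), left_injective.extend_apply]
      · rw [hr.extend_apply, hr.extend_apply]
    rw [hb', hb, hs]
    simp only [ho, hw]
  simp only [key]
  rw [sum_range_split (Fintype.card K) fun v => (1 / 2 ^ Fintype.card (K × K) : ℂ) *
    ∑ g : K × K → Bool, branchWeight CA CB lA lB out o
        (!(v.testBit (Fintype.card K) || v.testBit (Fintype.card K + 1)))
        (basisUnitary (v.testBit (Fintype.card K)) fun ij => g ij && v.testBit (Fintype.card K))
        (fun k => v.testBit (Fintype.equivFin K k) &&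
          !(v.testBit (Fintype.card K) || v.testBit (Fintype.card K + 1)))]
  have hpow : (2 : ℂ) ^ Fintype.card (K × K) ≠ 0 := pow_ne_zero _ two_ne_zero
  -- Where the edges are erased the summand does not depend on the graph, and averaging over it is
  -- trivial.
  have hcard : ∀ c : ℂ, (1 / 2 ^ Fintype.card (K × K) : ℂ) * ∑ _g : K × K → Bool, c = c := by
    intro c
    rw [Finset.sum_const, Finset.card_univ, Fintype.card_fun, Fintype.card_bool, nsmul_eq_mul]
    push_cast
    field_simp
  congr 1
  · congr 1
    · rw [← (Equiv.arrowCongr (Fintype.equivFin K).symm (Equiv.refl Bool)).sum_comp, ← sum_testBit]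
      refine Finset.sum_congr rfl fun v _ => ?_
      have hv1 : v.1.testBit (Fintype.card K) = false := Nat.testBit_lt_two_pow v.2
      have hv2 : v.1.testBit (Fintype.card K + 1) = false :=
        Nat.testBit_lt_two_pow (v.2.trans (Nat.pow_lt_pow_right (by norm_num) (by omega)))
      simp only [hv1, hv2, Bool.and_false, basisUnitary_false, Bool.or_false, Bool.not_false,
        Bool.and_true]
      rw [hcard]
      rfl
    · have hv : ∀ v : Fin (2 ^ Fintype.card K),
          (2 ^ Fintype.card K + v.1).testBit (Fintype.card K) = true ∧
          (2 ^ Fintype.card K + v.1).testBit (Fintype.card K + 1) = false := by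
        intro v
        refine ⟨?_, Nat.testBit_lt_two_pow ?_⟩
        · rw [Nat.testBit_two_pow_add_eq, Nat.testBit_lt_two_pow v.2]; rfl
        · have := v.2
          rw [pow_succ]; omega
      simp only [fun v => (hv v).1, fun v => (hv v).2, Bool.or_false, Bool.not_true, Bool.and_false,
        Bool.and_true, basisUnitary_true]
      rw [Finset.sum_const, Finset.card_univ, Fintype.card_fin, nsmul_eq_mul]
      push_cast
      ring
  · have hv1 : (2 ^ (Fintype.card K + 1)).testBit (Fintype.card K) = false :=
      Nat.testBit_two_pow_of_ne (by omega)
    simp only [hv1, Nat.testBit_two_pow_self, Bool.and_false, basisUnitary_false, Bool.or_true,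
      Bool.not_true, hcard]

end Program

/-! ### Restriction to the wires in use -/

section Restriction

lemma Circuit.exists_mapWires {W W' : Type} (ι : W ↪ W') (C : Circuit W')
    (h : ∀ g ∈ C, ∀ i, ∃ w, ι w = g.wires i) : ∃ C' : Circuit W, C = C'.mapWires ι := by
  induction C with
  | nil => exact ⟨[], rfl⟩
  | cons g C ih =>
    obtain ⟨C', hC'⟩ := ih fun g' hg' => h g' (List.mem_cons_of_mem _ hg')
    choose f hf using h g List.mem_cons_self
    have hinj : Injective f := fun i j hij => g.wires.injective (by rw [← hf, ← hf, hij])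
    refine ⟨⟨g.gate, ⟨f, hinj⟩⟩ :: C', ?_⟩
    have hg : g = ⟨g.gate, (⟨f, hinj⟩ : Fin g.gate.arity ↪ W).trans ι⟩ := by
      obtain ⟨gate, wires⟩ := g
      congr 1
      ext i
      exact (hf i).symm
    rw [hC']
    exact congrArg (· :: _) hg

/-- Only cut wires and wires of some gate are kept. The size bound by arities controls the
initializations and measurements, which would otherwise scale with the number of all wires. -/
lemma Circuit.exists_restriction {K W : Type} [Fintype K] [DecidableEq W] (C : Circuit W)
    {cut : K → W} (hcut : Injective cut) :
    ∃ (t : ℕ) (ι : Fin t ↪ W) (C' : Circuit (Fin t)) (l : K ↪ Fin t), C = C'.mapWires ι ∧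
      ι ∘ l = cut ∧ t ≤ Fintype.card K + (C.map fun g => g.gate.arity).sum := by
  have hS : ∃ S : Finset W, (∀ k, cut k ∈ S) ∧ (∀ g ∈ C, ∀ i, g.wires i ∈ S) ∧
      S.card ≤ Fintype.card K + (C.map fun g => g.gate.arity).sum := by
    clear hcut
    induction C with
    | nil =>
      exact ⟨Finset.univ.image cut, by simp, by simp,
        Finset.card_image_le.trans (by simp)⟩
    | cons g C ih =>
      obtain ⟨S, h1, h2, h3⟩ := ih
      refine ⟨Finset.univ.image g.wires ∪ S, fun k => Finset.mem_union_right _ (h1 k), ?_, ?_⟩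
      · intro g' hg' i
        rcases List.mem_cons.mp hg' with rfl | hg'
        · exact Finset.mem_union_left _ (Finset.mem_image_of_mem _ (Finset.mem_univ i))
        · exact Finset.mem_union_right _ (h2 g' hg' i)
      · refine (Finset.card_union_le _ _).trans ?_
        have : (Finset.univ.image g.wires).card ≤ g.gate.arity := by
          simpa using Finset.card_image_le (s := (Finset.univ : Finset (Fin g.gate.arity)))
            (f := g.wires)
        rw [List.map_cons, List.sum_cons]
        omega
  obtain ⟨S, h1, h2, h3⟩ := hS
  let ι : Fin S.card ↪ W := S.equivFin.symm.toEmbedding.trans (Embedding.subtype _)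
  have hι : ∀ w (hw : w ∈ S), ι (S.equivFin ⟨w, hw⟩) = w := fun w hw => by simp [ι]
  obtain ⟨C', hC'⟩ := C.exists_mapWires ι fun g hg i => ⟨_, hι _ (h2 g hg i)⟩
  refine ⟨S.card, ι, C', ⟨fun k => S.equivFin ⟨cut k, h1 k⟩, fun k k' h => hcut ?_⟩, hC', ?_, h3⟩
  · simpa using h
  · funext k
    exact hι _ (h1 k)

/-- Wires outside the image of `ι` stay in state 0, so they need no qubit and their outcome is
known. -/
lemma applyOn_run_mapWires {K W : Type} [Fintype W] [DecidableEq W] {t : ℕ} (ι : Fin t ↪ W)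
    (C : Circuit (Fin t)) (l : K ↪ Fin t) (Φ : Op K →ₗ[ℂ] Op K) (a : W → Bool) :
    applyOn Φ (ι ∘ l) ((C.mapWires ι).run (basisState fun _ => false)) a a =
      if extend ι (a ∘ ι) (fun _ => false) = a then
        applyOn Φ l (C.run (basisState fun _ => false)) (a ∘ ι) (a ∘ ι) else 0 := by
  rw [apply_eq_block ι.injective (applyOn Φ (ι ∘ l) _) a a, block_applyOn_comp ι.injective l.injective,
    Circuit.block_run, block_basisState_zero ι.injective]
  simp only [and_self]
  split_ifs
  · rfl
  · rw [← Circuit.runLin_apply, map_zero, ← applyOnLin_apply, map_zero]; rfl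

lemma run_mapWires_embed {K W : Type} [Fintype W] [DecidableEq W] [Fintype K] [DecidableEq K] {t : ℕ}
    (ι : Fin t ↪ W) (C : Circuit (Fin t)) (l : K ↪ Fin t) (V : Op K) (y : K → Bool) (b : W → Bool) :
    (C.mapWires ι).run (embed (ι ∘ l) (conj V (basisState y))) b b =
      if extend ι (b ∘ ι) (fun _ => false) = b then
        C.run (embed l (conj V (basisState y))) (b ∘ ι) (b ∘ ι) else 0 := by
  rw [apply_eq_block ι.injective ((C.mapWires ι).run _) b b, Circuit.block_run,
    ← applyOn_basisState (ι.injective.comp l.injective), block_applyOn_comp ι.injective l.injective,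
    extend_comp_extend ι.injective l.injective]
  have h : (fun _ : W => false) ∘ ι = fun _ => false := rfl
  rw [h, block_basisState ι.injective]
  simp only [and_self]
  split_ifs
  · rw [applyOn_basisState l.injective]
  · rw [← applyOnLin_apply, map_zero, ← Circuit.runLin_apply, map_zero]; rfl

end Restriction

/-! ### The output law of the program equals the cutting law -/

section Law

variable {n tA tB q : ℕ} {A B : Finset (Fin n)}

/-- The bit that holds the outcome of a wire. -/
def outputAddr (ιA : Fin tA ↪ A) (ιB : Fin tB ↪ B) (w : Fin n) : Addr ↥(A ∩ B) tA tB :=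
  if h : w ∈ B then extend ιB Addr.right (fun _ => .zero) ⟨w, h⟩
  else if h' : w ∈ A then extend ιA Addr.left (fun _ => .zero) ⟨w, h'⟩ else .zero

lemma outputAddr_cases (ιA : Fin tA ↪ A) (ιB : Fin tB ↪ B) (w : Fin n) :
    outputAddr ιA ιB w = .zero ∨ (∃ i, outputAddr ιA ιB w = .left i) ∨
      ∃ j, outputAddr ιA ιB w = .right j := by
  unfold outputAddr
  split_ifs with h1 h2
  · by_cases h : ∃ j, ιB j = ⟨w, h1⟩
    · obtain ⟨j, hj⟩ := h
      exact Or.inr (Or.inr ⟨j, by rw [← hj, ιB.injective.extend_apply]⟩)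
    · exact Or.inl (extend_apply' _ _ _ h)
  · by_cases h : ∃ j, ιA j = ⟨w, h2⟩
    · obtain ⟨j, hj⟩ := h
      exact Or.inr (Or.inl ⟨j, by rw [← hj, ιA.injective.extend_apply]⟩)
    · exact Or.inl (extend_apply' _ _ _ h)
  · exact Or.inl rfl

lemma outputAddr_read (ιA : Fin tA ↪ A) (ιB : Fin tB ↪ B) (α : Fin tA → Bool) (β : Fin tB → Bool) :
    (fun w => extend Addr.right β (extend Addr.left α fun _ => false) (outputAddr ιA ιB w)) =
      assemble (extend ιA α fun _ => false) (extend ιB β fun _ => false) := by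
  have hr : Injective (Addr.right : Fin tB → Addr ↥(A ∩ B) tA tB) := fun i j h => by simpa using h
  have hzero : extend (Addr.right : Fin tB → Addr ↥(A ∩ B) tA tB) β
      (extend Addr.left α fun _ => false) .zero = false := by
    rw [extend_apply' _ _ _ (by rintro ⟨i, hi⟩; cases hi),
      extend_apply' _ _ _ (by rintro ⟨i, hi⟩; cases hi)]
  funext w
  unfold outputAddr assemble
  split_ifs with h1 h2
  · by_cases h : ∃ j, ιB j = ⟨w, h1⟩
    · obtain ⟨j, hj⟩ := h
      rw [← hj, ιB.injective.extend_apply, ιB.injective.extend_apply, hr.extend_apply]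
    · rw [extend_apply' _ _ _ h, extend_apply' _ _ _ h, hzero]
  · by_cases h : ∃ j, ιA j = ⟨w, h2⟩
    · obtain ⟨j, hj⟩ := h
      rw [← hj, ιA.injective.extend_apply, ιA.injective.extend_apply,
        extend_apply' _ _ _ (by rintro ⟨i, hi⟩; cases hi), left_injective.extend_apply]
    · rw [extend_apply' _ _ _ h, extend_apply' _ _ _ h, hzero]
  · exact hzero

variable (CA : Circuit (Fin tA)) (CB : Circuit (Fin tB)) (lA : ↥(A ∩ B) ↪ Fin tA)
  (lB : ↥(A ∩ B) ↪ Fin tB) (ιA : Fin tA ↪ A) (ιB : Fin tB ↪ B)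

/-- Outcomes on the full sets `A` and `B` have weight zero unless they vanish on untouched wires, so
the sums collapse to those over the restricted registers. The shift `r` covers both values of z. -/
lemma branchWeight_eq (hA : ιA ∘ lA = cutInLeft) (hB : ιB ∘ lB = cutInRight) {V : Op ↥(A ∩ B)}
    (hV : V ∈ Matrix.unitaryGroup (↥(A ∩ B) → Bool) ℂ) (z : Bool) (x : Fin n → Bool)
    (r : ↥(A ∩ B) → Bool) :
    branchWeight CA CB lA lB (outputAddr ιA ιB) (z, x) z V r =
      ((∑ a, ∑ b, (if assemble a b = x then leftProb (CA.mapWires ιA) V a *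
        rightProb (CB.mapWires ιB) V (fun k => xor (r k) (a (cutInLeft k))) b else 0) : ℝ) : ℂ) := by
  have hl : ∀ a, ((leftProb (CA.mapWires ιA) V a : ℝ) : ℂ) =
      if extend ιA (a ∘ ιA) (fun _ => false) = a then leftWeight CA lA V (a ∘ ιA) else 0 := by
    intro a
    rw [(leftProb_nonneg_and_eq _ hV a).2, ← hA, applyOn_run_mapWires]
    rfl
  have hr : ∀ y b, ((rightProb (CB.mapWires ιB) V y b : ℝ) : ℂ) =
      if extend ιB (b ∘ ιB) (fun _ => false) = b then rightWeight CB lB V y (b ∘ ιB) else 0 := by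
    intro y b
    rw [(rightProb_nonneg_and_eq _ hV y b).2, ← hB, run_mapWires_embed]
    rfl
  have hsum : ∀ a, (∑ b, (if assemble a b = x then ((leftProb (CA.mapWires ιA) V a : ℝ) : ℂ) *
        ((rightProb (CB.mapWires ιB) V (fun k => xor (r k) (a (cutInLeft k))) b : ℝ) : ℂ) else 0)) =
      if extend ιA (a ∘ ιA) (fun _ => false) = a then leftWeight CA lA V (a ∘ ιA) *
        ∑ β : Fin tB → Bool, (if assemble a (extend ιB β fun _ => false) = x then
          rightWeight CB lB V (fun k => xor (r k) (a (cutInLeft k))) β else 0) else 0 := by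
    intro a
    have h1 := sum_ite_extend_eq ιB.injective (fun _ => false) fun b => if assemble a b = x then
      rightWeight CB lB V (fun k => xor (r k) (a (cutInLeft k))) (b ∘ ιB) else 0
    simp only [extend_comp_eq ιB.injective] at h1
    rw [← h1]
    simp only [hl, hr]
    split_ifs with ha
    · rw [Finset.mul_sum]
      refine Finset.sum_congr rfl fun b _ => ?_
      split_ifs <;> simp
    · simp
  push_cast
  simp only [apply_ite (Complex.ofReal), Complex.ofReal_mul, Complex.ofReal_zero, hsum]
  rw [sum_ite_extend_eq ιA.injective (fun _ => false) fun a => leftWeight CA lA V (a ∘ ιA) *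
        ∑ β : Fin tB → Bool, (if assemble a (extend ιB β fun _ => false) = x then
          rightWeight CB lB V (fun k => xor (r k) (a (cutInLeft k))) β else 0)]
  refine Finset.sum_congr rfl fun α _ => ?_
  rw [extend_comp_eq ιA.injective]
  congr 1
  refine Finset.sum_congr rfl fun β _ => ?_
  rw [outputAddr_read]
  simp only [Prod.mk.injEq, true_and]
  have hcut : ∀ k, extend ιA α (fun _ => false) (cutInLeft k) = α (lA k) := by
    intro k
    rw [← hA, comp_apply, ιA.injective.extend_apply]
  simp only [hcut]

lemma branchWeight_eq_zero {z z' : Bool} (hz : z ≠ z') (x : Fin n → Bool) (V : Op ↥(A ∩ B))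
    (r : ↥(A ∩ B) → Bool) :
    branchWeight CA CB lA lB (outputAddr ιA ιB) (z', x) z V r = 0 := by
  refine Finset.sum_eq_zero fun α _ => ?_
  simp [hz]

/-- The program outputs the sign and the outcomes with the law of the cutting procedure. -/
lemma cuttingProgram_samples (hA : ιA ∘ lA = cutInLeft) (hB : ιB ∘ lB = cutInRight)
    (jA : Fin tA ↪ Fin q) (jB : Fin tB ↪ Fin q) :
    (cuttingProgram CA CB lA lB jA jB (outputAddr ιA ιB)).Samples
      (cuttingPMF (CA.mapWires ιA) (CB.mapWires ιB)) := by
  intro μ₀ ρ hρ o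
  refine (cuttingProgram_outputProb CA CB lA lB jA jB (outputAddr ιA ιB)
    (outputAddr_cases ιA ιB) μ₀ ρ o).trans ?_
  rw [hρ.trace_eq_one, mul_one, cuttingPMF_toReal]
  have h1 : (1 : Op ↥(A ∩ B)) ∈ Matrix.unitaryGroup (↥(A ∩ B) → Bool) ℂ := one_mem _
  obtain ⟨z, x⟩ := o
  cases z
  · have hc : ∀ {V : Op ↥(A ∩ B)}, V ∈ Matrix.unitaryGroup (↥(A ∩ B) → Bool) ℂ →
        branchWeight CA CB lA lB (outputAddr ιA ιB) (false, x) false V (fun _ => false) =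
          ((cutProb (CA.mapWires ιA) (CB.mapWires ιB) V x : ℝ) : ℂ) := by
      intro V hV
      rw [branchWeight_eq CA CB lA lB ιA ιB hA hB hV]
      simp only [Bool.false_xor]
      rfl
    have hg := fun g : ↥(A ∩ B) × ↥(A ∩ B) → Bool => hc (isClifford_graphUnitary g).1
    simp only [branchWeight_eq_zero CA CB lA lB ιA ιB (show true ≠ false by decide), hc h1, hg,
      Finset.sum_const_zero, zero_add]
    -- Here the uniform Clifford of the procedure is exchanged for the bases that the program
    -- samples.
    have key := cliffordMean_cutProb_eq_graph (CA.mapWires ιA) (CB.mapWires ιB) x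
    have hlaw := cuttingLaw_false (CA.mapWires ιA) (CB.mapWires ιB) x
    rw [div_mul_eq_mul_div, key] at hlaw
    rw [hlaw, Fintype.card_coe]
    push_cast
    ring
  · simp only [branchWeight_eq_zero CA CB lA lB ιA ιB (show false ≠ true by decide),
      Finset.sum_const_zero, mul_zero, add_zero]
    rw [cuttingLaw_true, Fintype.card_coe]
    have hd : ∑ r, branchWeight CA CB lA lB (outputAddr ιA ιB) (true, x) true 1 r =
        ((discardProb (CA.mapWires ιA) (CB.mapWires ιB) x : ℝ) : ℂ) := by
      rw [Finset.sum_congr rfl fun r _ => branchWeight_eq CA CB lA lB ιA ιB hA hB h1 true x r,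
        ← Complex.ofReal_sum, discardProb]
      refine congrArg _ ?_
      rw [Finset.sum_comm]
      conv_rhs => rw [Finset.sum_comm]
      refine Finset.sum_congr rfl fun a _ => ?_
      -- For each fixed outcome `a`, adding its cut bits permutes the prepared strings, so their sum
      -- is unchanged.
      let τ : (↥(A ∩ B) → Bool) ≃ (↥(A ∩ B) → Bool) :=
        { toFun := fun r k => xor (r k) (a (cutInLeft k))
          invFun := fun r k => xor (r k) (a (cutInLeft k))
          left_inv := fun r => by funext k; simp
          right_inv := fun r => by funext k; simp }
      exact τ.sum_comp fun y => ∑ b, (if assemble a b = x then leftProb (CA.mapWires ιA) 1 a *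
        rightProb (CB.mapWires ιB) 1 y b else 0)
    rw [hd]
    push_cast
    ring

end Law

/-! ### Gates and running time of the program -/

section Time

variable {K : Type} [Fintype K] [DecidableEq K] {q n tA tB s : ℕ}

lemma filterMap_circuitCode (C : Circuit (Fin q)) :
    (circuitCode s C).filterMap Instr.appliedGate = C.map PlacedGate.gate := by
  induction C with
  | nil => rfl
  | cons g C ih =>
    simp only [circuitCode, List.map_cons] at ih ⊢
    rw [List.filterMap_cons_some (f := Instr.appliedGate) (b := g.gate) rfl, ih]

lemma Circuit.map_gate_mapWires {W W' : Type} (ι : W ↪ W') (C : Circuit W) :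
    (C.mapWires ι).map PlacedGate.gate = C.map PlacedGate.gate := by
  simp [Circuit.mapWires]

lemma filterMap_flatMap_eq_nil {α : Type} {c : α → List (Instr q s)} (l : List α)
    (h : ∀ x, (c x).filterMap Instr.appliedGate = []) :
    (l.flatMap c).filterMap Instr.appliedGate = [] := by
  rw [List.filterMap_flatMap]
  simp [h]

lemma filterMap_logic {α : Type} (g : Bool → Bool → Bool) (x y z : α → Fin s) (l : List α) :
    (l.map fun k => (.logic g (x k) (y k) (z k) : Instr q s)).filterMap Instr.appliedGate = [] := by
  rw [List.filterMap_eq_nil_iff]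
  intro I hI
  obtain ⟨x, _, rfl⟩ := List.mem_map.mp hI
  rfl

lemma pairCode_gates (i : Fin s) (c : K ↪ Fin q) (v w : K) :
    (pairCode i c v w).filterMap Instr.appliedGate = [] := by
  unfold pairCode
  split_ifs <;> simp [Instr.appliedGate]

lemma pairCodeInv_gates (i : Fin s) (c : K ↪ Fin q) (v w : K) :
    (pairCodeInv i c v w).filterMap Instr.appliedGate = [] := by
  unfold pairCodeInv
  split_ifs
  · simp [Instr.appliedGate]
  · exact pairCode_gates i c v w

lemma cuttingProgram_appliedGates (CA : Circuit (Fin tA)) (CB : Circuit (Fin tB)) (lA : K ↪ Fin tA)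
    (lB : K ↪ Fin tB) (jA : Fin tA ↪ Fin q) (jB : Fin tB ↪ Fin q) (out : Fin n → Addr K tA tB) :
    (cuttingProgram CA CB lA lB jA jB out).appliedGates =
      CA.map PlacedGate.gate ++ CB.map PlacedGate.gate := by
  have h1 : (sampleCode (q := q) (K := K) (tA := tA) (tB := tB)).filterMap Instr.appliedGate = [] := by
    simp only [sampleCode, List.filterMap_append, filterMap_logic]
    rfl
  have hgi : ∀ {s : ℕ} (g : K × K → Fin s) (c : K ↪ Fin q),
      (graphCodeInv g c).filterMap Instr.appliedGate = [] := fun g c =>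
    filterMap_flatMap_eq_nil _ fun ij => pairCodeInv_gates _ _ _ _
  have hg : ∀ {s : ℕ} (g : K × K → Fin s) (c : K ↪ Fin q),
      (graphCode g c).filterMap Instr.appliedGate = [] := fun g c =>
    filterMap_flatMap_eq_nil _ fun ij => pairCode_gates _ _ _ _
  have hh : ∀ {s : ℕ} (i : Fin s) (c : K → Fin q),
      (hadamardCode i c).filterMap Instr.appliedGate = [] := fun i c =>
    filterMap_flatMap_eq_nil _ fun _ => rfl
  have hf : ∀ {s : ℕ} (y : K → Fin s) (c : K → Fin q),
      (flipCode y c).filterMap Instr.appliedGate = [] := fun i c =>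
    filterMap_flatMap_eq_nil _ fun _ => rfl
  have hr : ∀ {s t : ℕ} (e : Fin t → Fin q), (resetCode s e).filterMap Instr.appliedGate = [] :=
    fun e => filterMap_flatMap_eq_nil _ fun _ => rfl
  have hm : ∀ {s t : ℕ} (e : Fin t → Fin q) (m : Fin t → Fin s),
      (measureCode e m).filterMap Instr.appliedGate = [] := by
    intro s t e m
    rw [List.filterMap_eq_nil_iff]
    intro I hI
    obtain ⟨i, rfl⟩ := List.mem_ofFn.mp hI
    rfl
  have h2 : (leftCode (K := K) tB CA lA jA).filterMap Instr.appliedGate = CA.map PlacedGate.gate := by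
    simp only [leftCode, List.filterMap_append, filterMap_logic, hgi, hh, hr, hm,
      filterMap_circuitCode, Circuit.map_gate_mapWires, List.append_nil, List.nil_append]
  have h3 : (rightCode (K := K) tA CB lB jB).filterMap Instr.appliedGate = CB.map PlacedGate.gate := by
    simp only [rightCode, List.filterMap_append, hg, hh, hr, hm, hf,
      filterMap_circuitCode, Circuit.map_gate_mapWires, List.append_nil, List.nil_append]
  have h : (sampleCode ++ (leftCode tB CA lA jA ++ rightCode tA CB lB jB)).filterMap
      Instr.appliedGate = CA.map PlacedGate.gate ++ CB.map PlacedGate.gate := by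
    rw [List.filterMap_append, List.filterMap_append, h1, h2, h3, List.nil_append]
  exact h

/-- The total time of a list of operations, for a given time of a single one. -/
def totalTime (τ : Instr q s → ℕ) (L : List (Instr q s)) : ℕ := (L.map τ).sum

lemma totalTime_append (τ : Instr q s → ℕ) (L L' : List (Instr q s)) :
    totalTime τ (L ++ L') = totalTime τ L + totalTime τ L' := by simp [totalTime]

lemma totalTime_map_le {α : Type} {τ : Instr q s → ℕ} {c : α → Instr q s} {b : ℕ} (l : List α)
    (h : ∀ x, τ (c x) ≤ b) : totalTime τ (l.map c) ≤ b * l.length := by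
  induction l with
  | nil => simp [totalTime]
  | cons x l ih =>
    simp only [totalTime, List.map_cons, List.sum_cons, List.length_cons] at ih ⊢
    have := h x
    rw [mul_add, mul_one]
    omega

lemma totalTime_flatMap_le {α : Type} {τ : Instr q s → ℕ} {c : α → List (Instr q s)} {b : ℕ}
    (l : List α) (h : ∀ x, totalTime τ (c x) ≤ b) : totalTime τ (l.flatMap c) ≤ b * l.length := by
  induction l with
  | nil => simp [totalTime]
  | cons x l ih =>
    rw [List.flatMap_cons, totalTime_append, List.length_cons]
    have := h x
    rw [mul_add, mul_one]
    omega

/-- The time `τ` of operations, with time `a` for initializations and measurements. -/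
def Instr.cost (a : ℕ) : Instr q s → ℕ
  | .reset _ => a
  | .measure _ _ => a
  | .uniform _ b _ _ _ => b + 1
  | _ => 1

lemma gateTime_eq_cost (I : Instr q s) : I.gateTime = I.cost 0 := by cases I <;> rfl

lemma time_eq_cost (I : Instr q s) : I.time = I.cost 1 := by cases I <;> rfl

lemma totalTime_pairCode (a : ℕ) (i : Fin s) (c : K ↪ Fin q) (v w : K) :
    totalTime (Instr.cost a) (pairCode i c v w) ≤ 7 := by
  unfold pairCode
  split_ifs <;> simp [totalTime, Instr.cost]

lemma totalTime_pairCodeInv (a : ℕ) (i : Fin s) (c : K ↪ Fin q) (v w : K) :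
    totalTime (Instr.cost a) (pairCodeInv i c v w) ≤ 7 := by
  unfold pairCodeInv
  split_ifs
  · simp [totalTime, Instr.cost]
  · exact totalTime_pairCode a i c v w

/-- With κ ≤ κ², sampling costs at most 4κ² + 6, the first basis change and the xor 9κ², the flips
and the second basis change 12κ². Every register qubit is reset once and measured once. -/
lemma cuttingProgram_cost_le (CA : Circuit (Fin tA)) (CB : Circuit (Fin tB)) (lA : K ↪ Fin tA)
    (lB : K ↪ Fin tB) (jA : Fin tA ↪ Fin q) (jB : Fin tB ↪ Fin q) (out : Fin n → Addr K tA tB)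
    (a : ℕ) : totalTime (Instr.cost a) (cuttingProgram CA CB lA lB jA jB out).code ≤
      CA.length + CB.length + 2 * a * (tA + tB) + 25 * Fintype.card K ^ 2 + 6 := by
  have hK : (Finset.univ : Finset K).toList.length = Fintype.card K := by simp
  have hKK : (Finset.univ : Finset (K × K)).toList.length = Fintype.card K ^ 2 := by
    simp [Fintype.card_prod, pow_two]
  have hle : Fintype.card K ≤ Fintype.card K ^ 2 := Nat.le_self_pow two_ne_zero _
  have hc : ∀ {s : ℕ} (C : Circuit (Fin q)), totalTime (Instr.cost a) (circuitCode s C) ≤ C.length := by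
    intro s C
    have := totalTime_map_le (τ := Instr.cost a) (c := fun g : PlacedGate (Fin q) =>
      (.gate g.gate g.wires : Instr q s)) (b := 1) C fun x => le_rfl
    simpa [circuitCode] using this
  have hlen : ∀ {t : ℕ} (j : Fin t ↪ Fin q) (C : Circuit (Fin t)),
      (C.mapWires j).length = C.length := fun j C => by simp [Circuit.mapWires]
  have hlog : ∀ {s : ℕ} {α : Type} [Fintype α] (g : Bool → Bool → Bool) (x y z : α → Fin s),
      totalTime (Instr.cost (q := q) a) ((Finset.univ : Finset α).toList.map fun k =>
        .logic g (x k) (y k) (z k)) ≤ 1 * (Finset.univ : Finset α).toList.length :=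
    fun g x y z => totalTime_map_le _ fun _ => le_rfl
  have hgi : ∀ {s : ℕ} (g : K × K → Fin s) (c : K ↪ Fin q),
      totalTime (Instr.cost a) (graphCodeInv g c) ≤ 7 * (Finset.univ : Finset (K × K)).toList.length :=
    fun g c => totalTime_flatMap_le _ fun ij => totalTime_pairCodeInv _ _ _ _ _
  have hg : ∀ {s : ℕ} (g : K × K → Fin s) (c : K ↪ Fin q),
      totalTime (Instr.cost a) (graphCode g c) ≤ 7 * (Finset.univ : Finset (K × K)).toList.length :=
    fun g c => totalTime_flatMap_le _ fun ij => totalTime_pairCode _ _ _ _ _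
  have hh : ∀ {s : ℕ} (i : Fin s) (c : K → Fin q), totalTime (Instr.cost a) (hadamardCode i c) ≤
      1 * (Finset.univ : Finset K).toList.length :=
    fun i c => totalTime_flatMap_le _ fun _ => by simp [totalTime, Instr.cost]
  have hf : ∀ {s : ℕ} (y : K → Fin s) (c : K → Fin q), totalTime (Instr.cost a) (flipCode y c) ≤
      4 * (Finset.univ : Finset K).toList.length :=
    fun i c => totalTime_flatMap_le _ fun _ => by simp [totalTime, Instr.cost]
  have hr : ∀ {s t : ℕ} (e : Fin t → Fin q), totalTime (Instr.cost a) (resetCode s e) ≤ a * t := by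
    intro s t e
    have := totalTime_flatMap_le (τ := Instr.cost a) (c := fun i : Fin t => [(.reset (e i) : Instr q s)])
      (b := a) (List.finRange t) fun _ => by simp [totalTime, Instr.cost]
    simpa [resetCode] using this
  have hm : ∀ {s t : ℕ} (e : Fin t → Fin q) (m : Fin t → Fin s),
      totalTime (Instr.cost a) (measureCode e m) ≤ a * t := by
    intro s t e m
    have := totalTime_map_le (τ := Instr.cost a) (c := fun i : Fin t => (.measure (e i) (m i) : Instr q s))
      (b := a) (List.finRange t) fun _ => le_rfl
    rw [← List.ofFn_eq_map] at this
    simpa [measureCode] using this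
  rw [hKK] at hgi hg
  rw [hK] at hh hf
  have h1 : totalTime (Instr.cost a) (sampleCode (q := q) (K := K) (tA := tA) (tB := tB)) ≤
      4 * Fintype.card K ^ 2 + 6 := by
    simp only [sampleCode, totalTime_append]
    have e1 := hlog and (fun k : K => (addr (wireBit k) : Fin (memorySize K tA tB)))
      (fun _ => addr .sign) fun k => addr (wireBit k)
    have e2 := hlog and (fun ij : K × K => (addr (.edge ij) : Fin (memorySize K tA tB)))
      (fun _ => addr graphBit) fun ij => addr (.edge ij)
    rw [hK] at e1
    rw [hKK] at e2
    simp only [totalTime, List.map_cons, List.map_nil, List.sum_cons, List.sum_nil, Instr.cost] at e1 e2 ⊢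
    rw [Fintype.card_prod, ← pow_two]
    omega
  have h2 : totalTime (Instr.cost a) (leftCode (K := K) tB CA lA jA) ≤
      CA.length + 2 * a * tA + 9 * Fintype.card K ^ 2 := by
    simp only [leftCode, totalTime_append]
    have e1 := hlog xor (fun k : K => (addr (wireBit k) : Fin (memorySize K tA tB)))
      (fun k => addr (.left (lA k))) fun k => addr (wireBit k)
    have e2 := hr (s := memorySize K tA tB) jA
    have e3 := hm jA fun i => (addr (.left i) : Fin (memorySize K tA tB))
    have e4 := hc (s := memorySize K tA tB) (CA.mapWires jA)
    have e5 := hgi (fun ij => (addr (.edge ij) : Fin (memorySize K tA tB))) (lA.trans jA)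
    have e6 := hh (addr graphBit : Fin (memorySize K tA tB)) (lA.trans jA)
    rw [hK] at e1
    rw [hlen] at e4
    have e7 : 2 * a * tA = a * tA + a * tA := by ring
    omega
  have h3 : totalTime (Instr.cost a) (rightCode (K := K) tA CB lB jB) ≤
      CB.length + 2 * a * tB + 12 * Fintype.card K ^ 2 := by
    simp only [rightCode, totalTime_append]
    have e1 := hf (fun k : K => (addr (wireBit k) : Fin (memorySize K tA tB))) (lB.trans jB)
    have e2 := hr (s := memorySize K tA tB) jB
    have e3 := hm jB fun i => (addr (.right i) : Fin (memorySize K tA tB))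
    have e4 := hc (s := memorySize K tA tB) (CB.mapWires jB)
    have e5 := hg (fun ij => (addr (.edge ij) : Fin (memorySize K tA tB))) (lB.trans jB)
    have e6 := hh (addr graphBit : Fin (memorySize K tA tB)) (lB.trans jB)
    rw [hlen] at e4
    have e7 : 2 * a * tB = a * tB + a * tB := by ring
    omega
  have h : totalTime (Instr.cost a) (sampleCode ++ (leftCode tB CA lA jA ++ rightCode tA CB lB jB)) ≤
      CA.length + CB.length + 2 * a * (tA + tB) + 25 * Fintype.card K ^ 2 + 6 := by
    rw [totalTime_append, totalTime_append, mul_add]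
    omega
  exact h

lemma Program.gateTime_eq {q n : ℕ} (P : Program q n) :
    P.gateTime = totalTime (Instr.cost 0) P.code := by
  rw [Program.gateTime, totalTime, funext gateTime_eq_cost]

lemma Program.time_eq {q n : ℕ} (P : Program q n) :
    P.time = totalTime (Instr.cost 1) P.code := by
  rw [Program.time, totalTime, funext time_eq_cost]

end Time

/-! ### Averaging independent runs -/

section Estimation

open MeasureTheory ProbabilityTheory

/-- Chebyshev's inequality for the mean of `N` independent samples of a bounded variable. -/
lemma one_sub_le_pi_abs_mean_sub_le {Ω : Type} [Fintype Ω] [MeasurableSpace Ω]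
    [MeasurableSingletonClass Ω] (p : PMF Ω) {Y : Ω → ℝ} {R ε δ : ℝ} (hY : ∀ o, |Y o| ≤ R)
    {N : ℕ} (hN : 0 < N) (hε : 0 < ε) (hδ : 0 ≤ δ) (h : R ^ 2 ≤ δ * (N * ε ^ 2)) :
    ENNReal.ofReal (1 - δ) ≤ Measure.pi (fun _ : Fin N => p.toMeasure)
      {ω | |(∑ i, Y (ω i)) / N - ∑ o, (p o).toReal * Y o| ≤ ε} := by
  have hN' : (0 : ℝ) < N := by exact_mod_cast hN
  set μ := Measure.pi fun _ : Fin N => p.toMeasure with hμ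
  set E := ∑ o, (p o).toReal * Y o with hE
  have hYm : AEStronglyMeasurable Y p.toMeasure := (measurable_of_finite Y).aestronglyMeasurable
  have hY2 : MemLp Y 2 p.toMeasure := MemLp.of_bound hYm R (by simpa using .of_forall hY)
  have hmean : ∫ o, Y o ∂p.toMeasure = E := by simp [PMF.integral_eq_sum, hE]
  have hvar : Var[Y; p.toMeasure] ≤ R ^ 2 := by
    refine (variance_le_expectation_sq hYm).trans ?_
    have : ∫ o, (Y ^ 2) o ∂p.toMeasure ≤ ∫ _, R ^ 2 ∂p.toMeasure := by
      refine integral_mono (.of_finite) (.of_finite) fun o => ?_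
      exact sq_le_sq.mpr ((hY o).trans (le_abs_self R))
    simpa using this
  let S : (Fin N → Ω) → ℝ := ∑ i, fun ω => Y (ω i)
  have hSa : ∀ ω, S ω = ∑ i, Y (ω i) := fun ω => by simp [S]
  have hS2 : MemLp S 2 μ := by
    refine MemLp.of_bound (measurable_of_finite S).aestronglyMeasurable (N * R) (.of_forall fun ω => ?_)
    rw [hSa, Real.norm_eq_abs]
    refine (Finset.abs_sum_le_sum_abs _ _).trans ((Finset.sum_le_sum fun i _ => hY (ω i)).trans ?_)
    simp
  have hSmean : ∫ ω, S ω ∂μ = N * E := by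
    simp_rw [hSa]
    rw [integral_finsetSum _ fun i _ => .of_finite]
    simp_rw [hμ, integral_comp_eval (μ := fun _ : Fin N => p.toMeasure) hYm, hmean]
    simp
  have hSvar : Var[S; μ] ≤ N * R ^ 2 := by
    have : Var[S; μ] = ∑ _ : Fin N, Var[Y; p.toMeasure] :=
      variance_sum_pi (μ := fun _ : Fin N => p.toMeasure) (X := fun _ => Y) fun _ => hY2
    rw [this, Finset.sum_const, Finset.card_univ, Fintype.card_fin, nsmul_eq_mul]
    gcongr
  have hcheb := meas_ge_le_variance_div_sq hS2 (c := N * ε) (by positivity)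
  rw [hSmean] at hcheb
  -- Independence makes the variance of the sum at most N R², so the quotient is at most R²/(N ε²).
  have hbad : Var[S; μ] / (N * ε) ^ 2 ≤ δ := by
    rw [div_le_iff₀ (by positivity)]
    nlinarith
  set G : Set (Fin N → Ω) := {ω | |(∑ i, Y (ω i)) / N - E| ≤ ε}
  have hG : Gᶜ ⊆ {ω | N * ε ≤ |S ω - N * E|} := by
    intro ω hω
    have hω' : ε < |(∑ i, Y (ω i)) / N - E| := not_le.mp hω
    have hrw : S ω - N * E = N * ((∑ i, Y (ω i)) / N - E) := by rw [hSa]; field_simp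
    rw [Set.mem_ofPred_eq, hrw, abs_mul, abs_of_pos hN']
    gcongr
  have hGc : μ Gᶜ ≤ ENNReal.ofReal δ :=
    (measure_mono hG).trans (hcheb.trans (ENNReal.ofReal_le_ofReal hbad))
  have hGm : MeasurableSet G := Set.toFinite G |>.measurableSet
  rw [prob_compl_eq_one_sub hGm] at hGc
  rw [ENNReal.ofReal_sub _ hδ, ENNReal.ofReal_one]
  -- Subtraction in `ENNReal` is truncated, so the bound is passed through the form 1 ≤ δ + μ G.
  exact tsub_le_iff_left.mpr (tsub_le_iff_right.mp hGc)

lemma abs_estimator_le {n κ : ℕ} {f : (Fin n → Bool) → ℝ} (hf : ∀ x, |f x| ≤ 1)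
    (o : Bool × (Fin n → Bool)) : |estimator κ f o| ≤ 2 ^ (κ + 1) + 1 := by
  have hs : |(if o.1 then -1 else 1 : ℝ)| = 1 := by split <;> simp
  rw [estimator, abs_mul, abs_mul, hs, abs_of_pos (by positivity), mul_one]
  exact mul_le_of_le_one_right (by positivity) (hf _)

end Estimation

/-! ### Assembly of the program and the estimation time -/

section Assembly

variable {n : ℕ} {A B : Finset (Fin n)}

/-- The cutting procedure is performed by a program that uses only the qubits touched by gates or
cut, and `O(κ²)` operations besides those of the circuits, the initializations and the
measurements. -/
lemma exists_cuttingProgram (CA : Circuit A) (CB : Circuit B) :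
    ∃ P : Program (max A.card B.card) n, P.Samples (cuttingPMF CA CB) ∧
      P.appliedGates = (CA.lift ++ CB.lift).map PlacedGate.gate ∧
      P.gateTime ≤ (CA.lift ++ CB.lift).length + 25 * (A ∩ B).card ^ 2 + 6 ∧
      P.time ≤ (CA.lift ++ CB.lift).length + 25 * (A ∩ B).card ^ 2 + 6 +
        2 * (2 * (A ∩ B).card + ((CA.lift ++ CB.lift).map fun g => g.gate.arity).sum) := by
  obtain ⟨tA, ιA, CA', lA, rfl, hA, htA⟩ :=
    Circuit.exists_restriction CA (cutInLeft_injective (A := A) (B := B))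
  obtain ⟨tB, ιB, CB', lB, rfl, hB, htB⟩ :=
    Circuit.exists_restriction CB (cutInRight_injective (A := A) (B := B))
  have hcA : tA ≤ max A.card B.card := by
    simpa using (Fintype.card_le_of_embedding ιA).trans_eq (Fintype.card_coe A) |>.trans
      (le_max_left _ B.card)
  have hcB : tB ≤ max A.card B.card := by
    simpa using (Fintype.card_le_of_embedding ιB).trans_eq (Fintype.card_coe B) |>.trans
      (le_max_right A.card _)
  -- Both registers occupy the first qubits of the device and overlap, so the larger of the two sets
  -- determines the number of qubits.
  have hcost := cuttingProgram_cost_le CA' CB' lA lB (Fin.castLEEmb hcA) (Fin.castLEEmb hcB)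
    (outputAddr ιA ιB)
  have hlA : (CA'.mapWires ιA).length = CA'.length := List.length_map _
  have hlB : (CB'.mapWires ιB).length = CB'.length := List.length_map _
  have hlift : ∀ {D : Finset (Fin n)} (C : Circuit D), C.lift.length = C.length :=
    fun C => List.length_map _
  have harity : ∀ {D : Finset (Fin n)} (C : Circuit D),
      (C.lift.map fun g => g.gate.arity).sum = (C.map fun g => g.gate.arity).sum := fun C => by
    simp [Circuit.lift, Function.comp_def]
  rw [Fintype.card_coe] at htA htB hcost
  refine ⟨_, cuttingProgram_samples CA' CB' lA lB ιA ιB hA hB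
    (Fin.castLEEmb hcA) (Fin.castLEEmb hcB), ?_, ?_, ?_⟩
  · rw [cuttingProgram_appliedGates, List.map_append, Circuit.lift_eq_mapWires,
      Circuit.lift_eq_mapWires]
    simp only [Circuit.map_gate_mapWires]
  · rw [Program.gateTime_eq, List.length_append, hlift, hlift, hlA, hlB]
    have := hcost 0
    omega
  · rw [Program.time_eq, List.length_append, List.map_append, List.sum_append, harity, harity,
      hlift, hlift, hlA, hlB]
    have := hcost 1
    omega

end Assembly

/-- The total time of the estimation, if a run takes at most `b (S + k²)` steps up to the bookkeeping. -/
lemma averagingTime_le {N t k S : ℕ} {δ ε : ℝ} (hN0 : 0 < N)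
    (hN : (N : ℝ) ≤ 10 * 4 ^ k / (δ * ε ^ 2)) (ht : t + 3 ≤ 29 * (S + k ^ 2)) :
    (averagingTime N t : ℝ) ≤ 290 / δ * (4 ^ k * (S + k ^ 2) / ε ^ 2) := by
  -- The final normalization is charged to the runs, as N ≥ 1.
  have h1 : averagingTime N t ≤ N * (t + 3) := by
    rw [averagingTime]; nlinarith
  calc (averagingTime N t : ℝ) ≤ (N * (t + 3) : ℕ) := by exact_mod_cast h1
    _ ≤ (N * (29 * (S + k ^ 2)) : ℕ) := by exact_mod_cast Nat.mul_le_mul_left N ht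
    _ = N * (29 * (S + k ^ 2)) := by push_cast; ring
    _ ≤ 10 * 4 ^ k / (δ * ε ^ 2) * (29 * (S + k ^ 2)) := by gcongr
    _ = 290 / δ * (4 ^ k * (S + k ^ 2) / ε ^ 2) := by
      rw [mul_comm δ, ← div_div]; ring

end CircuitCutting

end

theorem theorem1 (δ : ℝ) (hδ : 0 < δ) (hδ1 : δ < 1) :
    ∃ c : ℝ, 0 < c ∧
      ∀ (n m k : ℕ) (A B : Finset (Fin n)) (CA : Circuit A) (CB : Circuit B)
        (C : Circuit (Fin n)),
        C = CA.lift ++ CB.lift → C.length = m → 0 < m → (A ∩ B).card ≤ k →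
        ∃ (P : Program (max A.card B.card) n) (p : PMF (Bool × (Fin n → Bool))),
          -- `P` performs one run of the cutting procedure, using every gate of `C` once
          (∀ o, (p o).toReal = cuttingLaw CA CB o) ∧
          P.Samples p ∧
          P.appliedGates = C.map PlacedGate.gate ∧
          -- the output of a run is a bounded unbiased estimator
          (∀ f : (Fin n → Bool) → ℝ, (∀ x, |f x| ≤ 1) →
            (∀ o, |estimator (A ∩ B).card f o| ≤ 2 ^ (k + 1) + 1) ∧
            ((∑ o, (p o).toReal * estimator (A ∩ B).card f o : ℝ) : ℂ) = expectationValue C f) ∧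
          -- the mean of `N` independent runs is accurate, within the claimed time
          ∀ ε : ℝ, 0 < ε → ε ≤ 1 →
            ∃ N : ℕ, 0 < N ∧
              (∀ f : (Fin n → Bool) → ℝ, (∀ x, |f x| ≤ 1) →
                ENNReal.ofReal (1 - δ) ≤
                  MeasureTheory.Measure.pi (fun _ : Fin N => p.toMeasure)
                    {ω | ‖(((∑ i, estimator (A ∩ B).card f (ω i)) / N : ℝ) : ℂ)
                      - expectationValue C f‖ ≤ ε}) ∧
              (averagingTime N P.gateTime : ℝ) ≤ c * (4 ^ k * (m + k ^ 2) / ε ^ 2) ∧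
              ∀ r : ℕ, 1 ≤ r → (∀ g ∈ C, g.gate.arity ≤ r) →
                (averagingTime N P.time : ℝ) ≤ c * (4 ^ k * (r * m + k ^ 2) / ε ^ 2) := by
  -- 290 = 10 · 29: the factor 10 comes from the number of runs, 29 from the time of one run.
  refine ⟨290 / δ, by positivity, ?_⟩
  rintro n m k A B CA CB C rfl rfl hm hk
  obtain ⟨P, hP, hgates, hgt, ht⟩ := exists_cuttingProgram CA CB
  have hκ2 : (A ∩ B).card ^ 2 ≤ k ^ 2 := Nat.pow_le_pow_left hk 2
  have hmean : ∀ f : (Fin n → Bool) → ℝ,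
      ((∑ o, (cuttingPMF CA CB o).toReal * estimator (A ∩ B).card f o : ℝ) : ℂ)
        = expectationValue (CA.lift ++ CB.lift) f := fun f => by
    simp_rw [cuttingPMF_toReal]
    exact sum_cuttingLaw_mul_estimator CA CB f
  have hbound : ∀ f : (Fin n → Bool) → ℝ, (∀ x, |f x| ≤ 1) →
      ∀ o, |estimator (A ∩ B).card f o| ≤ 2 ^ (k + 1) + 1 := fun f hf o =>
    (abs_estimator_le hf o).trans (by gcongr; norm_num)
  refine ⟨P, cuttingPMF CA CB, cuttingPMF_toReal CA CB, hP, hgates,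
    fun f hf => ⟨hbound f hf, hmean f⟩, fun ε hε hε1 => ?_⟩
  -- Chebyshev's inequality asks for N ≥ R²/(δε²), and R = 2^(k+1) + 1 ≤ 3·2^k gives R² ≤ 9·4^k.
  have hpos : 0 < 9 * 4 ^ k / (δ * ε ^ 2) := by positivity
  have hN0 : 0 < ⌈9 * 4 ^ k / (δ * ε ^ 2)⌉₊ := Nat.ceil_pos.mpr hpos
  have hN : (⌈9 * 4 ^ k / (δ * ε ^ 2)⌉₊ : ℝ) ≤ 10 * 4 ^ k / (δ * ε ^ 2) := by
    -- Rounding up adds at most 1, which this absorbs, turning 9 into 10; δ < 1 and ε ≤ 1 enter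
    -- here.
    have h1 : 1 ≤ 4 ^ k / (δ * ε ^ 2) := by
      rw [one_le_div (by positivity)]
      calc δ * ε ^ 2 ≤ 1 * 1 := by
            gcongr
            exact pow_le_one₀ hε.le hε1
        _ ≤ 4 ^ k := by simpa using one_le_pow₀ (n := k) (by norm_num : (1 : ℝ) ≤ 4)
    calc (⌈9 * 4 ^ k / (δ * ε ^ 2)⌉₊ : ℝ) ≤ 9 * 4 ^ k / (δ * ε ^ 2) + 1 := (Nat.ceil_lt_add_one hpos.le).le
      _ ≤ 9 * 4 ^ k / (δ * ε ^ 2) + 4 ^ k / (δ * ε ^ 2) := by gcongr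
      _ = 10 * 4 ^ k / (δ * ε ^ 2) := by ring
  refine ⟨_, hN0, fun f hf => ?_, ?_, fun r hr hrg => ?_⟩
  · simp_rw [← hmean f, ← Complex.ofReal_sub, Complex.norm_real, Real.norm_eq_abs]
    refine one_sub_le_pi_abs_mean_sub_le _ (hbound f hf) hN0 hε hδ.le ?_
    have h4 : (2 : ℝ) ^ (k + 1) + 1 ≤ 3 * 2 ^ k := by
      have := one_le_pow₀ (n := k) (by norm_num : (1 : ℝ) ≤ 2)
      rw [pow_succ]; linarith
    calc ((2 : ℝ) ^ (k + 1) + 1) ^ 2 ≤ (3 * 2 ^ k) ^ 2 := by gcongr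
      _ = 9 * 4 ^ k := by rw [mul_pow, ← pow_mul, mul_comm k, pow_mul]; norm_num
      _ = δ * (9 * 4 ^ k / (δ * ε ^ 2) * ε ^ 2) := by field_simp
      _ ≤ _ := by gcongr; exact Nat.le_ceil _
  -- m + 25κ² + 6 + 3 ≤ 10m + 25k², since m ≥ 1.
  · exact averagingTime_le hN0 hN (by omega)
  · have hsum : ((CA.lift ++ CB.lift).map fun g => g.gate.arity).sum
        ≤ r * (CA.lift ++ CB.lift).length := by
      have := List.sum_le_card_nsmul ((CA.lift ++ CB.lift).map fun g => g.gate.arity) r (by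
        intro x hx
        obtain ⟨g, hg, rfl⟩ := List.mem_map.mp hx
        exact hrg g hg)
      simpa [mul_comm] using this
    have hrm : (CA.lift ++ CB.lift).length ≤ r * (CA.lift ++ CB.lift).length :=
      Nat.le_mul_of_pos_left _ hr
    have hκ : (A ∩ B).card ≤ (A ∩ B).card ^ 2 := Nat.le_self_pow two_ne_zero _
    -- Initializations and measurements add at most 4κ + 2rm, for a total of at most 12rm + 29k²;
    -- this is where 29 = 25 + 4 is needed.
    have := averagingTime_le (t := P.time) (S := r * (CA.lift ++ CB.lift).length) hN0 hN (by omega)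
    exact_mod_cast this
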